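/- Let $n\ge 1$, let $\Omega\subset\mathbb{R}^n$ be a bounded connected open set with boundary $\partial\Omega$ of class $C^\infty$ and outward unit normal $\nu$, and let $\varphi\in C^\infty(\overline{\Omega})$ be real-valued. Let $s>0$, $h>0$, $T\in\mathbb{R}$, $\Gamma(t)=T-t+h$, and $$\Phi(x,t)=\frac{s\,\varphi(x)}{\Gamma(t)},\qquad \eta=\tfrac12\partial_t\Phi+\tfrac14|\nabla\Phi|^2 .$$ For real-valued $f\in H^2(\Omega)$ define $$\mathcal{A}_\varphi f=-\nabla\Phi\cdot\nabla f-\tfrac12\,\Delta\Phi\, f,\qquad \mathcal{S}_\varphi f=-\Delta f-\eta f,\qquad \mathcal{S}'_\varphi f=-\partial_t\eta\, f .$$ Then for every $t<T+h$ (in particular, if $T>0$, for every $t\in[0,T]$) and every $f\in H^2(\Omega)$, the values of $f$ and $\nabla f$ on $\partial\Omega$ being taken in the sense of traces, with $\partial_n=\nu\cdot\nabla$ and with $\partial\Omega$ carrying its surface measure, all the integrals below converge absolutely and: (i) $$\int_\Omega \mathcal{A}_\varphi f\, f=-\frac12\int_{\partial\Omega}\partial_n\Phi\,|f|^2 ;$$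 (ii) $$\int_\Omega \mathcal{S}_\varphi f\, f=\int_\Omega|\nabla f|^2-\int_\Omega\eta|f|^2-\int_{\partial\Omega}\partial_n f\, f ;$$ (iii) $$\int_\Omega \mathcal{S}'_\varphi f\, f+2\int_\Omega \mathcal{S}_\varphi f\,\mathcal{A}_\varphi f=-2\int_\Omega\nabla f\cdot\nabla^2\Phi\,\nabla f-\int_\Omega(\nabla f\cdot\Delta\nabla\Phi)\, f-\frac{2}{\Gamma(t)}\int_\Omega\Big(\eta+\tfrac14|\nabla\Phi|^2+\tfrac{s}{4}\nabla\Phi\cdot\nabla^2\varphi\,\nabla\Phi\Big)|f|^2+B,$$ where $$B=2\int_{\partial\Omega}\partial_n f\,(\nabla\Phi\cdot\nabla f)-\int_{\partial\Omega}\partial_n\Phi\,|\nabla f|^2+\int_{\partial\Omega}\partial_n f\,\Delta\Phi\, f+\int_{\partial\Omega}\eta\,\partial_n\Phi\,|f|^2 .$$ Here $\nabla$, $\Delta$ and $\nabla^2$ act in $x$ only, and $\Phi$, $\eta$ and their derivatives are evaluated at time $t$. -/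

import Mathlib

open MeasureTheory Filter Topology
open scoped ContDiff ENNReal

noncomputable section

namespace HeatCarleman

/-- The Euclidean space `ℝⁿ`. -/
abbrev E (n : ℕ) : Type := EuclideanSpace ℝ (Fin n)

/-- The `i`-th vector of the canonical basis of `ℝⁿ`. -/
def basisVec {n : ℕ} (i : Fin n) : E n := EuclideanSpace.single i (1 : ℝ)

/-! ### Domains with smooth boundary, surface measure, outward normal -/

/-- The boundary of the open set `Ω` is of class `C^∞`: near each boundary point, after singling
out one coordinate `x_i` and one orientation `c = ±1` of its axis, `Ω` is the region
`c x_i > γ` above the graph of a smooth function `γ` of the other coordinates. -/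
def HasSmoothBoundary {n : ℕ} (Ω : Set (E n)) : Prop :=
  ∀ p ∈ frontier Ω, ∃ (i : Fin n) (c : ℝ) (γ : E n → ℝ) (r : ℝ),
    (c = 1 ∨ c = -1) ∧ ContDiff ℝ ∞ γ ∧
    (∀ x y : E n, (∀ j, j ≠ i → x j = y j) → γ x = γ y) ∧
    0 < r ∧ ∀ x ∈ Metric.ball p r, (x ∈ Ω ↔ γ x < c * x i)

/-- The surface measure of `∂Ω`: the `(n-1)`-dimensional Hausdorff measure, normalized so that
it is Lebesgue measure on `(n-1)`-dimensional Euclidean spaces, restricted to `∂Ω`. -/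
def surfaceMeasure {n : ℕ} (Ω : Set (E n)) : Measure (E n) :=
  (Measure.euclideanHausdorffMeasure (n - 1) : Measure (E n)).restrict (frontier Ω)

/-- `ν` is the outward unit normal of `Ω` at `p`: the unit vector positively proportional to
the gradient at `p` of a `C¹` function `ρ` with nonzero gradient such that `Ω` is `{ρ < 0}`
near `p`. -/
def IsOutwardNormal {n : ℕ} (Ω : Set (E n)) (p ν : E n) : Prop :=
  ‖ν‖ = 1 ∧ ∃ (ρ : E n → ℝ) (a : ℝ), ContDiffAt ℝ 1 ρ p ∧
    (∀ᶠ x in 𝓝 p, (x ∈ Ω ↔ ρ x < 0)) ∧ 0 < a ∧ HasGradientAt ρ (a • ν) p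

open Classical in
/-- The outward unit normal vector field `n` on `∂Ω` (and `0` where there is none). -/
def outwardNormal {n : ℕ} (Ω : Set (E n)) (p : E n) : E n :=
  if h : p ∈ frontier Ω ∧ ∃ ν, IsOutwardNormal Ω p ν then h.2.choose else 0

/-! ### Weak derivatives, Sobolev spaces, traces -/

/-- `g` is the weak derivative `∂_i u` in `Ω`. -/
def HasWeakPartial {n : ℕ} (Ω : Set (E n)) (i : Fin n) (u g : E n → ℝ) : Prop :=
  ∀ ψ : E n → ℝ, ContDiff ℝ ∞ ψ → HasCompactSupport ψ → tsupport ψ ⊆ Ω →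
    ∫ x in Ω, u x * fderiv ℝ ψ x (basisVec i) = - ∫ x in Ω, g x * ψ x

/-- `u ∈ H¹(Ω)`: `u` and its weak derivatives of order one are in `L²(Ω)`. -/
def MemH1 {n : ℕ} (Ω : Set (E n)) (u : E n → ℝ) : Prop :=
  MemLp u 2 (volume.restrict Ω) ∧
    ∀ i, ∃ g : E n → ℝ, MemLp g 2 (volume.restrict Ω) ∧ HasWeakPartial Ω i u g

open Classical in
/-- The weak derivative `∂_i u ∈ L²(Ω)`, which is unique up to equality almost everywhere
in `Ω` (and `0` if there is none). -/
def weakPartial {n : ℕ} (Ω : Set (E n)) (i : Fin n) (u : E n → ℝ) : E n → ℝ :=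
  if h : ∃ g : E n → ℝ, MemLp g 2 (volume.restrict Ω) ∧ HasWeakPartial Ω i u g
    then h.choose else 0

/-- `u ∈ H²(Ω)`: `u` and its weak derivatives of orders one and two are in `L²(Ω)`. -/
def MemH2 {n : ℕ} (Ω : Set (E n)) (u : E n → ℝ) : Prop :=
  MemH1 Ω u ∧ ∀ i, MemH1 Ω (weakPartial Ω i u)

/-- `g ∈ L²(∂Ω)` is the trace of `u ∈ H¹(Ω)` on `∂Ω`: there are functions `v k`, smooth up to the
boundary, with `v k → u` in `H¹(Ω)` and `v k → g` in `L²(∂Ω)`. -/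
def IsTrace {n : ℕ} (Ω : Set (E n)) (u g : E n → ℝ) : Prop :=
  MemLp g 2 (surfaceMeasure Ω) ∧ ∃ v : ℕ → E n → ℝ, (∀ k, ContDiff ℝ ∞ (v k)) ∧
    Tendsto (fun k => eLpNorm (fun x => v k x - u x) 2 (volume.restrict Ω)) atTop (𝓝 0) ∧
    (∀ i, Tendsto (fun k => eLpNorm (fun x => fderiv ℝ (v k) x (basisVec i) - weakPartial Ω i u x)
      2 (volume.restrict Ω)) atTop (𝓝 0)) ∧
    Tendsto (fun k => eLpNorm (fun x => v k x - g x) 2 (surfaceMeasure Ω)) atTop (𝓝 0)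

open Classical in
/-- The trace of `u` on `∂Ω`, which is unique up to equality almost everywhere on `∂Ω`
(and `0` if there is none). -/
def trace {n : ℕ} (Ω : Set (E n)) (u : E n → ℝ) : E n → ℝ :=
  if h : ∃ g : E n → ℝ, IsTrace Ω u g then h.choose else 0

/-- The outward normal derivative `∂_n u` on `∂Ω` of `u ∈ H²(Ω)`, through the traces of the
weak derivatives of `u`. -/
def traceNormal {n : ℕ} (Ω : Set (E n)) (u : E n → ℝ) (x : E n) : ℝ :=
  ∑ i, outwardNormal Ω x i * trace Ω (weakPartial Ω i u) x

/-! ### Classical derivatives of functions that are smooth on the closure of `Ω` -/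

/-- The partial derivative `∂_i g` on the closure of `Ω` of a function `g` on the closure of `Ω`.
In the open set `Ω` it is the usual partial derivative, and it is its continuous extension on
`∂Ω` for `g` smooth on the closure. -/
def pd {n : ℕ} (Ω : Set (E n)) (i : Fin n) (g : E n → ℝ) (x : E n) : ℝ :=
  fderivWithin ℝ g (closure Ω) x (basisVec i)

/-- The Laplacian `Δ g`. -/
def lap {n : ℕ} (Ω : Set (E n)) (g : E n → ℝ) (x : E n) : ℝ :=
  ∑ i, pd Ω i (pd Ω i g) x

/-- `|∇ g|²`. -/
def gradSq {n : ℕ} (Ω : Set (E n)) (g : E n → ℝ) (x : E n) : ℝ :=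
  ∑ i, pd Ω i g x ^ 2

/-- The outward normal derivative `∂_n g` on `∂Ω`. -/
def pdNormal {n : ℕ} (Ω : Set (E n)) (g : E n → ℝ) (x : E n) : ℝ :=
  ∑ i, outwardNormal Ω x i * pd Ω i g x

/-! ### The weight and the operators -/

/-- `Γ(t) = T - t + h`. -/
def Gam (T h t : ℝ) : ℝ := T - t + h

/-- `Φ(x, t) = s φ(x) / Γ(t)`; the time is the first argument, so that `weight φ s T h t` is the
function `Φ(·, t)`. -/
def weight {n : ℕ} (φ : E n → ℝ) (s T h : ℝ) (t : ℝ) (x : E n) : ℝ :=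
  s * φ x / Gam T h t

/-- `η = ½ ∂_t Φ + ¼ |∇Φ|²`. -/
def eta {n : ℕ} (Ω : Set (E n)) (Φ : ℝ → E n → ℝ) (t : ℝ) (x : E n) : ℝ :=
  1 / 2 * deriv (fun τ => Φ τ x) t + 1 / 4 * gradSq Ω (Φ t) x

/-- `𝒜 f = - ∇Φ · ∇f - ½ ΔΦ f`. -/
def opA {n : ℕ} (Ω : Set (E n)) (Φ : ℝ → E n → ℝ) (t : ℝ) (f : E n → ℝ) (x : E n) : ℝ :=
  - (∑ i, pd Ω i (Φ t) x * weakPartial Ω i f x) - 1 / 2 * lap Ω (Φ t) x * f x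

/-- `𝒮 f = - Δf - η f`. -/
def opS {n : ℕ} (Ω : Set (E n)) (Φ : ℝ → E n → ℝ) (t : ℝ) (f : E n → ℝ) (x : E n) : ℝ :=
  - (∑ i, weakPartial Ω i (weakPartial Ω i f) x) - eta Ω Φ t x * f x

/-- `𝒮' f = - ∂_t η f`. -/
def opS' {n : ℕ} (Ω : Set (E n)) (Φ : ℝ → E n → ℝ) (t : ℝ) (f : E n → ℝ) (x : E n) : ℝ :=
  - deriv (fun τ => eta Ω Φ τ x) t * f x

end HeatCarleman

end

open HeatCarleman

/-!
The three identities are integrations by parts for functions that are only in `H²(Ω)`. They all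
come from one formula, `IsSmoothDomain.hasFlux_mul`: for `u, w ∈ H¹(Ω)` and `a` of class `C¹` up to
the boundary,
`∫_Ω (∂ᵢa u w + a ∂ᵢu w + a u ∂ᵢw) = ∫_∂Ω a u w nᵢ`.

*Divergence theorem* (`IsSmoothDomain.integral_pd`). In a chart, `Ω` lies above the graph of a
smooth function `γ` of all coordinates but one. The shear `graphMap` flattens the graph and
preserves Lebesgue measure; in the flattened half-space the derivative across the boundary is
integrated by the fundamental theorem of calculus and the tangential derivatives integrate to zero.
The boundary term is a surface integral because the Hausdorff measure of a graph has density
`√(1 + |∇f|²)` (`map_graph_withDensity`): near each point the graph is, up to a factor close to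
one, the image of a linear map with the determinant of `stretch`. A partition of unity gives the
global statement.

*Traces.* `Ω` satisfies an interior cone condition (`exists_cone`), so a localized Sobolev function
can be translated into `Ω` and mollified; hence functions smooth up to the boundary are dense in
`H¹(Ω)` (`exists_smooth_near`). The divergence theorem, applied to `v² X` with `X` a field pointing
outward along `∂Ω`, bounds the `L²(∂Ω)` norm of a smooth `v` by its `H¹` norm
(`exists_eLpNorm_surface_le`), and completeness of `L²(∂Ω)` yields the trace (`isTrace_trace`).
The master formula follows by passing to the limit along the approximating sequences.

*Identities.* Taking `(a, u, w) = (∂ᵢΦ, f, f)` gives the first identity and `(1, ∂ᵢf, f)` the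
second. For the third, the combination
`2 (∂ₖΦ, ∂ᵢf, ∂ₖf)ᵢ - (∂ₖΦ, ∂ᵢf, ∂ᵢf)ₖ + (ΔΦ, ∂ᵢf, f)ᵢ + (η ∂ᵢΦ, f, f)ᵢ`, where the index outside
is the direction of differentiation, has the integrand
`2 ∇f·∇²Φ∇f + 2 𝒮f 𝒜f + (∇f·∇ΔΦ) f + (∇η·∇Φ) f²` (`commutator_identity`), since weak second
derivatives commute (`weakPartial_comm`). As `η(·, t)` is a function of `x` over `Γ(t)²`, one has
`∂ₜη = 2η/Γ` (`deriv_eta`), while `∇η·∇Φ` is computed in `sum_pd_eta_mul_pd`.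
-/

namespace HeatCarleman

/-! ### The area formula for graphs -/

section AreaFormula

open scoped NNReal InnerProductSpace

/-- If distances between the points `g x` are at most `K` times those between the points `f x`, then
the `d`-dimensional measure of `g '' S` is at most `K ^ d` times that of `f '' S`. No map from
`f '' S` to `g '' S` has to be named. -/
theorem hausdorff_image_le_of_edist_le {A X Y : Type*} [EMetricSpace X] [MeasurableSpace X]
    [BorelSpace X] [EMetricSpace Y] [MeasurableSpace Y] [BorelSpace Y] (d : ℕ) (S : Set A)
    (g : A → X) (f : A → Y) (K : ℝ≥0)
    (h : ∀ x ∈ S, ∀ y ∈ S, edist (g x) (g y) ≤ K * edist (f x) (f y)) :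
    (Measure.euclideanHausdorffMeasure d : Measure X) (g '' S)
      ≤ (K : ℝ≥0∞) ^ d * (Measure.euclideanHausdorffMeasure d : Measure Y) (f '' S) := by
  rcases S.eq_empty_or_nonempty with rfl | ⟨a₀, ha₀⟩
  · simp
  have : Nonempty A := ⟨a₀⟩
  have hinv : ∀ x ∈ S, Function.invFunOn f S (f x) ∈ S ∧
      f (Function.invFunOn f S (f x)) = f x := fun x hx =>
    Function.invFunOn_pos (f := f) (s := S) ⟨x, hx, rfl⟩
  have hL : LipschitzOnWith K (fun y => g (Function.invFunOn f S y)) (f '' S) := by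
    rintro _ ⟨x, hx, rfl⟩ _ ⟨y, hy, rfl⟩
    have := h _ (hinv x hx).1 _ (hinv y hy).1
    rwa [(hinv x hx).2, (hinv y hy).2] at this
  have himg : (fun y => g (Function.invFunOn f S y)) '' (f '' S) = g '' S := by
    rw [Set.image_image]
    refine Set.image_congr fun x hx => ?_
    have := h _ (hinv x hx).1 _ hx
    rw [(hinv x hx).2, edist_self, mul_zero] at this
    exact edist_le_zero.mp this
  have := hL.hausdorffMeasure_image_le (d := d) (by positivity)
  rw [himg, ENNReal.rpow_natCast] at this
  rw [Measure.euclideanHausdorffMeasure_def, Measure.euclideanHausdorffMeasure_def,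
    Measure.smul_apply, Measure.smul_apply, ENNReal.smul_def, ENNReal.smul_def, smul_eq_mul,
    smul_eq_mul, mul_left_comm]
  gcongr

/-- A comparison of measures up to every factor `c > 1`, on neighbourhoods that may depend on `c`,
is a comparison of measures. -/
theorem measure_le_of_locally_le {X : Type*} [TopologicalSpace X] [SecondCountableTopology X]
    [MeasurableSpace X] [OpensMeasurableSpace X] (m₁ m₂ : Measure X)
    (h : ∀ c : ℝ≥0, 1 < c → ∀ x, ∃ U ∈ 𝓝 x, ∀ S ⊆ U, MeasurableSet S → m₁ S ≤ c * m₂ S) :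
    m₁ ≤ m₂ := by
  have key : ∀ c : ℝ≥0, 1 < c → ∀ S, MeasurableSet S → m₁ S ≤ c * m₂ S := by
    intro c hc S hS
    choose U hU hUS using h c hc
    obtain ⟨s, hs, hcov⟩ := TopologicalSpace.countable_cover_nhds
      (f := fun x => interior (U x)) (fun x => interior_mem_nhds.2 (hU x))
    rcases s.eq_empty_or_nonempty with rfl | hne
    · have : S = ∅ := by
        have : (Set.univ : Set X) = ∅ := by simpa using hcov.symm
        exact Set.eq_empty_of_subset_empty (this ▸ Set.subset_univ S)
      simp [this]
    obtain ⟨e, he⟩ := hs.exists_eq_range hne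
    -- decompose `S` along the disjointed countable cover
    set V : ℕ → Set X := fun k => interior (U (e k)) with hV
    have hVm : ∀ k, MeasurableSet (disjointed V k) :=
      MeasurableSet.disjointed fun k => isOpen_interior.measurableSet
    have hVU : ⋃ k, disjointed V k = Set.univ := by
      rw [iUnion_disjointed]
      have : ⋃ x ∈ s, interior (U x) = ⋃ k, V k := by
        rw [he]; simp [hV]
      rw [← this, hcov]
    have hdec : S = ⋃ k, S ∩ disjointed V k := by
      rw [← Set.inter_iUnion, hVU, Set.inter_univ]
    have hdis : Pairwise (Function.onFun Disjoint fun k => S ∩ disjointed V k) := fun i j hij =>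
      (disjoint_disjointed V hij).mono Set.inter_subset_right Set.inter_subset_right
    rw [hdec, measure_iUnion hdis (fun k => hS.inter (hVm k)),
      measure_iUnion hdis (fun k => hS.inter (hVm k)), ← ENNReal.tsum_mul_left]
    refine ENNReal.tsum_le_tsum fun k => hUS (e k) _ ?_ (hS.inter (hVm k))
    exact Set.inter_subset_right.trans ((disjointed_subset V k).trans interior_subset)
  refine Measure.le_iff.2 fun S hS => ?_
  have hlim : Tendsto (fun k : ℕ => ((1 + 1 / ((k : ℝ≥0) + 1) : ℝ≥0) : ℝ≥0∞) * m₂ S) atTop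
      (𝓝 (((1 : ℝ≥0) : ℝ≥0∞) * m₂ S)) := by
    refine ENNReal.Tendsto.mul_const (ENNReal.tendsto_coe.2 ?_) (Or.inl (by simp))
    have : Tendsto (fun k : ℕ => 1 / ((k : ℝ≥0) + 1)) atTop (𝓝 0) :=
      tendsto_one_div_add_atTop_nhds_zero_nat
    simpa using this.const_add 1
  have := ge_of_tendsto' hlim (fun k : ℕ => key (1 + 1 / ((k : ℝ≥0) + 1)) (by
    rw [lt_add_iff_pos_right]; positivity) S hS)
  simpa using this

variable {V F : Type*} [NormedAddCommGroup V] [InnerProductSpace ℝ V]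
  [NormedAddCommGroup F] [InnerProductSpace ℝ F]

/-- A linear map stretching by the factor `√(1+‖g‖²)` in the direction of `g`. -/
noncomputable def stretch (g : V) : V →ₗ[ℝ] V :=
  LinearMap.transvection (innerₗ V g) ((1 / (1 + √(1 + ‖g‖ ^ 2))) • g)

theorem stretch_det [FiniteDimensional ℝ V] (g : V) :
    LinearMap.det (stretch g) = √(1 + ‖g‖ ^ 2) := by
  rw [stretch, LinearMap.transvection.det]
  have hq : √(1 + ‖g‖ ^ 2) ^ 2 = 1 + ‖g‖ ^ 2 := Real.sq_sqrt (by positivity)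
  have h0 : 0 ≤ √(1 + ‖g‖ ^ 2) := Real.sqrt_nonneg _
  simp only [innerₗ_apply_apply, inner_smul_right, real_inner_self_eq_norm_sq]
  field_simp
  nlinarith

/-- `stretch g` has the metric of the graph of the linear form `⟪g, ·⟫`. -/
theorem norm_stretch_sq (g v : V) : ‖stretch g v‖ ^ 2 = ‖v‖ ^ 2 + ⟪g, v⟫_ℝ ^ 2 := by
  have hq : √(1 + ‖g‖ ^ 2) ^ 2 = 1 + ‖g‖ ^ 2 := Real.sq_sqrt (by positivity)
  have h0 : 0 ≤ √(1 + ‖g‖ ^ 2) := Real.sqrt_nonneg _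
  have : stretch g v = v + (⟪g, v⟫_ℝ * (1 / (1 + √(1 + ‖g‖ ^ 2)))) • g := by
    simp [stretch, LinearMap.transvection.apply, smul_smul]
  rw [this, norm_add_sq_real, inner_smul_right, norm_smul, real_inner_comm v g, mul_pow,
    Real.norm_eq_abs, sq_abs]
  set q := √(1 + ‖g‖ ^ 2)
  have : ‖g‖ ^ 2 = q ^ 2 - 1 := by linarith
  rw [this]
  field_simp
  ring

theorem norm_graph_sq (ins : V →ₗᵢ[ℝ] F) (N : F) (hN : ‖N‖ = 1) (hperp : ∀ v, ⟪ins v, N⟫_ℝ = 0)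
    (v : V) (a : ℝ) : ‖ins v + a • N‖ ^ 2 = ‖v‖ ^ 2 + a ^ 2 := by
  rw [norm_add_sq_real, inner_smul_right, hperp, norm_smul, hN, ins.norm_map]
  simp

theorem graph_injective (ins : V →ₗᵢ[ℝ] F) (N : F) (hN : ‖N‖ = 1)
    (hperp : ∀ v, ⟪ins v, N⟫_ℝ = 0) (f : V → ℝ) :
    Function.Injective fun y => ins y + f y • N := by
  intro y z hyz
  have h := norm_graph_sq ins N hN hperp (y - z) (f y - f z)
  have h2 : ins (y - z) + (f y - f z) • N = 0 := by
    rw [map_sub, sub_smul]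
    have : ins y + f y • N = ins z + f z • N := hyz
    rw [← sub_eq_zero] at this
    rw [← this]; abel
  rw [h2, norm_zero] at h
  have : ‖y - z‖ = 0 := by nlinarith [sq_nonneg (f y - f z), norm_nonneg (y - z)]
  exact sub_eq_zero.1 (norm_eq_zero.1 this)

variable [MeasurableSpace F] [BorelSpace F]

theorem graph_measurableEmbedding [FiniteDimensional ℝ V] [MeasurableSpace V] [BorelSpace V]
    (ins : V →ₗᵢ[ℝ] F) (N : F) (hN : ‖N‖ = 1)
    (hperp : ∀ v, ⟪ins v, N⟫_ℝ = 0) (f : V → ℝ) (hf : Continuous f) :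
    MeasurableEmbedding fun y => ins y + f y • N :=
  (by fun_prop : Continuous fun y => ins y + f y • N).measurableEmbedding
    (graph_injective ins N hN hperp f)

/-- The area formula up to a factor `c > 1` near one point `y₀`, where the graph is almost isometric
to the image of `stretch (∇f y₀)`. -/
theorem graph_local_comparison {m : ℕ} (ins : E m →ₗᵢ[ℝ] F) (N : F) (hN : ‖N‖ = 1)
    (hperp : ∀ v, ⟪ins v, N⟫_ℝ = 0) (f : E m → ℝ) (hf : ContDiff ℝ 1 f) (c : ℝ≥0) (hc : 1 < c)
    (y₀ : E m) : ∃ U ∈ 𝓝 y₀, ∀ S ⊆ U, MeasurableSet S →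
      (Measure.euclideanHausdorffMeasure m : Measure F) ((fun y => ins y + f y • N) '' S)
        ≤ c * ∫⁻ y in S, ENNReal.ofReal √(1 + ‖gradient f y‖ ^ 2) ∧
      ∫⁻ y in S, ENNReal.ofReal √(1 + ‖gradient f y‖ ^ 2)
        ≤ c * (Measure.euclideanHausdorffMeasure m : Measure F)
          ((fun y => ins y + f y • N) '' S) := by
  set g := gradient f y₀ with hg
  set q : ℝ≥0 := NNReal.sqrt (1 + ‖g‖₊ ^ 2) with hq
  have hqr : (q : ℝ) = √(1 + ‖g‖ ^ 2) := by simp [hq]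
  have hq1 : 1 ≤ q := by
    rw [← NNReal.coe_le_coe, hqr, NNReal.coe_one, Real.one_le_sqrt]; nlinarith [norm_nonneg g]
  -- a Lipschitz tolerance `δ` for which both volume distortions stay below `c`
  obtain ⟨δ, hδ0, hδ1, hδc, hδc'⟩ : ∃ δ : ℝ≥0, 0 < δ ∧ δ < 1 ∧ (1 + δ) ^ m * (1 + δ) ≤ c ∧
      (1 + δ) * ((1 - δ)⁻¹) ^ m ≤ c := by
    have h1 : ContinuousAt (fun δ : ℝ≥0 => (1 + δ) ^ m * (1 + δ)) 0 := by fun_prop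
    have h2 : ContinuousAt (fun δ : ℝ≥0 => (1 + δ) * ((1 - δ)⁻¹) ^ m) 0 := by
      have : ContinuousAt (fun δ : ℝ≥0 => (1 - δ)⁻¹) 0 :=
        (by fun_prop : ContinuousAt (fun δ : ℝ≥0 => (1 - δ)) 0).inv₀ (by simp)
      fun_prop
    have e1 := h1.eventually_lt (g := fun _ => c) continuousAt_const (by simpa using hc)
    have e2 := h2.eventually_lt (g := fun _ => c) continuousAt_const (by simpa using hc)
    have e3 : ∀ᶠ δ : ℝ≥0 in 𝓝 0, δ < 1 := eventually_lt_nhds one_pos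
    have := ((e1.and e2).and e3)
    obtain ⟨r, hr, hball⟩ := Metric.eventually_nhds_iff.1 this
    have hr' : dist (Real.toNNReal (r / 2)) 0 < r := by
      rw [NNReal.dist_eq, Real.coe_toNNReal _ (by linarith)]
      simp only [NNReal.coe_zero, sub_zero]
      rw [abs_of_pos (by linarith)]; linarith
    obtain ⟨⟨a, b⟩, d⟩ := hball hr'
    exact ⟨_, by simpa using hr, d, a.le, b.le⟩
  have hstrict : HasStrictFDerivAt f (fderiv ℝ f y₀) y₀ :=
    hf.contDiffAt.hasStrictFDerivAt one_ne_zero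
  have hfg : ∀ v, fderiv ℝ f y₀ v = ⟪g, v⟫_ℝ := fun v => by
    simp [hg, gradient]
  have hnb1 := hstrict.isLittleO.def (c := (δ : ℝ)) (by exact_mod_cast hδ0)
  rw [nhds_prod_eq] at hnb1
  obtain ⟨U₁, hU₁, hU₁''⟩ := mem_prod_self_iff.1 hnb1
  have hU₁' : ∀ x ∈ U₁, ∀ y ∈ U₁, ‖f x - f y - fderiv ℝ f y₀ (x - y)‖ ≤ δ * ‖x - y‖ :=
    fun x hx y hy => hU₁'' (Set.mk_mem_prod hx hy)
  have hJc : Continuous fun y => √(1 + ‖gradient f y‖ ^ 2) := by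
    have : Continuous (gradient f) := by
      unfold gradient
      have := hf.continuous_fderiv one_ne_zero
      exact (InnerProductSpace.toDual ℝ (E m)).symm.continuous.comp this
    fun_prop
  have hqpos : (0 : ℝ) < q := by exact_mod_cast one_pos.trans_le hq1
  have hδ0' : (0 : ℝ) < δ := by exact_mod_cast hδ0
  have hJ1 : ∀ᶠ y in 𝓝 y₀, √(1 + ‖gradient f y‖ ^ 2) < (1 + δ) * q :=
    hJc.continuousAt.eventually_lt continuousAt_const (by rw [← hg, ← hqr]; nlinarith)
  have hJ2 : ∀ᶠ y in 𝓝 y₀, (q : ℝ) < (1 + δ) * √(1 + ‖gradient f y‖ ^ 2) :=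
    continuousAt_const.eventually_lt (hJc.const_mul _).continuousAt (by rw [← hg, ← hqr]; nlinarith)
  refine ⟨U₁ ∩ {y | √(1 + ‖gradient f y‖ ^ 2) < (1 + δ) * q ∧
    (q : ℝ) < (1 + δ) * √(1 + ‖gradient f y‖ ^ 2)}, inter_mem hU₁ (hJ1.and hJ2),
    fun S hS hSm => ?_⟩
  -- the graph is bi-Lipschitz close to the linear map `stretch g`
  have hcomp : ∀ x ∈ S, ∀ y ∈ S,
      |‖(ins x + f x • N) - (ins y + f y • N)‖ - ‖stretch g (x - y)‖|
        ≤ δ * ‖stretch g (x - y)‖ := by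
    intro x hx y hy
    have h1 := hU₁' x (hS hx).1 y (hS hy).1
    simp only [hfg, Real.norm_eq_abs] at h1
    have e1 : (ins x + f x • N) - (ins y + f y • N)
        = (ins (x - y) + ⟪g, x - y⟫_ℝ • N) + (f x - f y - ⟪g, x - y⟫_ℝ) • N := by
      rw [map_sub]; module
    have e2 : ‖stretch g (x - y)‖ = ‖ins (x - y) + ⟪g, x - y⟫_ℝ • N‖ := by
      have := norm_graph_sq ins N hN hperp (x - y) ⟪g, x - y⟫_ℝ
      rw [← norm_stretch_sq] at this
      exact ((sq_eq_sq₀ (norm_nonneg _) (norm_nonneg _)).1 this).symm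
    have e3 : ‖x - y‖ ≤ ‖stretch g (x - y)‖ := by
      have := norm_stretch_sq g (x - y)
      refine le_of_sq_le_sq ?_ (norm_nonneg _)
      nlinarith [sq_nonneg ⟪g, x - y⟫_ℝ]
    rw [e2, e1]
    refine (abs_norm_sub_norm_le _ _).trans ?_
    rw [add_sub_cancel_left, norm_smul, hN, mul_one, ← e2]
    exact h1.trans (by gcongr)
  have hup : (Measure.euclideanHausdorffMeasure m : Measure F) ((fun y => ins y + f y • N) '' S)
      ≤ ((1 + δ : ℝ≥0) : ℝ≥0∞) ^ m * (q * volume S) := by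
    refine (hausdorff_image_le_of_edist_le m S (fun y => ins y + f y • N) (stretch g) (1 + δ)
      fun x hx y hy => ?_).trans ?_
    · rw [edist_nndist, edist_nndist, ← ENNReal.coe_mul, ENNReal.coe_le_coe,
        ← NNReal.coe_le_coe]
      push_cast
      rw [dist_eq_norm, dist_eq_norm, ← map_sub]
      have := (abs_le.1 (hcomp x hx y hy)).2
      linarith
    · rw [EuclideanSpace.euclideanHausdorffMeasure_eq_volume, Measure.addHaar_image_linearMap,
        stretch_det, ← hqr]
      simp
  have hlow : q * volume S ≤ (((1 - δ)⁻¹ : ℝ≥0) : ℝ≥0∞) ^ m *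
      (Measure.euclideanHausdorffMeasure m : Measure F) ((fun y => ins y + f y • N) '' S) := by
    refine le_trans ?_ (hausdorff_image_le_of_edist_le m S (stretch g)
      (fun y => ins y + f y • N) (1 - δ)⁻¹ fun x hx y hy => ?_)
    · rw [EuclideanSpace.euclideanHausdorffMeasure_eq_volume, Measure.addHaar_image_linearMap,
        stretch_det, ← hqr]
      simp
    · rw [edist_nndist, edist_nndist, ← ENNReal.coe_mul, ENNReal.coe_le_coe,
        ← NNReal.coe_le_coe]
      push_cast [NNReal.coe_sub hδ1.le]
      rw [dist_eq_norm, dist_eq_norm, ← map_sub]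
      have := (abs_le.1 (hcomp x hx y hy)).1
      have h1 : (0 : ℝ) < 1 - δ := by have : (δ : ℝ) < 1 := hδ1
                                      linarith
      rw [inv_mul_eq_div, le_div_iff₀ h1]
      linarith
  have hIup : ∫⁻ y in S, ENNReal.ofReal √(1 + ‖gradient f y‖ ^ 2)
      ≤ (1 + δ : ℝ≥0) * (q * volume S) := by
    calc _ ≤ ∫⁻ y in S, (((1 + δ) * q : ℝ≥0) : ℝ≥0∞) := by
          refine setLIntegral_mono measurable_const fun y hy => ?_
          rw [← ENNReal.ofReal_coe_nnreal]
          refine ENNReal.ofReal_le_ofReal ?_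
          push_cast
          exact (hS hy).2.1.le
      _ = _ := by rw [setLIntegral_const]; push_cast; ring
  have hIlow : q * volume S
      ≤ (1 + δ : ℝ≥0) * ∫⁻ y in S, ENNReal.ofReal √(1 + ‖gradient f y‖ ^ 2) := by
    calc q * volume S = ∫⁻ y in S, (q : ℝ≥0∞) := by rw [setLIntegral_const]
      _ ≤ ∫⁻ y in S, (1 + δ : ℝ≥0) * ENNReal.ofReal √(1 + ‖gradient f y‖ ^ 2) := by
          refine setLIntegral_mono' hSm fun y hy => ?_
          rw [← ENNReal.ofReal_coe_nnreal, ← ENNReal.ofReal_coe_nnreal,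
            ← ENNReal.ofReal_mul (by positivity)]
          refine ENNReal.ofReal_le_ofReal ?_
          push_cast
          exact (hS hy).2.2.le
      _ = _ := lintegral_const_mul' _ _ (by simp)
  constructor
  · calc _ ≤ ((1 + δ : ℝ≥0) : ℝ≥0∞) ^ m * (q * volume S) := hup
      _ ≤ ((1 + δ : ℝ≥0) : ℝ≥0∞) ^ m * ((1 + δ : ℝ≥0) *
          ∫⁻ y in S, ENNReal.ofReal √(1 + ‖gradient f y‖ ^ 2)) := by gcongr
      _ ≤ _ := by
          rw [← mul_assoc]
          gcongr
          exact_mod_cast hδc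
  · calc _ ≤ (1 + δ : ℝ≥0) * (q * volume S) := hIup
      _ ≤ (1 + δ : ℝ≥0) * ((((1 - δ)⁻¹ : ℝ≥0) : ℝ≥0∞) ^ m *
        (Measure.euclideanHausdorffMeasure m : Measure F)
          ((fun y => ins y + f y • N) '' S)) := by gcongr
      _ ≤ _ := by
          rw [← mul_assoc]
          gcongr
          exact_mod_cast hδc'

/-- The area formula for the graph of a `C¹` function `f` over a hyperplane with unit normal `N`:
the measure `√(1 + |∇f|²) dy`, pushed forward to the graph, is the Hausdorff measure on the graph. -/
theorem map_graph_withDensity {m : ℕ} (ins : E m →ₗᵢ[ℝ] F) (N : F) (hN : ‖N‖ = 1)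
    (hperp : ∀ v, ⟪ins v, N⟫_ℝ = 0) (f : E m → ℝ) (hf : ContDiff ℝ 1 f) :
    ((volume : Measure (E m)).withDensity
        fun y => ENNReal.ofReal √(1 + ‖gradient f y‖ ^ 2)).map (fun y => ins y + f y • N)
      = (Measure.euclideanHausdorffMeasure m : Measure F).restrict
          (Set.range fun y => ins y + f y • N) := by
  have hemb := graph_measurableEmbedding ins N hN hperp f hf.continuous
  rw [← hemb.map_comap]
  congr 1
  apply le_antisymm
  · refine measure_le_of_locally_le _ _ fun c hc y => ?_
    obtain ⟨U, hU, h⟩ := graph_local_comparison ins N hN hperp f hf c hc y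
    refine ⟨U, hU, fun S hS hSm => ?_⟩
    rw [withDensity_apply _ hSm, hemb.comap_apply]
    exact (h S hS hSm).2
  · refine measure_le_of_locally_le _ _ fun c hc y => ?_
    obtain ⟨U, hU, h⟩ := graph_local_comparison ins N hN hperp f hf c hc y
    refine ⟨U, hU, fun S hS hSm => ?_⟩
    rw [withDensity_apply _ hSm, hemb.comap_apply]
    exact (h S hS hSm).1

end AreaFormula

/-! ### Graph charts of the boundary -/

section Charts

open scoped InnerProductSpace

/-- In the ball `B(p, r)` the set `Ω` is the region `c x_i > γ` above the graph of a smooth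
function `γ` of the coordinates other than `x_i`. -/
structure IsGraphChart {n : ℕ} (Ω : Set (E n)) (p : E n) (i : Fin n) (c : ℝ) (γ : E n → ℝ)
    (r : ℝ) : Prop where
  sign : c = 1 ∨ c = -1
  smooth : ContDiff ℝ ∞ γ
  indep : ∀ x y : E n, (∀ j, j ≠ i → x j = y j) → γ x = γ y
  pos : 0 < r
  mem_iff : ∀ x ∈ Metric.ball p r, (x ∈ Ω ↔ γ x < c * x i)

theorem IsGraphChart.sq {n : ℕ} {Ω : Set (E n)} {p : E n} {i : Fin n} {c : ℝ} {γ : E n → ℝ}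
    {r : ℝ} (h : IsGraphChart Ω p i c γ r) : c * c = 1 := by
  rcases h.sign with rfl | rfl <;> norm_num

@[simp] theorem norm_basisVec {n : ℕ} (i : Fin n) : ‖basisVec i‖ = 1 := by
  simp [basisVec]

theorem basisVec_self {n : ℕ} (i : Fin n) : (basisVec i : E n) i = 1 := by
  simp [basisVec]

theorem basisVec_ne {n : ℕ} {i j : Fin n} (h : j ≠ i) : (basisVec i : E n) j = 0 := by
  simp [basisVec, h]

theorem inner_basisVec {n : ℕ} (i : Fin n) (x : E n) : ⟪x, basisVec i⟫_ℝ = x i := by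
  simp [basisVec, EuclideanSpace.inner_single_right]

/-- The isometric embedding of `ℝᵐ` in `ℝᵐ⁺¹` as the hyperplane `x_i = 0`. -/
noncomputable def hyperplane {m : ℕ} (i : Fin (m + 1)) : E m →ₗᵢ[ℝ] E (m + 1) where
  toFun y := WithLp.toLp 2 (i.insertNth 0 y)
  map_add' x y := by
    ext j
    refine Fin.succAboveCases i ?_ (fun k => ?_) j <;> simp
  map_smul' a y := by
    ext j
    refine Fin.succAboveCases i ?_ (fun k => ?_) j <;> simp
  norm_map' y := by
    simp [EuclideanSpace.norm_eq, Fin.sum_univ_succAbove _ i]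

variable {m : ℕ}

@[simp] theorem hyperplane_self (i : Fin (m + 1)) (y : E m) : hyperplane i y i = 0 := by
  simp [hyperplane]

theorem inner_hyperplane_basisVec (i : Fin (m + 1)) (y : E m) :
    ⟪hyperplane i y, basisVec i⟫_ℝ = 0 := by
  rw [inner_basisVec, hyperplane_self]

theorem exists_hyperplane_add (i : Fin (m + 1)) (x : E (m + 1)) :
    ∃ y : E m, x = hyperplane i y + x i • basisVec i := by
  refine ⟨WithLp.toLp 2 (fun k => x (i.succAbove k)), ?_⟩
  ext j
  refine Fin.succAboveCases i ?_ (fun k => ?_) j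
  · simp [hyperplane, basisVec]
  · simp [hyperplane, basisVec]

theorem measurePreserving_hyperplane_add (i : Fin (m + 1)) :
    MeasurePreserving (fun z : E m × ℝ => hyperplane i z.1 + z.2 • basisVec i) := by
  let L : WithLp 2 (E m × ℝ) →ₗᵢ[ℝ] E (m + 1) :=
    { toFun := fun z => hyperplane i z.fst + z.snd • basisVec i
      map_add' := fun x y => by simp only [WithLp.add_fst, WithLp.add_snd, map_add]; module
      map_smul' := fun a x => by
        simp only [WithLp.smul_fst, WithLp.smul_snd, map_smul, RingHom.id_apply, smul_eq_mul]
        module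
      norm_map' := fun z => by
        have h := norm_graph_sq (hyperplane i) (basisVec i) (norm_basisVec i)
          (inner_hyperplane_basisVec i) z.fst z.snd
        have h2 := WithLp.prod_norm_sq_eq_of_L2 z
        rw [Real.norm_eq_abs, sq_abs] at h2
        rw [← h2] at h
        exact (sq_eq_sq₀ (norm_nonneg _) (norm_nonneg _)).1 h }
  have hfr : Module.finrank ℝ (WithLp 2 (E m × ℝ)) = Module.finrank ℝ (E (m + 1)) := by
    rw [(WithLp.linearEquiv 2 ℝ (E m × ℝ)).finrank_eq]
    simp
  have h1 := (L.toLinearIsometryEquiv hfr).measurePreserving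
  exact h1.comp (WithLp.volume_preserving_toLp (U := E m) (V := ℝ))

/-- The flattening of the graph of `γ`: the point lying `τ` above the graph, over the point `y` of
the hyperplane `x_i = 0`, in the direction `c e_i`. -/
noncomputable def graphMap (i : Fin (m + 1)) (c : ℝ) (γ : E (m + 1) → ℝ) (z : E m × ℝ) :
    E (m + 1) :=
  hyperplane i z.1 + (c * (γ (hyperplane i z.1) + z.2)) • basisVec i

variable {Ω : Set (E (m + 1))} {p : E (m + 1)} {i : Fin (m + 1)} {c : ℝ} {γ : E (m + 1) → ℝ}
  {r : ℝ}

theorem graphMap_self (i : Fin (m + 1)) (c : ℝ) (γ : E (m + 1) → ℝ) (z : E m × ℝ) :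
    graphMap i c γ z i = c * (γ (hyperplane i z.1) + z.2) := by
  simp [graphMap, basisVec]

namespace IsGraphChart

theorem apply_add_smul (h : IsGraphChart Ω p i c γ r) (x : E (m + 1)) (a : ℝ) :
    γ (x + a • basisVec i) = γ x :=
  h.indep _ _ fun j hj => by simp [basisVec_ne hj]

theorem fderiv_add_smul (h : IsGraphChart Ω p i c γ r) (x : E (m + 1)) (a : ℝ) :
    fderiv ℝ γ (x + a • basisVec i) = fderiv ℝ γ x := by
  rw [← fderiv_comp_add_right]
  congr 1
  ext y
  exact h.apply_add_smul y a

theorem differentiableAt (h : IsGraphChart Ω p i c γ r) (x : E (m + 1)) :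
    DifferentiableAt ℝ γ x :=
  h.smooth.contDiffAt.differentiableAt (by simp)

theorem fderiv_basisVec (h : IsGraphChart Ω p i c γ r) (x : E (m + 1)) :
    fderiv ℝ γ x (basisVec i) = 0 := by
  rw [← (h.differentiableAt x).lineDeriv_eq_fderiv, lineDeriv]
  simp [h.apply_add_smul]

theorem mul_apply_graphMap (h : IsGraphChart Ω p i c γ r) (z : E m × ℝ) :
    c * graphMap i c γ z i = γ (graphMap i c γ z) + z.2 := by
  rw [graphMap_self, ← mul_assoc, h.sq, one_mul, graphMap, h.apply_add_smul]

theorem graphMap_mem_iff (h : IsGraphChart Ω p i c γ r) {z : E m × ℝ}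
    (hz : graphMap i c γ z ∈ Metric.ball p r) : graphMap i c γ z ∈ Ω ↔ 0 < z.2 := by
  rw [h.mem_iff _ hz, h.mul_apply_graphMap]
  simp

theorem continuous_graphMap (h : IsGraphChart Ω p i c γ r) : Continuous (graphMap i c γ) := by
  have := h.smooth.continuous
  unfold graphMap
  fun_prop

theorem graphMap_injective (h : IsGraphChart Ω p i c γ r) :
    Function.Injective (graphMap i c γ) := by
  rintro ⟨y, s⟩ ⟨z, t⟩ hyz
  have hn := norm_graph_sq (hyperplane i) (basisVec i) (norm_basisVec i)
    (inner_hyperplane_basisVec i) (y - z)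
    (c * (γ (hyperplane i y) + s) - c * (γ (hyperplane i z) + t))
  have h0 : hyperplane i (y - z) + (c * (γ (hyperplane i y) + s)
      - c * (γ (hyperplane i z) + t)) • basisVec i = 0 := by
    have : graphMap i c γ (y, s) - graphMap i c γ (z, t) = 0 := sub_eq_zero.2 hyz
    rw [← this, map_sub, graphMap, graphMap]
    module
  rw [h0, norm_zero] at hn
  have hy : y = z := by
    have : ‖y - z‖ = 0 := by
      nlinarith [norm_nonneg (y - z), sq_nonneg
        (c * (γ (hyperplane i y) + s) - c * (γ (hyperplane i z) + t))]
    exact sub_eq_zero.1 (norm_eq_zero.1 this)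
  subst hy
  have h1 := h.mul_apply_graphMap (y, s)
  rw [hyz, h.mul_apply_graphMap (y, t)] at h1
  simpa using h1.symm

theorem measurableEmbedding_graphMap (h : IsGraphChart Ω p i c γ r) :
    MeasurableEmbedding (graphMap i c γ) :=
  h.continuous_graphMap.measurableEmbedding h.graphMap_injective

/-- The flattening is a shear followed by an isometry, hence preserves volume. -/
theorem measurePreserving_graphMap (h : IsGraphChart Ω p i c γ r) :
    MeasurePreserving (graphMap i c γ) := by
  have hγ := h.smooth.continuous
  have h1 : MeasurePreserving (fun z : E m × ℝ => (z.1, c * (γ (hyperplane i z.1) + z.2))) := by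
    refine (MeasurePreserving.id (volume : Measure (E m))).skew_product
      (g := fun y s => c * (γ (hyperplane i y) + s)) ?_ (Eventually.of_forall fun y => ?_)
    · exact (by fun_prop : Continuous fun z : E m × ℝ =>
        c * (γ (hyperplane i z.1) + z.2)).measurable
    · have e1 : MeasurePreserving (fun s : ℝ => γ (hyperplane i y) + s) :=
        measurePreserving_add_left volume _
      have e2 : MeasurePreserving (fun s : ℝ => c * s) := by
        rcases h.sign with rfl | rfl
        · simp only [one_mul]
          exact MeasurePreserving.id (volume : Measure ℝ)
        · simpa using Measure.measurePreserving_neg (volume : Measure ℝ)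
      exact (e2.comp e1).map_eq
  exact (measurePreserving_hyperplane_add i).comp h1

/-- From a point of the graph, the direction `c e_i` enters `Ω`. -/
theorem eventually_add_mem (h : IsGraphChart Ω p i c γ r) {x : E (m + 1)}
    (hx : x ∈ Metric.ball p r) (hγ : γ x = c * x i) :
    ∀ᶠ t in 𝓝[>] (0 : ℝ), x + (t * c) • basisVec i ∈ Ω := by
  have hc : Tendsto (fun t : ℝ => x + (t * c) • (basisVec i : E (m + 1))) (𝓝[>] 0) (𝓝 x) := by
    have : Continuous (fun t : ℝ => x + (t * c) • (basisVec i : E (m + 1))) := by fun_prop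
    have := (this.tendsto 0).mono_left (nhdsWithin_le_nhds (s := Set.Ioi 0))
    simpa using this
  filter_upwards [hc.eventually (Metric.isOpen_ball.mem_nhds hx), self_mem_nhdsWithin] with t ht h0
  rw [h.mem_iff _ ht, h.apply_add_smul, hγ]
  have h0' : (0 : ℝ) < t := h0
  have := h.sq
  simp only [PiLp.add_apply, PiLp.smul_apply, basisVec_self, smul_eq_mul, mul_one]
  nlinarith

theorem mem_frontier_iff (h : IsGraphChart Ω p i c γ r) (hΩ : IsOpen Ω) {x : E (m + 1)}
    (hx : x ∈ Metric.ball p r) : x ∈ frontier Ω ↔ γ x = c * x i := by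
  rw [hΩ.frontier_eq]
  constructor
  · rintro ⟨h1, h2⟩
    rw [h.mem_iff x hx, not_lt] at h2
    refine le_antisymm ?_ h2
    have hcl : x ∈ closure (Metric.ball p r ∩ Ω) :=
      Metric.isOpen_ball.inter_closure ⟨hx, h1⟩
    have hsub : closure (Metric.ball p r ∩ Ω) ⊆ {y | γ y ≤ c * y i} := by
      refine closure_minimal (fun y hy => ((h.mem_iff y hy.1).1 hy.2).le) ?_
      exact isClosed_le h.smooth.continuous (by fun_prop)
    exact hsub hcl
  · intro hγ
    refine ⟨?_, fun hc => ?_⟩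
    · refine mem_closure_of_tendsto (f := fun t : ℝ => x + (t * c) • (basisVec i : E (m + 1)))
        (b := 𝓝[>] 0) ?_ (h.eventually_add_mem hx hγ)
      have : Continuous (fun t : ℝ => x + (t * c) • (basisVec i : E (m + 1))) := by fun_prop
      have := (this.tendsto 0).mono_left (nhdsWithin_le_nhds (s := Set.Ioi 0))
      simpa using this
    · rw [h.mem_iff x hx, hγ] at hc
      exact lt_irrefl _ hc

theorem graphMap_zero_mem_frontier (h : IsGraphChart Ω p i c γ r) (hΩ : IsOpen Ω) {y : E m}
    (hy : graphMap i c γ (y, 0) ∈ Metric.ball p r) : graphMap i c γ (y, 0) ∈ frontier Ω := by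
  rw [h.mem_frontier_iff hΩ hy, h.mul_apply_graphMap, add_zero]

theorem exists_graphMap_zero (h : IsGraphChart Ω p i c γ r) {x : E (m + 1)}
    (hγ : γ x = c * x i) : ∃ y, graphMap i c γ (y, 0) = x := by
  obtain ⟨y, hy⟩ := exists_hyperplane_add i x
  refine ⟨y, ?_⟩
  have : γ (hyperplane i y) = γ x := by
    conv_rhs => rw [hy]
    rw [h.apply_add_smul]
  rw [graphMap]
  simp only [add_zero, this, hγ]
  rw [← mul_assoc, h.sq, one_mul, ← hy]

end IsGraphChart

end Charts

/-! ### Outward normal and surface integrals in a chart -/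

section Normal

open scoped InnerProductSpace

theorem IsOutwardNormal.eq_zero_of_mem_frontier {n : ℕ} {Ω : Set (E n)} (hΩ : IsOpen Ω) {p : E n}
    (hp : p ∈ frontier Ω) {ρ : E n → ℝ} (hρ : ContinuousAt ρ p)
    (h : ∀ᶠ x in 𝓝 p, (x ∈ Ω ↔ ρ x < 0)) : ρ p = 0 := by
  rw [hΩ.frontier_eq] at hp
  refine le_antisymm ?_ (not_lt.1 fun h0 => hp.2 (h.self_of_nhds.2 h0))
  have : (𝓝[Ω] p).NeBot := mem_closure_iff_nhdsWithin_neBot.1 hp.1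
  refine le_of_tendsto (hρ.mono_left (nhdsWithin_le_nhds (s := Ω))) ?_
  filter_upwards [h.filter_mono nhdsWithin_le_nhds, self_mem_nhdsWithin] with x hx hxΩ
  exact (hx.1 hxΩ).le

theorem hasDerivAt_line {n : ℕ} {ρ : E n → ℝ} {p w : E n} (h : HasGradientAt ρ w p) (v : E n) :
    HasDerivAt (fun t : ℝ => ρ (p + t • v)) ⟪w, v⟫_ℝ 0 := by
  have h1 : HasFDerivAt ρ (InnerProductSpace.toDual ℝ (E n) w) (p + (0 : ℝ) • v) := by
    simpa using h.hasFDerivAt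
  have h2 : HasDerivAt (fun t : ℝ => p + t • v) v 0 := by
    simpa using ((hasDerivAt_id (0 : ℝ)).smul_const v).const_add p
  have := h1.comp_hasDerivAt (0 : ℝ) h2
  rw [InnerProductSpace.toDual_apply_apply] at this
  exact this

/-- A direction entering `Ω` according to one outward normal does not leave it according to
another one. -/
theorem IsOutwardNormal.inner_nonpos {n : ℕ} {Ω : Set (E n)} (hΩ : IsOpen Ω) {p ν ν' : E n}
    (hp : p ∈ frontier Ω) (h : IsOutwardNormal Ω p ν) (h' : IsOutwardNormal Ω p ν') {v : E n}
    (hv : ⟪ν, v⟫_ℝ < 0) : ⟪ν', v⟫_ℝ ≤ 0 := by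
  obtain ⟨-, ρ, a, hρ, hΩρ, ha, hg⟩ := h
  obtain ⟨-, ρ', a', hρ', hΩρ', ha', hg'⟩ := h'
  have z := IsOutwardNormal.eq_zero_of_mem_frontier hΩ hp hρ.continuousAt hΩρ
  have z' := IsOutwardNormal.eq_zero_of_mem_frontier hΩ hp hρ'.continuousAt hΩρ'
  have d := (hasDerivAt_line hg v).tendsto_slope_zero_right
  have d' := (hasDerivAt_line hg' v).tendsto_slope_zero_right
  simp only [zero_add, zero_smul, add_zero, z, z', sub_zero, smul_eq_mul, inner_smul_left,
    conj_trivial] at d d'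
  have hc : Tendsto (fun t : ℝ => p + t • v) (𝓝[>] 0) (𝓝 p) := by
    have : Continuous (fun t : ℝ => p + t • v) := by fun_prop
    simpa using (this.tendsto 0).mono_left (nhdsWithin_le_nhds (s := Set.Ioi 0))
  have hneg := d.eventually (gt_mem_nhds (by nlinarith : a * ⟪ν, v⟫_ℝ < 0))
  have : a' * ⟪ν', v⟫_ℝ ≤ 0 := by
    refine le_of_tendsto d' ?_
    filter_upwards [hneg, hc.eventually hΩρ, hc.eventually hΩρ', self_mem_nhdsWithin]
      with t h1 h2 h3 h4
    have h4' : (0 : ℝ) < t⁻¹ := inv_pos.2 h4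
    have h5 : ρ (p + t • v) < 0 := by
      by_contra hcon
      exact absurd h1 (not_lt.2 (mul_nonneg h4'.le (not_lt.1 hcon)))
    exact mul_nonpos_of_nonneg_of_nonpos h4'.le (h3.1 (h2.2 h5)).le
  by_contra hcon
  exact absurd this (not_le.2 (mul_pos ha' (not_le.1 hcon)))

/-- Test the half-space inclusion of `IsOutwardNormal.inner_nonpos` with the directions `-ν` and
`ν' - (⟪ν, ν'⟫ + ε) ν`. -/
theorem IsOutwardNormal.unique {n : ℕ} {Ω : Set (E n)} (hΩ : IsOpen Ω) {p ν ν' : E n}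
    (hp : p ∈ frontier Ω) (h : IsOutwardNormal Ω p ν) (h' : IsOutwardNormal Ω p ν') : ν = ν' := by
  set s := ⟪ν, ν'⟫_ℝ with hs
  have hνν : ⟪ν, ν⟫_ℝ = 1 := by rw [real_inner_self_eq_norm_sq, h.1]; norm_num
  have hνν' : ⟪ν', ν'⟫_ℝ = 1 := by rw [real_inner_self_eq_norm_sq, h'.1]; norm_num
  have hs1 : s ≤ 1 := by
    have := real_inner_le_norm ν ν'
    rwa [h.1, h'.1, mul_one] at this
  have hs0 : 0 ≤ s := by
    have := h.inner_nonpos hΩ hp h' (v := -ν) (by rw [inner_neg_right, hνν]; norm_num)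
    rw [inner_neg_right, real_inner_comm] at this
    linarith
  have hε : ∀ ε : ℝ, 0 < ε → 1 ≤ s ^ 2 + ε := by
    intro ε hε
    have := h.inner_nonpos hΩ hp h' (v := ν' - (s + ε) • ν) (by
      rw [inner_sub_right, inner_smul_right, hνν, ← hs]; linarith)
    rw [inner_sub_right, inner_smul_right, hνν', real_inner_comm ν ν', ← hs] at this
    nlinarith
  have h1 : 1 ≤ s ^ 2 := le_of_forall_pos_le_add hε
  have : s = 1 := by nlinarith
  exact (inner_eq_one_iff_of_norm_eq_one h.1 h'.1).1 this

theorem outwardNormal_eq {n : ℕ} {Ω : Set (E n)} (hΩ : IsOpen Ω) {p ν : E n}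
    (hp : p ∈ frontier Ω) (h : IsOutwardNormal Ω p ν) : outwardNormal Ω p = ν := by
  have hex : p ∈ frontier Ω ∧ ∃ ν, IsOutwardNormal Ω p ν := ⟨hp, ν, h⟩
  rw [outwardNormal, dif_pos hex]
  exact hex.2.choose_spec.unique hΩ hp h

variable {m : ℕ} {Ω : Set (E (m + 1))} {p : E (m + 1)} {i : Fin (m + 1)} {c : ℝ}
  {γ : E (m + 1) → ℝ} {r : ℝ}

/-- The gradient of `γ - c x_i`, an outward normal vector to the region `c x_i > γ`. -/
noncomputable def graphNormal (i : Fin (m + 1)) (c : ℝ) (γ : E (m + 1) → ℝ) (x : E (m + 1)) :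
    E (m + 1) :=
  gradient γ x - c • basisVec i

namespace IsGraphChart

theorem inner_graphNormal (x v : E (m + 1)) :
    ⟪graphNormal i c γ x, v⟫_ℝ = fderiv ℝ γ x v - c * v i := by
  rw [graphNormal, inner_sub_left, inner_smul_left, real_inner_comm, real_inner_comm _ (basisVec i),
    inner_basisVec, real_inner_comm]
  simp [gradient]

theorem hasGradientAt (h : IsGraphChart Ω p i c γ r) (x : E (m + 1)) :
    HasGradientAt (fun x => γ x - c * x i) (graphNormal i c γ x) x := by
  rw [hasGradientAt_iff_hasFDerivAt]
  have h1 : HasFDerivAt (fun x : E (m + 1) => x i) (EuclideanSpace.proj i : E (m + 1) →L[ℝ] ℝ) x :=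
    (EuclideanSpace.proj i : E (m + 1) →L[ℝ] ℝ).hasFDerivAt
  have h2 := (h.differentiableAt x).hasFDerivAt.sub (h1.const_mul c)
  have e : InnerProductSpace.toDual ℝ (E (m + 1)) (graphNormal i c γ x)
      = fderiv ℝ γ x - c • (EuclideanSpace.proj i : E (m + 1) →L[ℝ] ℝ) := by
    ext v
    rw [InnerProductSpace.toDual_apply_apply, inner_graphNormal]
    simp
  rw [e]
  exact h2

theorem graphNormal_ne_zero (h : IsGraphChart Ω p i c γ r) (x : E (m + 1)) :
    graphNormal i c γ x ≠ 0 := by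
  intro h0
  have h1 := inner_graphNormal (i := i) (c := c) (γ := γ) x (basisVec i)
  rw [h0, inner_zero_left, h.fderiv_basisVec, basisVec_self] at h1
  have := h.sq
  nlinarith

theorem isOutwardNormal (h : IsGraphChart Ω p i c γ r) {x : E (m + 1)}
    (hx : x ∈ Metric.ball p r) :
    IsOutwardNormal Ω x (‖graphNormal i c γ x‖⁻¹ • graphNormal i c γ x) := by
  have h0 : 0 < ‖graphNormal i c γ x‖ := norm_pos_iff.2 (h.graphNormal_ne_zero x)
  refine ⟨by rw [norm_smul, norm_inv, norm_norm, inv_mul_cancel₀ h0.ne'],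
    fun x => γ x - c * x i, ‖graphNormal i c γ x‖, ?_, ?_, h0, ?_⟩
  · have := h.smooth.of_le (m := 1) (by norm_cast)
    exact ContDiff.contDiffAt (by fun_prop)
  · filter_upwards [Metric.isOpen_ball.mem_nhds hx] with y hy
    rw [h.mem_iff y hy, sub_neg]
  · rw [smul_smul, mul_inv_cancel₀ h0.ne', one_smul]
    exact h.hasGradientAt x

theorem outwardNormal_eq (h : IsGraphChart Ω p i c γ r) (hΩ : IsOpen Ω) {x : E (m + 1)}
    (hx : x ∈ Metric.ball p r) (hxf : x ∈ frontier Ω) :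
    outwardNormal Ω x = ‖graphNormal i c γ x‖⁻¹ • graphNormal i c γ x :=
  HeatCarleman.outwardNormal_eq hΩ hxf (h.isOutwardNormal hx)

theorem continuous_graphNormal (h : IsGraphChart Ω p i c γ r) :
    Continuous (graphNormal i c γ) := by
  have := h.smooth.continuous_fderiv (by simp)
  have : Continuous (gradient γ) :=
    (InnerProductSpace.toDual ℝ (E (m + 1))).symm.continuous.comp this
  unfold graphNormal
  fun_prop

/-- The function whose graph is `∂Ω`, on the parameter space. -/
theorem contDiff_profile (h : IsGraphChart Ω p i c γ r) :
    ContDiff ℝ 1 fun y : E m => c * γ (hyperplane i y) := by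
  have h1 := h.smooth.of_le (m := 1) (by norm_cast)
  have : ContDiff ℝ 1 (hyperplane i : E m → E (m + 1)) := (hyperplane i).contDiff
  exact contDiff_const.mul (h1.comp this)

theorem graphMap_zero (y : E m) :
    graphMap i c γ (y, 0) = hyperplane i y + (c * γ (hyperplane i y)) • basisVec i := by
  simp [graphMap]

/-- The length of the normal is the density of the area formula. -/
theorem norm_graphNormal (h : IsGraphChart Ω p i c γ r) (y : E m) :
    ‖graphNormal i c γ (graphMap i c γ (y, 0))‖
      = √(1 + ‖gradient (fun y : E m => c * γ (hyperplane i y)) y‖ ^ 2) := by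
  set g := gradient (fun y : E m => c * γ (hyperplane i y)) y with hg
  have hgi : ∀ u : E m, ⟪g, u⟫_ℝ = c * fderiv ℝ γ (hyperplane i y) (hyperplane i u) := by
    intro u
    have h2 : HasFDerivAt (fun y : E m => c * γ (hyperplane i y))
        (c • (fderiv ℝ γ (hyperplane i y)).comp
          (hyperplane i).toContinuousLinearMap) y :=
      ((h.differentiableAt _).hasFDerivAt.comp y
        (hyperplane i).toContinuousLinearMap.hasFDerivAt).const_mul c
    simp [hg, gradient, h2.fderiv, inner_smul_left]
  have hN : graphNormal i c γ (graphMap i c γ (y, 0))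
      = hyperplane i (c • g) + (-c) • basisVec i := by
    refine ext_inner_right ℝ fun v => ?_
    obtain ⟨u, hu⟩ := exists_hyperplane_add i v
    rw [inner_graphNormal, graphMap, h.fderiv_add_smul]
    have hb : ⟪basisVec i, v⟫_ℝ = v i := by rw [real_inner_comm, inner_basisVec]
    have h1 : ⟪hyperplane i g, v⟫_ℝ = ⟪g, u⟫_ℝ := by
      conv_lhs => rw [hu]
      rw [inner_add_right, inner_smul_right, inner_hyperplane_basisVec,
        (hyperplane i).inner_map_map]
      simp
    have h2 : fderiv ℝ γ (hyperplane i y) v = fderiv ℝ γ (hyperplane i y) (hyperplane i u) := by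
      conv_lhs => rw [hu]
      rw [map_add, map_smul, h.fderiv_basisVec]
      simp
    rw [inner_add_left, inner_smul_left, map_smul, inner_smul_left, h1, hgi, hb, h2]
    simp only [conj_trivial]
    linear_combination (-(fderiv ℝ γ (hyperplane i y) (hyperplane i u))) * h.sq
  have := norm_graph_sq (hyperplane i) (basisVec i) (norm_basisVec i)
    (inner_hyperplane_basisVec i) (c • g) (-c)
  rw [← hN, norm_smul, mul_pow, Real.norm_eq_abs, sq_abs] at this
  rw [eq_comm, Real.sqrt_eq_iff_eq_sq (by positivity) (norm_nonneg _), this]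
  have := h.sq
  linear_combination (-1 - ‖g‖ ^ 2) * this

theorem measurableEmbedding_graphMap_zero (h : IsGraphChart Ω p i c γ r) :
    MeasurableEmbedding fun y : E m => graphMap i c γ (y, 0) := by
  simp only [graphMap_zero]
  exact graph_measurableEmbedding (hyperplane i) (basisVec i) (norm_basisVec i)
    (inner_hyperplane_basisVec i) _ h.contDiff_profile.continuous

/-- The area formula for the graph of `γ`. -/
theorem map_graphMap_withDensity (h : IsGraphChart Ω p i c γ r) :
    ((volume : Measure (E m)).withDensity fun y =>
        ENNReal.ofReal ‖graphNormal i c γ (graphMap i c γ (y, 0))‖).map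
          (fun y => graphMap i c γ (y, 0))
      = (Measure.euclideanHausdorffMeasure m : Measure (E (m + 1))).restrict
          (Set.range fun y => graphMap i c γ (y, 0)) := by
  simp only [h.norm_graphNormal]
  simp only [graphMap_zero]
  exact map_graph_withDensity (hyperplane i) (basisVec i) (norm_basisVec i)
    (inner_hyperplane_basisVec i) _ h.contDiff_profile

theorem mem_frontier_iff_mem_range (h : IsGraphChart Ω p i c γ r) (hΩ : IsOpen Ω)
    {x : E (m + 1)} (hx : x ∈ Metric.ball p r) :
    x ∈ frontier Ω ↔ x ∈ Set.range fun y : E m => graphMap i c γ (y, 0) := by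
  rw [h.mem_frontier_iff hΩ hx]
  constructor
  · intro hγ
    exact h.exists_graphMap_zero hγ
  · rintro ⟨y, rfl⟩
    rw [h.mul_apply_graphMap, add_zero]

theorem continuous_norm_graphNormal (h : IsGraphChart Ω p i c γ r) :
    Continuous fun y : E m => ‖graphNormal i c γ (graphMap i c γ (y, 0))‖ :=
  (h.continuous_graphNormal.comp (h.continuous_graphMap.comp
      (by fun_prop : Continuous fun y : E m => (y, (0 : ℝ))))).norm

/-- Surface integrals in a graph chart. -/
theorem integral_surfaceMeasure (h : IsGraphChart Ω p i c γ r) (hΩ : IsOpen Ω)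
    {H : E (m + 1) → ℝ} (hH : ∀ x, x ∉ Metric.ball p r → H x = 0) :
    ∫ x, H x ∂(surfaceMeasure Ω)
      = ∫ y : E m, ‖graphNormal i c γ (graphMap i c γ (y, 0))‖ * H (graphMap i c γ (y, 0)) := by
  classical
  have hemb := h.measurableEmbedding_graphMap_zero
  have e1 : ∫ x, H x ∂(surfaceMeasure Ω) = ∫ x in Set.range (fun y => graphMap i c γ (y, 0)), H x
      ∂(Measure.euclideanHausdorffMeasure m) := by
    change ∫ x in frontier Ω, H x ∂(Measure.euclideanHausdorffMeasure m) = _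
    rw [← integral_indicator isClosed_frontier.measurableSet,
      ← integral_indicator hemb.measurableSet_range]
    refine integral_congr_ae (Eventually.of_forall fun x => ?_)
    by_cases hx : x ∈ Metric.ball p r
    · simp only [Set.indicator_apply, h.mem_frontier_iff_mem_range hΩ hx]
    · simp [Set.indicator_apply, hH x hx]
  rw [e1, ← h.map_graphMap_withDensity, hemb.integral_map,
    integral_withDensity_eq_integral_toReal_smul
      h.continuous_norm_graphNormal.measurable.ennreal_ofReal
      (Eventually.of_forall fun _ => ENNReal.ofReal_lt_top)]
  simp only [ENNReal.toReal_ofReal (norm_nonneg _), smul_eq_mul]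

theorem norm_le_norm_graphMap (y : E m) (τ : ℝ) : ‖y‖ ≤ ‖graphMap i c γ (y, τ)‖ := by
  have := norm_graph_sq (hyperplane i) (basisVec i) (norm_basisVec i)
    (inner_hyperplane_basisVec i) y (c * (γ (hyperplane i y) + τ))
  refine le_of_sq_le_sq ?_ (norm_nonneg _)
  rw [graphMap, this]
  nlinarith [sq_nonneg (c * (γ (hyperplane i y) + τ))]

theorem surfaceMeasure_ball_lt_top (h : IsGraphChart Ω p i c γ r) (hΩ : IsOpen Ω) :
    surfaceMeasure Ω (Metric.ball p r) < ⊤ := by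
  have hemb := h.measurableEmbedding_graphMap_zero
  have hB := (Metric.isOpen_ball (x := p) (ε := r)).measurableSet
  have e1 : surfaceMeasure Ω (Metric.ball p r)
      = ((Measure.euclideanHausdorffMeasure m : Measure (E (m + 1))).restrict
          (Set.range fun y => graphMap i c γ (y, 0))) (Metric.ball p r) := by
    change ((Measure.euclideanHausdorffMeasure m : Measure (E (m + 1))).restrict
      (frontier Ω)) (Metric.ball p r) = _
    rw [Measure.restrict_apply hB, Measure.restrict_apply hB]
    congr 1
    ext x
    exact and_congr_right fun hx => h.mem_frontier_iff_mem_range hΩ hx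
  rw [e1, ← h.map_graphMap_withDensity, hemb.map_apply, withDensity_apply _ (hemb.measurable hB)]
  have hsub : (fun y : E m => graphMap i c γ (y, 0)) ⁻¹' Metric.ball p r
      ⊆ Metric.closedBall 0 (‖p‖ + r) := by
    intro y hy
    rw [mem_closedBall_zero_iff]
    refine (norm_le_norm_graphMap (i := i) (c := c) (γ := γ) y 0).trans ?_
    have h1 : dist (graphMap i c γ (y, 0)) p < r := hy
    rw [dist_eq_norm] at h1
    have h2 := norm_add_le p (graphMap i c γ (y, 0) - p)
    rw [add_sub_cancel] at h2
    linarith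
  refine (lintegral_mono_set hsub).trans_lt ?_
  exact (h.continuous_norm_graphNormal.continuousOn.integrableOn_compact
    (isCompact_closedBall _ _)).setLIntegral_lt_top

end IsGraphChart

end Normal

/-! ### The divergence theorem in a chart -/

section LocalGaussGreen

open scoped InnerProductSpace

variable {m : ℕ} {Ω : Set (E (m + 1))} {p : E (m + 1)} {i : Fin (m + 1)} {c : ℝ}
  {γ : E (m + 1) → ℝ} {r : ℝ}

/-- The half-space measure: Lebesgue measure on `{(y, τ) | τ > 0}`. -/
noncomputable abbrev halfSpace (m : ℕ) : Measure (E m × ℝ) :=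
  (volume : Measure (E m)).prod (volume.restrict (Set.Ioi (0 : ℝ)))

theorem halfSpace_eq (m : ℕ) :
    halfSpace m = (volume : Measure (E m × ℝ)).restrict {z | 0 < z.2} := by
  have : {z : E m × ℝ | 0 < z.2} = Set.univ ×ˢ Set.Ioi (0 : ℝ) := by
    ext z; simp
  rw [this, Measure.volume_eq_prod, ← Measure.prod_restrict, Measure.restrict_univ]

theorem measurableSet_upper (m : ℕ) : MeasurableSet {z : E m × ℝ | 0 < z.2} :=
  measurableSet_lt measurable_const measurable_snd

theorem eventually_eq_zero_of_notMem {n : ℕ} {K : Set (E n)} (hK : IsClosed K) {F : E n → ℝ}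
    (hF : ∀ x, x ∉ K → F x = 0) {x : E n} (hx : x ∉ K) : F =ᶠ[𝓝 x] fun _ => 0 := by
  filter_upwards [hK.isOpen_compl.mem_nhds hx] with y hy
  exact hF y hy

theorem fderiv_eq_zero_of_notMem {n : ℕ} {K : Set (E n)} (hK : IsClosed K) {F : E n → ℝ}
    (hF : ∀ x, x ∉ K → F x = 0) {x : E n} (hx : x ∉ K) : fderiv ℝ F x = 0 := by
  rw [(eventually_eq_zero_of_notMem hK hF hx).fderiv_eq]
  simp

/-- A function supported in `K` which is `C¹` on the open set `Ω`, continuous up to the boundary,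
and has bounded derivative. -/
structure IsC1UpTo {n : ℕ} (Ω K : Set (E n)) (F : E n → ℝ) : Prop where
  isCompact : IsCompact K
  eq_zero : ∀ x, x ∉ K → F x = 0
  continuousOn : ContinuousOn F (closure Ω)
  differentiableOn : DifferentiableOn ℝ F Ω
  continuousOn_fderiv : ContinuousOn (fderiv ℝ F) Ω
  bounded : ∃ C, ∀ x ∈ Ω, ‖fderiv ℝ F x‖ ≤ C

namespace IsC1UpTo

variable {n : ℕ} {U K : Set (E n)} {F : E n → ℝ}

theorem fderiv_eq_zero (hF : IsC1UpTo U K F) {x : E n} (hx : x ∉ K) : fderiv ℝ F x = 0 :=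
  fderiv_eq_zero_of_notMem hF.isCompact.isClosed hF.eq_zero hx

theorem differentiableAt (hF : IsC1UpTo U K F) (hU : IsOpen U) {x : E n} (hx : x ∈ U ∨ x ∉ K) :
    DifferentiableAt ℝ F x := by
  rcases hx with hx | hx
  · exact hF.differentiableOn.differentiableAt (hU.mem_nhds hx)
  · exact (differentiableAt_const (0 : ℝ)).congr_of_eventuallyEq
      (eventually_eq_zero_of_notMem hF.isCompact.isClosed hF.eq_zero hx)

theorem continuousAt_fderiv (hF : IsC1UpTo U K F) (hU : IsOpen U) {x : E n}
    (hx : x ∈ U ∨ x ∉ K) : ContinuousAt (fderiv ℝ F) x := by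
  rcases hx with hx | hx
  · exact hF.continuousOn_fderiv.continuousAt (hU.mem_nhds hx)
  · refine (continuousAt_const (y := (0 : E n →L[ℝ] ℝ))).congr ?_
    filter_upwards [hF.isCompact.isClosed.isOpen_compl.mem_nhds hx] with y hy
    exact (hF.fderiv_eq_zero hy).symm

theorem exists_bound (hF : IsC1UpTo U K F) :
    ∃ C, 0 ≤ C ∧ ∀ x, x ∈ U ∨ x ∉ K → ‖fderiv ℝ F x‖ ≤ C := by
  obtain ⟨C, hC⟩ := hF.bounded
  refine ⟨max C 0, le_max_right _ _, fun x hx => ?_⟩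
  rcases hx with hx | hx
  · exact (hC x hx).trans (le_max_left _ _)
  · rw [hF.fderiv_eq_zero hx, norm_zero]; exact le_max_right _ _

end IsC1UpTo

namespace IsGraphChart

variable {K : Set (E (m + 1))} {F : E (m + 1) → ℝ}

/-- The flattened half-space is sent either into `Ω` or off the support `K`, so that functions
supported in `K` are differentiable along it. -/
theorem mem_or_notMem (h : IsGraphChart Ω p i c γ r) (hK : K ⊆ Metric.ball p r) {z : E m × ℝ}
    (hz : 0 < z.2) : graphMap i c γ z ∈ Ω ∨ graphMap i c γ z ∉ K := by
  by_cases hzK : graphMap i c γ z ∈ K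
  · exact Or.inl ((h.graphMap_mem_iff (hK hzK)).2 hz)
  · exact Or.inr hzK

theorem integral_eq_halfSpace (h : IsGraphChart Ω p i c γ r) (hΩ : IsOpen Ω)
    (hK : K ⊆ Metric.ball p r) {g : E (m + 1) → ℝ} (hg : ∀ x, x ∉ K → g x = 0) :
    ∫ x in Ω, g x = ∫ z, g (graphMap i c γ z) ∂(halfSpace m) := by
  classical
  rw [← h.measurePreserving_graphMap.setIntegral_preimage_emb h.measurableEmbedding_graphMap,
    halfSpace_eq, ← integral_indicator (measurableSet_upper m),
    ← integral_indicator (h.continuous_graphMap.measurable hΩ.measurableSet)]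
  refine integral_congr_ae (Eventually.of_forall fun z => ?_)
  by_cases hzK : graphMap i c γ z ∈ K
  · have := h.graphMap_mem_iff (hK hzK)
    simp only [Set.indicator_apply, Set.mem_preimage, this, Set.mem_ofPred_eq]
  · simp [Set.indicator_apply, hg _ hzK]

theorem integrable_halfSpace (h : IsGraphChart Ω p i c γ r) (hΩ : IsOpen Ω)
    (hF : IsC1UpTo Ω K F) (hK : K ⊆ Metric.ball p r) {a : E (m + 1) → ℝ} (ha : Continuous a)
    (v : E (m + 1)) :
    Integrable (fun z => a (graphMap i c γ z) * fderiv ℝ F (graphMap i c γ z) v)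
      (halfSpace m) := by
  obtain ⟨C, hC0, hC⟩ := hF.exists_bound
  obtain ⟨A, hA⟩ := hF.isCompact.exists_bound_of_continuousOn ha.continuousOn
  have hKm : MeasurableSet (graphMap i c γ ⁻¹' K) :=
    h.continuous_graphMap.measurable hF.isCompact.isClosed.measurableSet
  have hcont : ContinuousOn
      (fun z => a (graphMap i c γ z) * fderiv ℝ F (graphMap i c γ z) v) {z | 0 < z.2} := by
    intro z hz
    have h1 : ContinuousAt (fun z => fderiv ℝ F (graphMap i c γ z)) z :=
      (hF.continuousAt_fderiv hΩ (h.mem_or_notMem hK hz)).comp h.continuous_graphMap.continuousAt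
    exact ((ha.comp h.continuous_graphMap).continuousAt.mul
      (h1.clm_apply continuousAt_const)).continuousWithinAt
  rw [halfSpace_eq]
  have hfin : volume ({z : E m × ℝ | 0 < z.2} ∩ graphMap i c γ ⁻¹' K) ≠ ⊤ := by
    refine ne_top_of_le_ne_top ?_ (measure_mono Set.inter_subset_right)
    rw [h.measurePreserving_graphMap.measure_preimage
      hF.isCompact.isClosed.measurableSet.nullMeasurableSet]
    exact hF.isCompact.measure_lt_top.ne
  have h1 : IntegrableOn (fun z => a (graphMap i c γ z) * fderiv ℝ F (graphMap i c γ z) v)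
      ({z : E m × ℝ | 0 < z.2} ∩ graphMap i c γ ⁻¹' K) := by
    refine ⟨(hcont.aestronglyMeasurable (measurableSet_upper m)).mono_measure
      (Measure.restrict_mono Set.inter_subset_left le_rfl),
      .restrict_of_bounded (C := A * (C * ‖v‖)) hfin.lt_top ?_⟩
    · refine (ae_restrict_iff' ((measurableSet_upper m).inter hKm)).2
        (Eventually.of_forall fun z hz => ?_)
      rw [norm_mul]
      have e1 := hA _ hz.2
      have e2 := hC _ (h.mem_or_notMem hK hz.1)
      refine mul_le_mul e1 ((ContinuousLinearMap.le_opNorm _ _).trans (by gcongr))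
        (norm_nonneg _) ((norm_nonneg _).trans e1)
  refine h1.of_forall_sdiff_eq_zero (measurableSet_upper m) fun z hz => ?_
  have : graphMap i c γ z ∉ K := fun hzK => hz.2 ⟨hz.1, hzK⟩
  rw [hF.fderiv_eq_zero this]
  simp

/-- The fundamental theorem of calculus along a line that enters `Ω` in the direction `c e_i`. -/
theorem integral_normal_line (h : IsGraphChart Ω p i c γ r) (hΩ : IsOpen Ω)
    (hF : IsC1UpTo Ω K F) (hK : K ⊆ Metric.ball p r) (y : E m)
    (hint : IntegrableOn (fun τ => fderiv ℝ F (graphMap i c γ (y, τ)) (basisVec i))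
      (Set.Ioi (0 : ℝ))) :
    ∫ τ in Set.Ioi (0 : ℝ), fderiv ℝ F (graphMap i c γ (y, τ)) (basisVec i)
      = - c * F (graphMap i c γ (y, 0)) := by
  have hline : ∀ τ : ℝ, HasDerivAt (fun τ => graphMap i c γ (y, τ)) (c • basisVec i) τ := by
    intro τ
    have h1 : HasDerivAt (fun τ : ℝ => c * (γ (hyperplane i y) + τ)) c τ := by
      simpa using ((hasDerivAt_id τ).const_add (γ (hyperplane i y))).const_mul c
    exact (h1.smul_const (basisVec i)).const_add (hyperplane i y)
  have hcl : Continuous fun τ : ℝ => graphMap i c γ (y, τ) :=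
    h.continuous_graphMap.comp (by fun_prop)
  have hderiv : ∀ τ ∈ Set.Ioi (0 : ℝ), HasDerivAt (fun τ => F (graphMap i c γ (y, τ)))
      (c * fderiv ℝ F (graphMap i c γ (y, τ)) (basisVec i)) τ := by
    intro τ hτ
    have h1 := (hF.differentiableAt hΩ (h.mem_or_notMem hK (z := (y, τ)) hτ)).hasFDerivAt
    have h2 := h1.comp_hasDerivAt τ (hline τ)
    rw [map_smul, smul_eq_mul] at h2
    exact h2
  have hcont : ContinuousWithinAt (fun τ => F (graphMap i c γ (y, τ))) (Set.Ici 0) 0 := by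
    by_cases hb : graphMap i c γ (y, 0) ∈ Metric.ball p r
    · have hmem : ∀ᶠ τ in 𝓝[Set.Ici 0] (0 : ℝ), graphMap i c γ (y, τ) ∈ closure Ω := by
        have h1 : ∀ᶠ τ in 𝓝[Set.Ici 0] (0 : ℝ), graphMap i c γ (y, τ) ∈ Metric.ball p r :=
          (hcl.tendsto 0).mono_left nhdsWithin_le_nhds (Metric.isOpen_ball.mem_nhds hb)
        filter_upwards [h1, self_mem_nhdsWithin] with τ h2 h3
        rcases (Set.mem_Ici.1 h3).eq_or_lt with rfl | h4
        · exact frontier_subset_closure (h.graphMap_zero_mem_frontier hΩ h2)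
        · exact subset_closure ((h.graphMap_mem_iff (z := (y, τ)) h2).2 h4)
      have h5 := hF.continuousOn _ (frontier_subset_closure (h.graphMap_zero_mem_frontier hΩ hb))
      exact h5.tendsto.comp (tendsto_nhdsWithin_iff.2
        ⟨(hcl.tendsto 0).mono_left nhdsWithin_le_nhds, hmem⟩)
    · have h1 := (hF.differentiableAt hΩ (Or.inr fun hk => hb (hK hk))).continuousAt
      exact (ContinuousAt.comp (f := fun τ : ℝ => graphMap i c γ (y, τ)) (x := (0 : ℝ)) h1
        hcl.continuousAt).continuousWithinAt
  have hlim : Tendsto (fun τ => F (graphMap i c γ (y, τ))) atTop (𝓝 0) := by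
    obtain ⟨R, hR⟩ := hF.isCompact.isBounded.exists_norm_le
    refine tendsto_const_nhds.congr' ?_
    filter_upwards [eventually_gt_atTop (R + |γ (hyperplane i y)|)] with τ hτ
    refine (hF.eq_zero _ fun hk => ?_).symm
    have h1 := (PiLp.norm_apply_le (graphMap i c γ (y, τ)) i).trans (hR _ hk)
    rw [graphMap_self, norm_mul, Real.norm_eq_abs, Real.norm_eq_abs] at h1
    have h2 : |c| = 1 := by rcases h.sign with rfl | rfl <;> simp
    rw [h2, one_mul] at h1
    have h3 := (abs_le.1 h1).2
    have h4 := neg_abs_le (γ (hyperplane i y))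
    simp only at h3
    linarith
  have hFTC := integral_Ioi_of_hasDerivAt_of_tendsto hcont hderiv (hint.const_mul c) hlim
  rw [integral_const_mul] at hFTC
  linear_combination c * hFTC
    - (∫ τ in Set.Ioi (0 : ℝ), fderiv ℝ F (graphMap i c γ (y, τ)) (basisVec i)) * h.sq

/-- The normal part of the divergence theorem, with a weight `a` independent of `x_i`. -/
theorem integral_normal (h : IsGraphChart Ω p i c γ r) (hΩ : IsOpen Ω)
    (hF : IsC1UpTo Ω K F) (hK : K ⊆ Metric.ball p r) {a : E (m + 1) → ℝ} (ha : Continuous a)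
    (hai : ∀ x (s : ℝ), a (x + s • basisVec i) = a x) :
    Integrable (fun y => - c * (a (graphMap i c γ (y, 0)) * F (graphMap i c γ (y, 0)))) ∧
    ∫ z, a (graphMap i c γ z) * fderiv ℝ F (graphMap i c γ z) (basisVec i) ∂(halfSpace m)
      = ∫ y, - c * (a (graphMap i c γ (y, 0)) * F (graphMap i c γ (y, 0))) := by
  have h1 := h.integrable_halfSpace hΩ hF hK (a := fun _ => 1) continuous_const (basisVec i)
  simp only [one_mul] at h1
  have h2 := h.integrable_halfSpace hΩ hF hK ha (basisVec i)
  have hconst : ∀ y τ, a (graphMap i c γ (y, τ)) = a (graphMap i c γ (y, 0)) := by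
    intro y τ
    rw [graphMap, graphMap, hai, hai]
  have key : (fun y => ∫ τ in Set.Ioi (0 : ℝ), a (graphMap i c γ (y, τ)) *
        fderiv ℝ F (graphMap i c γ (y, τ)) (basisVec i))
      =ᵐ[volume] fun y => - c * (a (graphMap i c γ (y, 0)) * F (graphMap i c γ (y, 0))) := by
    filter_upwards [h1.prod_right_ae] with y hy
    simp only [hconst]
    rw [integral_const_mul, h.integral_normal_line hΩ hF hK y hy]
    ring
  exact ⟨h2.integral_prod_left.congr key, by
    rw [integral_prod _ h2]; exact integral_congr_ae key⟩

/-- The derivative of `F ∘ graphMap` in a direction `u` of the hyperplane integrates to zero over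
the half-space, slice by slice. -/
theorem integral_tangential (h : IsGraphChart Ω p i c γ r) (hΩ : IsOpen Ω)
    (hF : IsC1UpTo Ω K F) (hK : K ⊆ Metric.ball p r) (u : E m) :
    ∫ z, (fderiv ℝ F (graphMap i c γ z) (hyperplane i u) +
      c * (fderiv ℝ γ (graphMap i c γ z) (hyperplane i u) *
        fderiv ℝ F (graphMap i c γ z) (basisVec i))) ∂(halfSpace m) = 0 := by
  have hb : Continuous fun x => fderiv ℝ γ x (hyperplane i u) :=
    (h.smooth.continuous_fderiv (by simp)).clm_apply continuous_const
  have h1 := h.integrable_halfSpace hΩ hF hK (a := fun _ => 1) continuous_const (hyperplane i u)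
  simp only [one_mul] at h1
  have h2 := h.integrable_halfSpace hΩ hF hK hb (basisVec i)
  have h3 := h1.add (h2.const_mul c)
  have h3' : Integrable (fun z => (fderiv ℝ F (graphMap i c γ z) (hyperplane i u) +
      c * (fderiv ℝ γ (graphMap i c γ z) (hyperplane i u) *
        fderiv ℝ F (graphMap i c γ z) (basisVec i)))) (halfSpace m) := h3
  rw [integral_prod_symm _ h3']
  refine (integral_congr_ae ?_).trans (integral_zero _ _)
  filter_upwards [h3'.prod_left_ae, ae_restrict_mem measurableSet_Ioi] with τ hτ hτ0
  have hmap : ∀ y : E m, HasFDerivAt (fun y => graphMap i c γ (y, τ))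
      ((hyperplane i).toContinuousLinearMap + (c • (fderiv ℝ γ (hyperplane i y)).comp
          (hyperplane i).toContinuousLinearMap).smulRight (basisVec i)) y := by
    intro y
    have e1 : HasFDerivAt (fun y => c * (γ (hyperplane i y) + τ))
        (c • (fderiv ℝ γ (hyperplane i y)).comp (hyperplane i).toContinuousLinearMap) y :=
      (((h.differentiableAt _).hasFDerivAt.comp y
        (hyperplane i).toContinuousLinearMap.hasFDerivAt).add_const τ).const_mul c
    exact (hyperplane i).toContinuousLinearMap.hasFDerivAt.add (e1.smul_const (basisVec i))
  have hline : ∀ y : E m, HasLineDerivAt ℝ (fun y => F (graphMap i c γ (y, τ)))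
      (fderiv ℝ F (graphMap i c γ (y, τ)) (hyperplane i u) +
      c * (fderiv ℝ γ (graphMap i c γ (y, τ)) (hyperplane i u) *
        fderiv ℝ F (graphMap i c γ (y, τ)) (basisVec i))) y u := by
    intro y
    have e1 := ((hF.differentiableAt hΩ (h.mem_or_notMem hK (z := (y, τ)) hτ0)).hasFDerivAt.comp y
      (hmap y)).hasLineDerivAt u
    have e2 : fderiv ℝ γ (graphMap i c γ (y, τ)) = fderiv ℝ γ (hyperplane i y) := by
      rw [graphMap, h.fderiv_add_smul]
    have e3 : fderiv ℝ F (graphMap i c γ (y, τ)) (hyperplane i u) +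
        c * (fderiv ℝ γ (graphMap i c γ (y, τ)) (hyperplane i u) *
          fderiv ℝ F (graphMap i c γ (y, τ)) (basisVec i))
        = ((fderiv ℝ F (graphMap i c γ (y, τ))).comp
          ((hyperplane i).toContinuousLinearMap + (c • (fderiv ℝ γ (hyperplane i y)).comp
          (hyperplane i).toContinuousLinearMap).smulRight (basisVec i))) u := by
      simp only [ContinuousLinearMap.comp_apply, add_apply,
        ContinuousLinearMap.smulRight_apply, smul_apply, map_add, map_smul,
        smul_eq_mul, LinearIsometry.coe_toContinuousLinearMap, e2]
      ring
    rw [e3]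
    exact e1
  have hcont : Continuous fun y => F (graphMap i c γ (y, τ)) := by
    refine continuous_iff_continuousAt.2 fun y => ?_
    exact ContinuousAt.comp (f := fun y => graphMap i c γ (y, τ))
      (hF.differentiableAt hΩ (h.mem_or_notMem hK (z := (y, τ)) hτ0)).continuousAt
      (hmap y).continuousAt
  have hsupp : HasCompactSupport fun y => F (graphMap i c γ (y, τ)) := by
    obtain ⟨R, hR⟩ := hF.isCompact.isBounded.exists_norm_le
    refine HasCompactSupport.intro (isCompact_closedBall (0 : E m) R) fun y hy => ?_
    refine hF.eq_zero _ fun hk => hy ?_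
    rw [mem_closedBall_zero_iff]
    refine le_trans ?_ (hR _ hk)
    exact norm_le_norm_graphMap (i := i) (c := c) (γ := γ) y τ
  -- integration by parts against the constant `1`
  have := integral_bilinear_hasLineDerivAt_right_eq_neg_left_of_integrable
    (μ := (volume : Measure (E m))) (B := ContinuousLinearMap.mul ℝ ℝ)
    (f := fun _ => (1 : ℝ)) (f' := fun _ => 0) (v := u)
    (g := fun y => F (graphMap i c γ (y, τ)))
    (g' := fun y => fderiv ℝ F (graphMap i c γ (y, τ)) (hyperplane i u) +
      c * (fderiv ℝ γ (graphMap i c γ (y, τ)) (hyperplane i u) *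
        fderiv ℝ F (graphMap i c γ (y, τ)) (basisVec i)))
    (by simp) (by simpa using hτ)
    (by simpa using hcont.integrable_of_hasCompactSupport hsupp)
    (fun y _ => by simpa using (hasFDerivAt_const (1 : ℝ) y).hasLineDerivAt u)
    (fun y _ => hline y)
  simpa using this

/-- The divergence theorem for a function supported in a graph chart. -/
theorem integral_fderiv (h : IsGraphChart Ω p i c γ r) (hΩ : IsOpen Ω)
    (hF : IsC1UpTo Ω K F) (hK : K ⊆ Metric.ball p r) (v : E (m + 1)) :
    ∫ x in Ω, fderiv ℝ F x v = ∫ x, F x * ⟪outwardNormal Ω x, v⟫_ℝ ∂(surfaceMeasure Ω) := by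
  obtain ⟨u, hu⟩ := exists_hyperplane_add i v
  have hb : Continuous fun x => fderiv ℝ γ x (hyperplane i u) :=
    (h.smooth.continuous_fderiv (by simp)).clm_apply continuous_const
  have hbi : ∀ x (s : ℝ), fderiv ℝ γ (x + s • basisVec i) (hyperplane i u)
      = fderiv ℝ γ x (hyperplane i u) := fun x s => by rw [h.fderiv_add_smul]
  have h1 := h.integrable_halfSpace hΩ hF hK (a := fun _ => 1) continuous_const (hyperplane i u)
  have h1' := h.integrable_halfSpace hΩ hF hK (a := fun _ => 1) continuous_const (basisVec i)
  have h2 := h.integrable_halfSpace hΩ hF hK hb (basisVec i)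
  obtain ⟨i1, n1⟩ := h.integral_normal hΩ hF hK (a := fun _ => 1) continuous_const
    (fun _ _ => rfl)
  obtain ⟨i2, n2⟩ := h.integral_normal hΩ hF hK hb hbi
  simp only [one_mul] at h1 h1' i1 n1
  have ht := h.integral_tangential hΩ hF hK u
  have e0 : ∫ x in Ω, fderiv ℝ F x v
      = ∫ z, fderiv ℝ F (graphMap i c γ z) v ∂(halfSpace m) :=
    h.integral_eq_halfSpace hΩ hK fun x hx => by rw [hF.fderiv_eq_zero hx]; simp
  have e1 : ∀ z, fderiv ℝ F (graphMap i c γ z) v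
      = fderiv ℝ F (graphMap i c γ z) (hyperplane i u)
        + v i * fderiv ℝ F (graphMap i c γ z) (basisVec i) := fun z => by
    conv_lhs => rw [hu]
    simp
  have e2 : ∀ x, fderiv ℝ γ x v = fderiv ℝ γ x (hyperplane i u) := fun x => by
    conv_lhs => rw [hu]
    simp [h.fderiv_basisVec]
  rw [integral_add h1 (h2.const_mul c), integral_const_mul, n2, integral_const_mul] at ht
  rw [e0]
  simp only [e1]
  rw [integral_add h1 (h1'.const_mul _), integral_const_mul, n1]
  rw [h.integral_surfaceMeasure hΩ (fun x hx => by
    rw [hF.eq_zero x fun hk => hx (hK hk), zero_mul])]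
  have e3 : ∀ y, ‖graphNormal i c γ (graphMap i c γ (y, 0))‖ * (F (graphMap i c γ (y, 0)) *
      ⟪outwardNormal Ω (graphMap i c γ (y, 0)), v⟫_ℝ)
      = fderiv ℝ γ (graphMap i c γ (y, 0)) (hyperplane i u) * F (graphMap i c γ (y, 0))
        + v i * (- c * F (graphMap i c γ (y, 0))) := by
    intro y
    by_cases hy : graphMap i c γ (y, 0) ∈ K
    · rw [h.outwardNormal_eq hΩ (hK hy) (h.graphMap_zero_mem_frontier hΩ (hK hy)),
        inner_smul_left, inner_graphNormal, e2, conj_trivial]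
      have := norm_ne_zero_iff.2 (h.graphNormal_ne_zero (graphMap i c γ (y, 0)))
      field_simp
      ring
    · rw [hF.eq_zero _ hy]; ring
  have i2' : Integrable fun y => fderiv ℝ γ (graphMap i c γ (y, 0)) (hyperplane i u) *
      F (graphMap i c γ (y, 0)) := by
    refine (i2.const_mul (- c)).congr (Eventually.of_forall fun y => ?_)
    simp only
    linear_combination (fderiv ℝ γ (graphMap i c γ (y, 0)) (hyperplane i u) *
      F (graphMap i c γ (y, 0))) * h.sq
  simp only [e3]
  rw [integral_add i2' (i1.const_mul _), integral_const_mul (v i)]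
  linear_combination ht + (∫ y, fderiv ℝ γ (graphMap i c γ (y, 0)) (hyperplane i u) *
      F (graphMap i c γ (y, 0))) * h.sq

end IsGraphChart

end LocalGaussGreen

/-! ### Finite smooth partitions of unity -/

section Partition

open scoped Manifold

theorem exists_finite_partition {n : ℕ} {K : Set (E n)} (hK : IsCompact K) (U : E n → Set (E n))
    (hU : ∀ p ∈ K, U p ∈ 𝓝 p) :
    ∃ (s : Finset (E n)) (χ : E n → E n → ℝ), (∀ p ∈ s, p ∈ K) ∧ (∀ p, ContDiff ℝ ∞ (χ p)) ∧
      (∀ p ∈ s, IsCompact (tsupport (χ p)) ∧ tsupport (χ p) ⊆ U p) ∧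
      (∀ p x, 0 ≤ χ p x) ∧ ∀ x ∈ K, ∑ p ∈ s, χ p x = 1 := by
  classical
  set W : E n → Set (E n) := fun p => interior (U p) ∩ Metric.ball p 1 with hW
  obtain ⟨s, hsK, hcov⟩ := hK.elim_nhds_subcover W fun p hp =>
    inter_mem (interior_mem_nhds.2 (hU p hp)) (Metric.ball_mem_nhds p one_pos)
  obtain ⟨f, hf⟩ := SmoothPartitionOfUnity.exists_isSubordinate 𝓘(ℝ, E n) hK.isClosed
    (fun p : s => W p) (fun p => isOpen_interior.inter Metric.isOpen_ball) (by
      intro x hx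
      obtain ⟨p, hp, hxp⟩ := Set.mem_iUnion₂.1 (hcov hx)
      exact Set.mem_iUnion.2 ⟨⟨p, hp⟩, hxp⟩)
  refine ⟨s, fun p x => if hp : p ∈ s then f ⟨p, hp⟩ x else 0, hsK, fun p => ?_,
    fun p hp => ?_, fun p x => ?_, fun x hx => ?_⟩
  · by_cases hp : p ∈ s
    · simpa only [hp, dite_true] using (f ⟨p, hp⟩).contMDiff.contDiff
    · simpa only [hp, dite_false] using contDiff_const
  · simp only [hp, dite_true]
    have h1 : tsupport (f ⟨p, hp⟩) ⊆ W p := hf ⟨p, hp⟩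
    refine ⟨?_, h1.trans (Set.inter_subset_left.trans interior_subset)⟩
    exact (isCompact_closedBall p 1).of_isClosed_subset (isClosed_tsupport _)
      (h1.trans (Set.inter_subset_right.trans Metric.ball_subset_closedBall))
  · by_cases hp : p ∈ s
    · simpa only [hp, dite_true] using f.nonneg ⟨p, hp⟩ x
    · simp only [hp, dite_false, le_refl]
  · have h1 := f.sum_eq_one hx
    rw [finsum_eq_sum_of_fintype] at h1
    rw [← Finset.sum_attach, ← h1]
    simp

end Partition

/-! ### The divergence theorem on a smooth bounded domain -/

section Domain

open scoped InnerProductSpace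

theorem HasSmoothBoundary.exists_chart {n : ℕ} {Ω : Set (E n)} (h : HasSmoothBoundary Ω) {p : E n}
    (hp : p ∈ frontier Ω) : ∃ i c γ r, IsGraphChart Ω p i c γ r := by
  obtain ⟨i, c, γ, r, h1, h2, h3, h4, h5⟩ := h p hp
  exact ⟨i, c, γ, r, ⟨h1, h2, h3, h4, h5⟩⟩

/-- A bounded open set with smooth boundary. -/
structure IsSmoothDomain {m : ℕ} (Ω : Set (E (m + 1))) : Prop where
  isOpen : IsOpen Ω
  isBounded : Bornology.IsBounded Ω
  smooth : HasSmoothBoundary Ω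

namespace IsSmoothDomain

variable {m : ℕ} {Ω : Set (E (m + 1))}

theorem isCompact_closure (hΩ : IsSmoothDomain Ω) : IsCompact (closure Ω) :=
  hΩ.isBounded.isCompact_closure

theorem isCompact_frontier (hΩ : IsSmoothDomain Ω) : IsCompact (frontier Ω) :=
  hΩ.isCompact_closure.of_isClosed_subset isClosed_frontier frontier_subset_closure

theorem mem_or_mem_frontier (hΩ : IsSmoothDomain Ω) {p : E (m + 1)} (hp : p ∈ closure Ω) :
    p ∈ Ω ∨ p ∈ frontier Ω := by
  rw [hΩ.isOpen.frontier_eq]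
  by_cases h : p ∈ Ω
  · exact Or.inl h
  · exact Or.inr ⟨hp, h⟩

theorem isFiniteMeasure_volume (hΩ : IsSmoothDomain Ω) :
    IsFiniteMeasure ((volume : Measure (E (m + 1))).restrict Ω) :=
  ⟨by rw [Measure.restrict_apply_univ]; exact hΩ.isBounded.measure_lt_top⟩

theorem isFiniteMeasure_surface (hΩ : IsSmoothDomain Ω) : IsFiniteMeasure (surfaceMeasure Ω) := by
  have h1 : surfaceMeasure Ω (frontier Ω) < ⊤ := by
    refine hΩ.isCompact_frontier.measure_lt_top_of_nhdsWithin fun p hp => ?_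
    obtain ⟨i, c, γ, r, h⟩ := hΩ.smooth.exists_chart hp
    exact ⟨Metric.ball p r, mem_nhdsWithin_of_mem_nhds (Metric.ball_mem_nhds p h.pos),
      h.surfaceMeasure_ball_lt_top hΩ.isOpen⟩
  refine ⟨?_⟩
  rw [surfaceMeasure, Measure.restrict_apply_univ]
  rwa [surfaceMeasure, Measure.restrict_apply_self] at h1

theorem continuousOn_outwardNormal (hΩ : IsSmoothDomain Ω) :
    ContinuousOn (outwardNormal Ω) (frontier Ω) := by
  intro p hp
  obtain ⟨i, c, γ, r, h⟩ := hΩ.smooth.exists_chart hp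
  have h1 : ContinuousAt (fun x => ‖graphNormal i c γ x‖⁻¹ • graphNormal i c γ x) p :=
    (h.continuous_graphNormal.norm.continuousAt.inv₀
      (norm_ne_zero_iff.2 (h.graphNormal_ne_zero p))).smul h.continuous_graphNormal.continuousAt
  refine h1.continuousWithinAt.congr_of_eventuallyEq ?_
    (h.outwardNormal_eq hΩ.isOpen (Metric.mem_ball_self h.pos) hp)
  filter_upwards [mem_nhdsWithin_of_mem_nhds (Metric.ball_mem_nhds p h.pos),
    self_mem_nhdsWithin] with x hx hxf
  exact h.outwardNormal_eq hΩ.isOpen hx hxf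

theorem integrable_surface (hΩ : IsSmoothDomain Ω) {g : E (m + 1) → ℝ}
    (hg : ContinuousOn g (frontier Ω)) : Integrable g (surfaceMeasure Ω) := by
  have := hΩ.isFiniteMeasure_surface
  obtain ⟨C, hC⟩ := hΩ.isCompact_frontier.exists_bound_of_continuousOn hg
  refine Integrable.of_bound (hg.aestronglyMeasurable isClosed_frontier.measurableSet) C ?_
  exact (ae_restrict_iff' isClosed_frontier.measurableSet).2 (Eventually.of_forall hC)

/-- The uniform interior cone condition, locally: near any point of the closure there is a
direction `e` such that the points `x + ε e`, together with a ball of radius proportional to `ε`,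
lie in `Ω` for all nearby `x ∈ Ω`. -/
theorem exists_cone (hΩ : IsSmoothDomain Ω) {p : E (m + 1)} (hp : p ∈ closure Ω) :
    ∃ (e : E (m + 1)) (κ r ε₀ : ℝ), 0 < κ ∧ 0 < r ∧ 0 < ε₀ ∧
      ∀ x ∈ Ω, x ∈ Metric.ball p r → ∀ ε, 0 < ε → ε < ε₀ →
        Metric.closedBall (x + ε • e) (κ * ε) ⊆ Ω := by
  rcases hΩ.mem_or_mem_frontier hp with hp | hp
  · obtain ⟨r, hr, hball⟩ := Metric.isOpen_iff.1 hΩ.isOpen p hp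
    -- at an interior point no shift is needed
    refine ⟨0, 1, r / 2, r / 2, one_pos, by positivity, by positivity, ?_⟩
    intro x _ hx ε _ hε y hy
    apply hball
    rw [Metric.mem_ball] at hx ⊢
    rw [smul_zero, add_zero, Metric.mem_closedBall, one_mul] at hy
    linarith [dist_triangle y x p]
  · obtain ⟨i, c, γ, r₀, h⟩ := hΩ.smooth.exists_chart hp
    obtain ⟨K, t, ht, hL⟩ := (h.smooth.of_le (m := 1) (by norm_cast)).contDiffAt (x := p)
      |>.exists_lipschitzOnWith
    obtain ⟨ρ, hρ, hρt⟩ := Metric.mem_nhds_iff.1 (inter_mem ht (Metric.ball_mem_nhds p h.pos))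
    have hK0 : (0 : ℝ) ≤ K := K.2
    -- `K` is a Lipschitz constant of `γ`; moving up by `ε` gains `ε`, while moving by `κ ε` in any
    -- direction loses at most `(K + 1) κ ε < ε`
    refine ⟨c • basisVec i, 1 / (K + 2), ρ / 2, ρ / 4, by positivity, by positivity,
      by positivity, ?_⟩
    intro x hxΩ hx ε hε hε' y hy
    set κ : ℝ := 1 / (K + 2) with hκ
    have hκ0 : 0 < κ := by positivity
    have hκK : K * κ + κ < 1 := by rw [hκ]; field_simp; linarith
    have hκ1 : κ < 1 := by nlinarith
    have hce : ‖c • (basisVec i : E (m + 1))‖ = 1 := by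
      rw [norm_smul, norm_basisVec, mul_one]; rcases h.sign with rfl | rfl <;> simp
    have hd1 : dist (x + ε • c • (basisVec i : E (m + 1))) x = ε := by
      rw [dist_eq_norm, add_sub_cancel_left, norm_smul, hce, mul_one, Real.norm_eq_abs,
        abs_of_pos hε]
    rw [Metric.mem_closedBall] at hy
    rw [Metric.mem_ball] at hx
    have hκε : κ * ε < ε := by nlinarith
    have hxε : x + ε • c • (basisVec i : E (m + 1)) ∈ Metric.ball p ρ := by
      rw [Metric.mem_ball]
      linarith [dist_triangle (x + ε • c • (basisVec i : E (m + 1))) x p]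
    have hyρ : y ∈ Metric.ball p ρ := by
      rw [Metric.mem_ball]
      linarith [dist_triangle (x + ε • c • (basisVec i : E (m + 1))) x p,
        dist_triangle y (x + ε • c • (basisVec i : E (m + 1))) p]
    have hxρ : x ∈ Metric.ball p ρ := by rw [Metric.mem_ball]; linarith
    rw [h.mem_iff y (hρt hyρ).2]
    have h1 := (h.mem_iff x (hρt hxρ).2).1 hxΩ
    have h2 := hL.dist_le_mul y (hρt hyρ).1 _ (hρt hxε).1
    rw [smul_smul, h.apply_add_smul, Real.dist_eq, ← smul_smul] at h2
    have h3 := (PiLp.norm_apply_le (y - (x + ε • c • (basisVec i : E (m + 1)))) i)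
    rw [← dist_eq_norm, Real.norm_eq_abs] at h3
    simp only [PiLp.sub_apply, PiLp.add_apply, PiLp.smul_apply, basisVec_self, smul_eq_mul,
      mul_one] at h3
    have h4 := (abs_le.1 h2).2
    have h5 : K * dist y (x + ε • c • (basisVec i : E (m + 1))) ≤ K * (κ * ε) := by gcongr
    have h6 : c * (x i + ε * c) - κ * ε ≤ c * y i := by
      have h7 := abs_le.1 (h3.trans hy)
      rcases h.sign with rfl | rfl
      · linarith [h7.1]
      · linarith [h7.2]
    have h8 : c * (x i + ε * c) = c * x i + ε := by linear_combination ε * h.sq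
    nlinarith

/-- The closure of `Ω` contains the convex hull of each of its points with a ball, by the cone
condition, so that derivatives within the closure are well defined. -/
theorem uniqueDiffOn_closure (hΩ : IsSmoothDomain Ω) : UniqueDiffOn ℝ (closure Ω) := by
  intro p hp
  obtain ⟨e, κ, r, ε₀, hκ, hr, hε₀, hcone⟩ := hΩ.exists_cone hp
  have hcl : ∀ ε, 0 < ε → ε < ε₀ → Metric.ball (p + ε • e) (κ * ε) ⊆ closure Ω := by
    intro ε h1 h2 y hy
    have hne : ∃ x ∈ Ω, dist x p < min r (κ * ε - dist y (p + ε • e)) := by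
      obtain ⟨x, hx, hxp⟩ := Metric.mem_closure_iff.1 hp (min r (κ * ε - dist y (p + ε • e)))
        (lt_min hr (by rw [Metric.mem_ball] at hy; linarith))
      exact ⟨x, hx, by rwa [dist_comm]⟩
    obtain ⟨x, hx, hxp⟩ := hne
    refine subset_closure (hcone x hx (hxp.trans_le (min_le_left _ _)) ε h1 h2 ?_)
    have h3 : dist (p + ε • e) (x + ε • e) = dist x p := by
      rw [dist_add_right, dist_comm]
    rw [Metric.mem_closedBall]
    have := dist_triangle y (p + ε • e) (x + ε • e)
    have := hxp.trans_le (min_le_right _ _)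
    linarith
  set ε := ε₀ / 2 with hε
  have hball : (Metric.ball (p + ε • e) (κ * ε)).Nonempty :=
    ⟨_, Metric.mem_ball_self (by positivity)⟩
  have hsub : convexHull ℝ (insert p (Metric.ball (p + ε • e) (κ * ε))) ⊆ closure Ω := by
    rw [convexHull_insert hball, (convex_ball _ _).convexHull_eq]
    intro y hy
    rw [convexJoin_singleton_left] at hy
    obtain ⟨z, hz, hyz⟩ := Set.mem_iUnion₂.1 hy
    rw [segment_eq_image'] at hyz
    obtain ⟨θ, ⟨hθ0, hθ1⟩, rfl⟩ := hyz
    rcases hθ0.eq_or_lt with rfl | hθ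
    · simpa using hp
    · refine hcl (θ * ε) (by positivity) (by nlinarith) ?_
      rw [Metric.mem_ball, dist_eq_norm] at hz ⊢
      have : p + θ • (z - p) - (p + (θ * ε) • e) = θ • (z - (p + ε • e)) := by module
      simp only [this]
      rw [norm_smul, Real.norm_eq_abs, abs_of_pos hθ]
      nlinarith
  refine UniqueDiffWithinAt.mono (uniqueDiffWithinAt_convex (convex_convexHull ℝ _) ?_ ?_) hsub
  · obtain ⟨q, hq⟩ := hball
    exact ⟨q, interior_mono ((Set.subset_insert _ _).trans (subset_convexHull ℝ _))
      (by rwa [Metric.isOpen_ball.interior_eq])⟩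
  · exact subset_closure (subset_convexHull ℝ _ (Set.mem_insert _ _))

theorem pd_eq_fderiv (hΩ : IsSmoothDomain Ω) (j : Fin (m + 1)) (g : E (m + 1) → ℝ)
    {x : E (m + 1)} (hx : x ∈ Ω) : pd Ω j g x = fderiv ℝ g x (basisVec j) := by
  rw [pd, fderivWithin_of_mem_nhds (mem_of_superset (hΩ.isOpen.mem_nhds hx) subset_closure)]

theorem continuousOn_pd (hΩ : IsSmoothDomain Ω) (j : Fin (m + 1)) {g : E (m + 1) → ℝ}
    (hg : ContDiffOn ℝ 1 g (closure Ω)) : ContinuousOn (pd Ω j g) (closure Ω) :=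
  (hg.continuousOn_fderivWithin hΩ.uniqueDiffOn_closure le_rfl).clm_apply continuousOn_const

theorem contDiffOn_pd (hΩ : IsSmoothDomain Ω) (j : Fin (m + 1)) {g : E (m + 1) → ℝ}
    (hg : ContDiffOn ℝ ∞ g (closure Ω)) : ContDiffOn ℝ ∞ (pd Ω j g) (closure Ω) :=
  (hg.fderivWithin hΩ.uniqueDiffOn_closure le_rfl).clm_apply contDiffOn_const

theorem isC1UpTo (hΩ : IsSmoothDomain Ω) {g : E (m + 1) → ℝ} {K : Set (E (m + 1))}
    (hK : IsCompact K) (hgK : ∀ x, x ∉ K → g x = 0) (hg : ContDiffOn ℝ 1 g (closure Ω)) :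
    IsC1UpTo Ω K g := by
  have hc := hg.continuousOn_fderivWithin hΩ.uniqueDiffOn_closure le_rfl
  have heq : ∀ x ∈ Ω, fderivWithin ℝ g (closure Ω) x = fderiv ℝ g x := fun x hx =>
    fderivWithin_of_mem_nhds (mem_of_superset (hΩ.isOpen.mem_nhds hx) subset_closure)
  obtain ⟨C, hC⟩ := hΩ.isCompact_closure.exists_bound_of_continuousOn hc
  exact
    { isCompact := hK
      eq_zero := hgK
      continuousOn := hg.continuousOn
      differentiableOn := (hg.differentiableOn one_ne_zero).mono subset_closure
      continuousOn_fderiv := (hc.mono subset_closure).congr fun x hx => (heq x hx).symm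
      bounded := ⟨C, fun x hx => by rw [← heq x hx]; exact hC x (subset_closure hx)⟩ }

theorem integrableOn_of_continuousOn (hΩ : IsSmoothDomain Ω) {g : E (m + 1) → ℝ}
    (hg : ContinuousOn g (closure Ω)) : IntegrableOn g Ω :=
  (hg.integrableOn_compact hΩ.isCompact_closure).mono_set subset_closure

theorem integrableOn_fderiv (hΩ : IsSmoothDomain Ω) {g : E (m + 1) → ℝ}
    (hg : ContDiffOn ℝ 1 g (closure Ω)) (j : Fin (m + 1)) :
    IntegrableOn (fun x => fderiv ℝ g x (basisVec j)) Ω :=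
  (hΩ.integrableOn_of_continuousOn (hΩ.continuousOn_pd j hg)).congr_fun
    (fun _ hx => hΩ.pd_eq_fderiv j g hx) hΩ.isOpen.measurableSet

theorem continuousOn_normal_apply (hΩ : IsSmoothDomain Ω) (j : Fin (m + 1)) :
    ContinuousOn (fun x => outwardNormal Ω x j) (frontier Ω) :=
  (EuclideanSpace.proj j : E (m + 1) →L[ℝ] ℝ).continuous.comp_continuousOn
    hΩ.continuousOn_outwardNormal

/-- The divergence theorem for a function supported in the interior. -/
theorem integral_fderiv_interior (hΩ : IsSmoothDomain Ω) {g : E (m + 1) → ℝ}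
    (hg : ContDiffOn ℝ 1 g (closure Ω)) (hc : IsCompact (tsupport g)) (hs : tsupport g ⊆ Ω)
    (v : E (m + 1)) : ∫ x in Ω, fderiv ℝ g x v = 0 := by
  have hgC : ContDiff ℝ 1 g := by
    refine contDiff_iff_contDiffAt.2 fun x => ?_
    by_cases hx : x ∈ tsupport g
    · exact hg.contDiffAt (mem_of_superset (hΩ.isOpen.mem_nhds (hs hx)) subset_closure)
    · exact (contDiffAt_const (c := (0 : ℝ))).congr_of_eventuallyEq
        (notMem_tsupport_iff_eventuallyEq.1 hx)
  have hcs : HasCompactSupport g := hc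
  have hd : Continuous fun x => fderiv ℝ g x v :=
    (hgC.continuous_fderiv one_ne_zero).clm_apply continuous_const
  have hdc : HasCompactSupport fun x => fderiv ℝ g x v := hcs.fderiv_apply (𝕜 := ℝ) v
  have h0 : ∀ x, x ∉ Ω → fderiv ℝ g x v = 0 := by
    intro x hx
    have : fderiv ℝ g x = 0 := by
      rw [(notMem_tsupport_iff_eventuallyEq.1 fun h => hx (hs h)).fderiv_eq]; simp
    simp [this]
  rw [setIntegral_eq_integral_of_forall_compl_eq_zero h0]
  have := integral_mul_fderiv_eq_neg_fderiv_mul_of_integrable (μ := (volume : Measure (E (m + 1))))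
    (f := fun _ => (1 : ℝ)) (g := g) (v := v) (by simp)
    (by simpa using hd.integrable_of_hasCompactSupport hdc)
    (by simpa using hgC.continuous.integrable_of_hasCompactSupport hcs)
    (fun _ _ => differentiableAt_const _)
    (fun x _ => hgC.differentiable one_ne_zero x)
  simpa using this

/-- The divergence theorem on a smooth bounded domain, one partial derivative at a time. -/
theorem integral_pd (hΩ : IsSmoothDomain Ω) {F : E (m + 1) → ℝ}
    (hF : ContDiffOn ℝ 1 F (closure Ω)) (j : Fin (m + 1)) :
    ∫ x in Ω, pd Ω j F x = ∫ x, F x * outwardNormal Ω x j ∂(surfaceMeasure Ω) := by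
  have hex : ∀ p : E (m + 1), ∃ U ∈ 𝓝 p, p ∈ closure Ω → U ⊆ Ω ∨
      ∃ q i c γ r, IsGraphChart Ω q i c γ r ∧ U ⊆ Metric.ball q r := by
    intro p
    by_cases hp : p ∈ closure Ω
    · rcases hΩ.mem_or_mem_frontier hp with h | h
      · exact ⟨Ω, hΩ.isOpen.mem_nhds h, fun _ => Or.inl subset_rfl⟩
      · obtain ⟨i, c, γ, r, hch⟩ := hΩ.smooth.exists_chart h
        exact ⟨Metric.ball p r, Metric.ball_mem_nhds p hch.pos,
          fun _ => Or.inr ⟨p, i, c, γ, r, hch, subset_rfl⟩⟩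
    · exact ⟨Set.univ, univ_mem, fun h => absurd h hp⟩
  choose U hU hUΩ using hex
  obtain ⟨s, χ, hs, hχ, hχs, -, hsum⟩ := exists_finite_partition hΩ.isCompact_closure U
    fun p _ => hU p
  have hG : ∀ p, ContDiffOn ℝ 1 (fun x => χ p x * F x) (closure Ω) := fun p =>
    ((hχ p).of_le (by norm_cast)).contDiffOn.mul hF
  have hsupp : ∀ p, tsupport (fun x => χ p x * F x) ⊆ tsupport (χ p) := fun p =>
    closure_mono fun x hx => left_ne_zero_of_mul hx
  have hpiece : ∀ p ∈ s, ∫ x in Ω, fderiv ℝ (fun x => χ p x * F x) x (basisVec j)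
      = ∫ x, χ p x * F x * outwardNormal Ω x j ∂(surfaceMeasure Ω) := by
    intro p hp
    rcases hUΩ p (hs p hp) with h | ⟨q, i, c, γ, r, hch, h⟩
    · rw [hΩ.integral_fderiv_interior (hG p) ((hχs p hp).1.of_isClosed_subset
        (isClosed_tsupport _) (hsupp p)) ((hsupp p).trans ((hχs p hp).2.trans h))]
      have h0 : ∀ x ∈ frontier Ω, χ p x * F x * outwardNormal Ω x j = 0 := by
        intro x hx
        have : χ p x = 0 := by
          refine image_eq_zero_of_notMem_tsupport fun hxs => ?_
          have h1 := (hχs p hp).2.trans h hxs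
          rw [hΩ.isOpen.frontier_eq] at hx
          exact hx.2 h1
        rw [this]; ring
      rw [surfaceMeasure, setIntegral_congr_fun isClosed_frontier.measurableSet h0]
      simp
    · have hC1 := hΩ.isC1UpTo (K := tsupport (χ p)) (hχs p hp).1 (fun x hx => by
        rw [image_eq_zero_of_notMem_tsupport hx, zero_mul]) (hG p)
      rw [hch.integral_fderiv hΩ.isOpen hC1 ((hχs p hp).2.trans h)]
      simp only [inner_basisVec]
  have e1 : ∫ x in Ω, pd Ω j F x
      = ∫ x in Ω, ∑ p ∈ s, fderiv ℝ (fun x => χ p x * F x) x (basisVec j) := by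
    refine setIntegral_congr_fun hΩ.isOpen.measurableSet fun x hx => ?_
    have hloc : F =ᶠ[𝓝 x] fun y => ∑ p ∈ s, χ p y * F y := by
      filter_upwards [hΩ.isOpen.mem_nhds hx] with y hy
      rw [← Finset.sum_mul, hsum y (subset_closure hy), one_mul]
    simp only [hΩ.pd_eq_fderiv j F hx]
    rw [hloc.fderiv_eq, fderiv_fun_sum]
    · simp
    · intro p _
      exact ((hG p).differentiableOn one_ne_zero).differentiableAt
        (mem_of_superset (hΩ.isOpen.mem_nhds hx) subset_closure)
  have e2 : ∫ x, F x * outwardNormal Ω x j ∂(surfaceMeasure Ω)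
      = ∫ x, ∑ p ∈ s, χ p x * F x * outwardNormal Ω x j ∂(surfaceMeasure Ω) := by
    refine setIntegral_congr_fun isClosed_frontier.measurableSet fun x hx => ?_
    simp only [← Finset.sum_mul, hsum x (frontier_subset_closure hx), one_mul]
  have hint : ∀ p ∈ s, Integrable (fun x => χ p x * F x * outwardNormal Ω x j)
      (surfaceMeasure Ω) := fun p _ => hΩ.integrable_surface
    (((hG p).continuousOn.mono frontier_subset_closure).mul (hΩ.continuousOn_normal_apply j))
  rw [e1, e2, integral_finsetSum _ fun p _ => hΩ.integrableOn_fderiv (hG p) j,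
    integral_finsetSum _ hint]
  exact Finset.sum_congr rfl hpiece

end IsSmoothDomain

end Domain

/-! ### Mollification in `L²` -/

section ApproximateIdentity

open scoped Convolution
open ContinuousLinearMap (lsmul)

variable {n : ℕ}

/-- Translations are continuous in `L²`. -/
theorem tendsto_eLpNorm_translate {w : E n → ℝ} (hw : MemLp w 2) :
    Tendsto (fun z : E n => eLpNorm (fun x => w (x - z) - w x) 2 volume) (𝓝 0) (𝓝 0) := by
  have : Fact ((1 : ℝ≥0∞) ≤ 2) := ⟨by norm_num⟩
  let g : E n → C(E n, E n) := fun z => ⟨fun x => x - z, by fun_prop⟩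
  have hg : Continuous g :=
    ContinuousMap.continuous_of_continuous_uncurry _
      (by fun_prop : Continuous fun q : E n × E n => q.2 - q.1)
  have hgm : ∀ z, MeasurePreserving (g z) (volume : Measure (E n)) volume := fun z =>
    measurePreserving_sub_right volume z
  -- continuity of composition with measure-preserving maps, applied to `z ↦ (· - z)`
  have hc := (continuous_const (y := hw.toLp w)).compMeasurePreservingLp hg hgm
    (by norm_num : (2 : ℝ≥0∞) ≠ ⊤)
  have h0 : Lp.compMeasurePreserving (g 0) (hgm 0) (hw.toLp w) = hw.toLp w := by
    apply Lp.ext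
    refine (Lp.coeFn_compMeasurePreserving _ (hgm 0)).trans ?_
    have : (g 0 : E n → E n) = id := by ext1 x; simp [g]
    rw [this]; rfl
  have h1 := tendsto_iff_edist_tendsto_0.1 (hc.tendsto 0)
  refine h1.congr fun z => ?_
  rw [h0, Lp.edist_def]
  refine eLpNorm_congr_ae ?_
  have e1 : ⇑(Lp.compMeasurePreserving (g z) (hgm z) (hw.toLp w)) =ᵐ[volume] w ∘ g z :=
    (Lp.coeFn_compMeasurePreserving _ (hgm z)).trans
      ((hgm z).quasiMeasurePreserving.ae_eq_comp hw.coeFn_toLp)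
  filter_upwards [e1, hw.coeFn_toLp] with x h2 h3
  simp only [Pi.sub_apply, h2, h3]
  rfl

/-- Averages of translates: Jensen's inequality and Tonelli's theorem. -/
theorem eLpNorm_convolution_sub_le {w : E n → ℝ} (hw : MemLp w 2) (hwm : StronglyMeasurable w)
    {k : E n → ℝ} (hk : Continuous k) (hkc : HasCompactSupport k) (hk0 : ∀ z, 0 ≤ k z)
    (hk1 : ∫ z, k z = 1) {η : ℝ≥0∞}
    (hη : ∀ z ∈ Function.support k, eLpNorm (fun x => w (x - z) - w x) 2 volume ≤ η) :
    eLpNorm (fun x => (k ⋆[lsmul ℝ ℝ, volume] w) x - w x) 2 volume ≤ η := by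
  have hkm : Measurable fun z => ENNReal.ofReal (k z) := hk.measurable.ennreal_ofReal
  -- the convolution is an average of translates for the probability measure `k(z) dz`
  set μ : Measure (E n) := volume.withDensity fun z => ENNReal.ofReal (k z) with hμ
  have hki : Integrable k := hk.integrable_of_hasCompactSupport hkc
  have hprob : IsProbabilityMeasure μ := ⟨by
    rw [hμ, withDensity_apply _ MeasurableSet.univ, Measure.restrict_univ,
      ← ofReal_integral_eq_lintegral_ofReal hki (Eventually.of_forall hk0), hk1,
      ENNReal.ofReal_one]⟩
  have hmeas : Measurable fun q : E n × E n => w (q.1 - q.2) - w q.1 :=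
    (hwm.measurable.comp (measurable_fst.sub measurable_snd)).sub
      (hwm.measurable.comp measurable_fst)
  have hpoint : ∀ x, ‖(k ⋆[lsmul ℝ ℝ, volume] w) x - w x‖ₑ ^ (2 : ℝ)
      ≤ ∫⁻ z, ‖w (x - z) - w x‖ₑ ^ (2 : ℝ) ∂μ := by
    intro x
    have hex : Integrable fun z => k z • w (x - z) :=
      (hkc.convolutionExists_left (L := lsmul ℝ ℝ) hk
        (hw.locallyIntegrable (by norm_num)) x).integrable
    have e1 : (k ⋆[lsmul ℝ ℝ, volume] w) x - w x = ∫ z, (w (x - z) - w x) ∂μ := by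
      rw [hμ, integral_withDensity_eq_integral_toReal_smul hkm
        (Eventually.of_forall fun _ => ENNReal.ofReal_lt_top)]
      simp only [ENNReal.toReal_ofReal (hk0 _), smul_sub]
      rw [integral_sub hex (hki.smul_const (w x)), integral_smul_const, hk1, one_smul,
        convolution_lsmul]
    have hgm : AEStronglyMeasurable (fun z => w (x - z) - w x) μ :=
      (hmeas.comp (measurable_const.prodMk measurable_id)).aestronglyMeasurable
    have e2 : ‖∫ z, (w (x - z) - w x) ∂μ‖ₑ ≤ eLpNorm (fun z => w (x - z) - w x) 2 μ := by
      refine (enorm_integral_le_lintegral_enorm _).trans ?_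
      rw [← eLpNorm_one_eq_lintegral_enorm]
      exact eLpNorm_le_eLpNorm_of_exponent_le (by norm_num) hgm
    rw [e1]
    have e3 := eLpNorm_nnreal_pow_eq_lintegral (μ := μ) (f := fun z => w (x - z) - w x)
      (p := 2) (by norm_num)
    simp only [NNReal.coe_ofNat, ENNReal.coe_ofNat] at e3
    rw [← e3]
    gcongr
  have hsq : eLpNorm (fun x => (k ⋆[lsmul ℝ ℝ, volume] w) x - w x) 2 volume ^ (2 : ℝ)
      ≤ η ^ (2 : ℝ) := by
    have e3 := eLpNorm_nnreal_pow_eq_lintegral (μ := (volume : Measure (E n)))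
      (f := fun x => (k ⋆[lsmul ℝ ℝ, volume] w) x - w x) (p := 2) (by norm_num)
    simp only [NNReal.coe_ofNat, ENNReal.coe_ofNat] at e3
    rw [e3]
    calc _ ≤ ∫⁻ x, ∫⁻ z, ‖w (x - z) - w x‖ₑ ^ (2 : ℝ) ∂μ := lintegral_mono hpoint
      _ = ∫⁻ z, ∫⁻ x, ‖w (x - z) - w x‖ₑ ^ (2 : ℝ) ∂volume ∂μ :=
          lintegral_lintegral_swap (hmeas.enorm.pow_const _).aemeasurable
      _ ≤ ∫⁻ _, η ^ (2 : ℝ) ∂μ := by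
          refine lintegral_mono_ae ?_
          rw [hμ, ae_withDensity_iff hkm]
          refine Eventually.of_forall fun z hz => ?_
          have hz' : z ∈ Function.support k := fun h => hz (by rw [h, ENNReal.ofReal_zero])
          have e4 := eLpNorm_nnreal_pow_eq_lintegral (μ := (volume : Measure (E n)))
            (f := fun x => w (x - z) - w x) (p := 2) (by norm_num)
          simp only [NNReal.coe_ofNat, ENNReal.coe_ofNat] at e4
          rw [← e4]
          gcongr
          exact hη z hz'
      _ = η ^ (2 : ℝ) := by rw [lintegral_const, measure_univ, mul_one]
  exact (ENNReal.rpow_le_rpow_iff (by norm_num)).1 hsq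

theorem exists_radius_eLpNorm_convolution_sub_le {w : E n → ℝ} (hw : MemLp w 2) {η : ℝ≥0∞}
    (hη : 0 < η) : ∃ δ > 0, ∀ k : E n → ℝ, Continuous k → HasCompactSupport k →
      (∀ z, 0 ≤ k z) → ∫ z, k z = 1 → Function.support k ⊆ Metric.ball 0 δ →
      eLpNorm (fun x => (k ⋆[lsmul ℝ ℝ, volume] w) x - w x) 2 volume ≤ η := by
  obtain ⟨w', hw'm, hww'⟩ := hw.aestronglyMeasurable
  have hw' : MemLp w' 2 := hw.ae_eq hww'
  have h1 := (tendsto_eLpNorm_translate hw').eventually (gt_mem_nhds hη)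
  obtain ⟨δ, hδ, hball⟩ := Metric.eventually_nhds_iff_ball.1 h1
  refine ⟨δ, hδ, fun k hk hkc hk0 hk1 hks => ?_⟩
  have h2 := eLpNorm_convolution_sub_le hw' hw'm hk hkc hk0 hk1
    (fun z hz => (hball z (hks hz)).le)
  rw [← convolution_congr (lsmul ℝ ℝ) (ae_eq_refl k) hww'] at h2
  refine (eLpNorm_congr_ae ?_).trans_le h2
  filter_upwards [hww'] with x hx
  rw [hx]

/-- A smooth probability density supported near `-ε e`. -/
theorem exists_shifted_kernel (e : E n) {κ ε : ℝ} (hκ : 0 < κ) (hε : 0 < ε) :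
    ∃ k : E n → ℝ, ContDiff ℝ ∞ k ∧ HasCompactSupport k ∧ (∀ z, 0 ≤ k z) ∧ ∫ z, k z = 1 ∧
      tsupport k ⊆ Metric.closedBall (-(ε • e)) (κ * ε) ∧
      Function.support k ⊆ Metric.ball 0 ((‖e‖ + κ) * ε) := by
  have hκε : 0 < κ * ε := by positivity
  let b : ContDiffBump (0 : E n) := ⟨κ * ε / 2, κ * ε, by positivity, by linarith⟩
  have hsupp : Function.support (fun z => b.normed volume (z + ε • e))
      = Metric.ball (-(ε • e)) (κ * ε) := by
    ext z
    have := Set.ext_iff.1 (b.support_normed_eq (μ := volume)) (z + ε • e)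
    rw [Function.mem_support] at this ⊢
    rw [this, Metric.mem_ball, Metric.mem_ball, dist_zero_right, dist_eq_norm, sub_neg_eq_add]
  have hts : tsupport (fun z => b.normed volume (z + ε • e))
      ⊆ Metric.closedBall (-(ε • e)) (κ * ε) := by
    rw [tsupport, hsupp]
    exact Metric.closure_ball_subset_closedBall
  refine ⟨fun z => b.normed volume (z + ε • e), b.contDiff_normed.comp (by fun_prop), ?_,
    fun z => b.nonneg_normed _, ?_, hts, ?_⟩
  · exact (isCompact_closedBall _ _).of_isClosed_subset (isClosed_tsupport _) hts
  · rw [integral_add_right_eq_self (fun z => b.normed volume z)]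
    exact b.integral_normed
  · rw [hsupp]
    refine Metric.ball_subset_ball' ?_
    rw [dist_zero_right, norm_neg, norm_smul, Real.norm_eq_abs, abs_of_pos hε]
    linarith

end ApproximateIdentity

/-! ### Smooth approximation of localized Sobolev functions -/

section LocalDensity

open scoped Convolution
open ContinuousLinearMap (lsmul)

variable {m : ℕ} {Ω : Set (E (m + 1))}

theorem IsSmoothDomain.integrableOn_of_memLp (hΩ : IsSmoothDomain Ω) {u : E (m + 1) → ℝ}
    (hu : MemLp u 2 (volume.restrict Ω)) : IntegrableOn u Ω :=
  have := hΩ.isFiniteMeasure_volume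
  hu.integrable (by norm_num)

theorem memLp_continuous_mul {n : ℕ} {μ : Measure (E n)} {a u : E n → ℝ} (ha : Continuous a)
    (hac : HasCompactSupport a) (hu : MemLp u 2 μ) : MemLp (fun x => a x * u x) 2 μ := by
  obtain ⟨C, hC⟩ := hac.exists_bound_of_continuous ha
  refine hu.of_le_mul (c := C) (ha.aestronglyMeasurable.mul hu.aestronglyMeasurable)
    (Eventually.of_forall fun x => ?_)
  rw [norm_mul]
  gcongr
  exact hC x

theorem integrableOn_continuous_mul {n : ℕ} {S : Set (E n)} {a u : E n → ℝ} (ha : Continuous a)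
    (hac : HasCompactSupport a) (hu : IntegrableOn u S) : IntegrableOn (fun x => a x * u x) S := by
  obtain ⟨C, hC⟩ := hac.exists_bound_of_continuous ha
  exact hu.bdd_mul ha.aestronglyMeasurable (Eventually.of_forall hC)

theorem fderiv_convolution_apply {n : ℕ} {k w : E n → ℝ} (hk : ContDiff ℝ ∞ k)
    (hkc : HasCompactSupport k) (hw : LocallyIntegrable w) (x v : E n) :
    fderiv ℝ (k ⋆[lsmul ℝ ℝ, volume] w) x v = ∫ y, fderiv ℝ k (x - y) v * w y := by
  have h1 := hkc.hasFDerivAt_convolution_left (lsmul ℝ ℝ) (hk.of_le (by norm_cast)) hw x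
  have h2 : ConvolutionExistsAt (fderiv ℝ k) w x
      ((lsmul ℝ ℝ : ℝ →L[ℝ] ℝ →L[ℝ] ℝ).precompL (E n)) volume :=
    HasCompactSupport.convolutionExists_left _ (hkc.fderiv (𝕜 := ℝ))
      (hk.continuous_fderiv (by simp)) hw x
  have h3 := convolutionExistsAt_iff_integrable_swap.1 h2
  rw [h1.fderiv, convolution_eq_swap, ContinuousLinearMap.integral_apply h3]
  rfl

/-- Regularization commutes with weak derivatives at the points of `Ω` whose translated balls
stay in `Ω`. -/
theorem fderiv_convolution_weak {n : ℕ} {Ω : Set (E n)} (hΩ : MeasurableSet Ω) {u g χ k : E n → ℝ}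
    {i : Fin n} (hu : IntegrableOn u Ω) (hg : IntegrableOn g Ω) (hug : HasWeakPartial Ω i u g)
    (hχ : ContDiff ℝ ∞ χ) (hχc : HasCompactSupport χ) (hk : ContDiff ℝ ∞ k)
    (hkc : HasCompactSupport k) {x : E n} (hx : ∀ y ∈ tsupport χ, x - y ∈ tsupport k → y ∈ Ω) :
    fderiv ℝ (k ⋆[lsmul ℝ ℝ, volume] Ω.indicator fun y => χ y * u y) x (basisVec i)
      = (k ⋆[lsmul ℝ ℝ, volume] Ω.indicator fun y =>
          χ y * g y + fderiv ℝ χ y (basisVec i) * u y) x := by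
  -- the test function; its support stays in `Ω` by `hx`
  set ψ : E n → ℝ := fun y => k (x - y) * χ y with hψ
  have hkx : ContDiff ℝ ∞ fun y => k (x - y) := hk.comp (by fun_prop)
  have hψc : HasCompactSupport ψ := hχc.mul_left
  have hts : tsupport ψ ⊆ Ω := by
    intro y hy
    refine hx y (closure_mono (fun z hz => right_ne_zero_of_mul hz) hy) ?_
    have hcl : IsClosed ((fun y => x - y) ⁻¹' tsupport k) :=
      (isClosed_tsupport k).preimage (by fun_prop)
    have hsub : Function.support ψ ⊆ (fun y => x - y) ⁻¹' tsupport k := fun z hz =>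
      subset_closure (left_ne_zero_of_mul hz)
    exact closure_minimal hsub hcl hy
  have hD : ∀ y, fderiv ℝ ψ y (basisVec i)
      = - (fderiv ℝ k (x - y) (basisVec i) * χ y) + k (x - y) * fderiv ℝ χ y (basisVec i) := by
    intro y
    have e1 : HasFDerivAt (fun y => k (x - y))
        ((fderiv ℝ k (x - y)).comp (-(ContinuousLinearMap.id ℝ (E n)))) y :=
      ((hk.differentiable (by simp) (x - y)).hasFDerivAt).comp y ((hasFDerivAt_id y).const_sub x)
    have e2 := e1.mul (hχ.differentiable (by simp) y).hasFDerivAt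
    have e3 : HasFDerivAt ψ _ y := e2
    rw [e3.fderiv]
    simp
    ring
  have hweak := hug ψ (hkx.mul hχ) hψc hts
  have hk'x : Continuous fun y => fderiv ℝ k (x - y) (basisVec i) :=
    ((hk.continuous_fderiv (by simp)).comp (by fun_prop)).clm_apply continuous_const
  have hχ' : Continuous fun y => fderiv ℝ χ y (basisVec i) :=
    (hχ.continuous_fderiv (by simp)).clm_apply continuous_const
  have hχ'c : HasCompactSupport fun y => fderiv ℝ χ y (basisVec i) :=
    hχc.fderiv_apply (𝕜 := ℝ) _
  have i1 : IntegrableOn (fun y => (fderiv ℝ k (x - y) (basisVec i) * χ y) * u y) Ω :=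
    integrableOn_continuous_mul (hk'x.mul hχ.continuous) hχc.mul_left hu
  have i2 : IntegrableOn (fun y => (k (x - y) * fderiv ℝ χ y (basisVec i)) * u y) Ω :=
    integrableOn_continuous_mul (hkx.continuous.mul hχ') hχ'c.mul_left hu
  have i3 : IntegrableOn (fun y => (k (x - y) * χ y) * g y) Ω :=
    integrableOn_continuous_mul (hkx.continuous.mul hχ.continuous) hψc hg
  have hloc : LocallyIntegrable (Ω.indicator fun y => χ y * u y) :=
    ((integrable_indicator_iff hΩ).2
      (integrableOn_continuous_mul hχ.continuous hχc hu)).locallyIntegrable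
  have hL : fderiv ℝ (k ⋆[lsmul ℝ ℝ, volume] Ω.indicator fun y => χ y * u y) x (basisVec i)
      = ∫ y in Ω, (fderiv ℝ k (x - y) (basisVec i) * χ y) * u y := by
    rw [fderiv_convolution_apply hk hkc hloc, ← integral_indicator hΩ]
    refine integral_congr_ae (Eventually.of_forall fun y => ?_)
    by_cases hy : y ∈ Ω
    · simp [hy, mul_assoc]
    · simp [hy]
  have hR : (k ⋆[lsmul ℝ ℝ, volume] Ω.indicator fun y =>
          χ y * g y + fderiv ℝ χ y (basisVec i) * u y) x
      = ∫ y in Ω, ((k (x - y) * χ y) * g y + (k (x - y) * fderiv ℝ χ y (basisVec i)) * u y) := by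
    rw [convolution_eq_swap, ← integral_indicator hΩ]
    refine integral_congr_ae (Eventually.of_forall fun y => ?_)
    by_cases hy : y ∈ Ω
    · simp [hy]; ring
    · simp [hy]
  have e1 : ∫ y in Ω, u y * fderiv ℝ ψ y (basisVec i)
      = - (∫ y in Ω, (fderiv ℝ k (x - y) (basisVec i) * χ y) * u y)
        + ∫ y in Ω, (k (x - y) * fderiv ℝ χ y (basisVec i)) * u y := by
    have i1' : IntegrableOn (fun y => -((fderiv ℝ k (x - y) (basisVec i) * χ y) * u y)) Ω :=
      i1.neg
    rw [← integral_neg, ← integral_add i1' i2]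
    refine integral_congr_ae (Eventually.of_forall fun y => ?_)
    simp only [hD]
    ring
  have e2 : ∫ y in Ω, g y * ψ y = ∫ y in Ω, (k (x - y) * χ y) * g y := by
    refine integral_congr_ae (Eventually.of_forall fun y => ?_)
    simp only [hψ]; ring
  rw [hL, hR, integral_add i3 i2, ← e2]
  rw [e1] at hweak
  linarith

/-- A localized `H¹` function is the limit in `H¹(Ω)` of smooth functions: translate into `Ω` along
the cone direction and mollify. -/
theorem IsSmoothDomain.exists_smooth_near_localized (hΩ : IsSmoothDomain Ω)
    {e p : E (m + 1)} {κ r ε₀ : ℝ} (hκ : 0 < κ) (hr : 0 < r) (hε₀ : 0 < ε₀)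
    (hcone : ∀ x ∈ Ω, x ∈ Metric.ball p r → ∀ ε, 0 < ε → ε < ε₀ →
        Metric.closedBall (x + ε • e) (κ * ε) ⊆ Ω)
    {χ : E (m + 1) → ℝ} (hχ : ContDiff ℝ ∞ χ) (hχc : HasCompactSupport χ)
    (hχr : tsupport χ ⊆ Metric.ball p (r / 2))
    {u : E (m + 1) → ℝ} {g : Fin (m + 1) → E (m + 1) → ℝ}
    (hu : MemLp u 2 (volume.restrict Ω)) (hg : ∀ i, MemLp (g i) 2 (volume.restrict Ω))
    (hug : ∀ i, HasWeakPartial Ω i u (g i)) {η : ℝ≥0∞} (hη : 0 < η) :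
    ∃ v : E (m + 1) → ℝ, ContDiff ℝ ∞ v ∧
      eLpNorm (fun x => v x - χ x * u x) 2 (volume.restrict Ω) ≤ η ∧
      ∀ i, eLpNorm (fun x => fderiv ℝ v x (basisVec i)
        - (χ x * g i x + fderiv ℝ χ x (basisVec i) * u x)) 2 (volume.restrict Ω) ≤ η := by
  have hΩm := hΩ.isOpen.measurableSet
  have hχ' : ∀ i, Continuous fun y => fderiv ℝ χ y (basisVec i) := fun i =>
    (hχ.continuous_fderiv (by simp)).clm_apply continuous_const
  have hχ'c : ∀ i, HasCompactSupport fun y => fderiv ℝ χ y (basisVec i) := fun i =>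
    hχc.fderiv_apply (𝕜 := ℝ) _
  have hw : MemLp (Ω.indicator fun y => χ y * u y) 2 :=
    (memLp_indicator_iff_restrict hΩm).2 (memLp_continuous_mul hχ.continuous hχc hu)
  have hwi : ∀ i, MemLp (Ω.indicator fun y => χ y * g i y + fderiv ℝ χ y (basisVec i) * u y) 2 :=
    fun i => (memLp_indicator_iff_restrict hΩm).2
      ((memLp_continuous_mul hχ.continuous hχc (hg i)).add
        (memLp_continuous_mul (hχ' i) (hχ'c i) hu))
  obtain ⟨δ, hδ, hδw⟩ := exists_radius_eLpNorm_convolution_sub_le hw hη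
  choose δi hδi hδwi using fun i => exists_radius_eLpNorm_convolution_sub_le (hwi i) hη
  obtain ⟨d, hd, hdδ, hdδi⟩ : ∃ d > 0, d ≤ δ ∧ ∀ i, d ≤ δi i := by
    refine ⟨min δ (Finset.univ.inf' Finset.univ_nonempty δi), lt_min hδ ?_, min_le_left _ _,
      fun i => (min_le_right _ _).trans (Finset.inf'_le _ (Finset.mem_univ i))⟩
    exact (Finset.lt_inf'_iff _).2 fun i _ => hδi i
  have he0 := norm_nonneg e
  obtain ⟨ε, hε, hε1, hε2, hε3⟩ : ∃ ε > 0, ε < ε₀ ∧ (‖e‖ + κ) * ε ≤ d ∧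
      (‖e‖ + κ) * ε < r / 2 := by
    refine ⟨min (ε₀ / 2) (min (d / (‖e‖ + κ)) (r / 4 / (‖e‖ + κ))), ?_, ?_, ?_, ?_⟩
    · positivity
    · exact (min_le_left _ _).trans_lt (by linarith)
    · rw [← le_div_iff₀' (by positivity)]
      exact (min_le_right _ _).trans (min_le_left _ _)
    · rw [← lt_div_iff₀' (by positivity)]
      refine ((min_le_right _ _).trans (min_le_right _ _)).trans_lt ?_
      gcongr
      linarith
  obtain ⟨k, hk, hkc, hk0, hk1, hkts, hks⟩ := exists_shifted_kernel e hκ hε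
  have hks' := hks.trans (Metric.ball_subset_ball hε2)
  refine ⟨k ⋆[lsmul ℝ ℝ, volume] Ω.indicator fun y => χ y * u y,
    hkc.contDiff_convolution_left _ hk (hw.locallyIntegrable (by norm_num)), ?_, fun i => ?_⟩
  · refine le_trans ?_ ((eLpNorm_restrict_le _ 2 volume Ω).trans
      (hδw k hk.continuous hkc hk0 hk1 (hks'.trans (Metric.ball_subset_ball hdδ))))
    refine (eLpNorm_congr_ae ?_).le
    filter_upwards [ae_restrict_mem hΩm] with x hx
    rw [Set.indicator_of_mem hx]
  · refine le_trans ?_ ((eLpNorm_restrict_le _ 2 volume Ω).trans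
      (hδwi i k hk.continuous hkc hk0 hk1 (hks'.trans (Metric.ball_subset_ball (hdδi i)))))
    refine (eLpNorm_congr_ae ?_).le
    filter_upwards [ae_restrict_mem hΩm] with x hx
    rw [fderiv_convolution_weak hΩm (hΩ.integrableOn_of_memLp hu)
      (hΩ.integrableOn_of_memLp (hg i)) (hug i) hχ hχc hk hkc, Set.indicator_of_mem hx]
    intro y hy hxy
    have h1 : y ∈ Metric.closedBall (x + ε • e) (κ * ε) := by
      have := hkts hxy
      rw [Metric.mem_closedBall, dist_eq_norm] at this ⊢
      rwa [show x - y - -(ε • e) = -(y - (x + ε • e)) by abel, norm_neg] at this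
    refine hcone x hx ?_ ε hε hε1 h1
    have h2 := hχr hy
    rw [Metric.mem_ball] at h2 ⊢
    rw [Metric.mem_closedBall] at h1
    have h3 : dist (x + ε • e) x = ‖e‖ * ε := by
      rw [dist_eq_norm, add_sub_cancel_left, norm_smul, Real.norm_eq_abs, abs_of_pos hε, mul_comm]
    have h4 := dist_triangle y (x + ε • e) x
    have h5 := dist_triangle_left x p y
    nlinarith

end LocalDensity

/-! ### Density of smooth functions and existence of traces -/

section Density

theorem MemH1.weakPartial_spec {n : ℕ} {Ω : Set (E n)} {u : E n → ℝ} (hu : MemH1 Ω u)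
    (i : Fin n) : MemLp (weakPartial Ω i u) 2 (volume.restrict Ω) ∧
      HasWeakPartial Ω i u (weakPartial Ω i u) := by
  have h := hu.2 i
  rw [weakPartial, dif_pos h]
  exact h.choose_spec

theorem eLpNorm_two_rpow_eq {X : Type*} [MeasurableSpace X] {μ : Measure X} {v : X → ℝ}
    (hv : MemLp v 2 μ) : eLpNorm v 2 μ ^ (2 : ℝ) = ENNReal.ofReal (∫ x, v x ^ 2 ∂μ) := by
  have e3 := eLpNorm_nnreal_pow_eq_lintegral (μ := μ) (f := v) (p := 2) (by norm_num)
  simp only [NNReal.coe_ofNat, ENNReal.coe_ofNat] at e3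
  rw [e3, ofReal_integral_eq_lintegral_ofReal hv.integrable_sq
    (Eventually.of_forall fun x => sq_nonneg _)]
  refine lintegral_congr fun x => ?_
  rw [ENNReal.rpow_ofNat, ← sq_abs, ENNReal.ofReal_pow (abs_nonneg _), ← Real.norm_eq_abs,
    ofReal_norm]

namespace IsSmoothDomain

variable {m : ℕ} {Ω : Set (E (m + 1))}

theorem memLp_surface (hΩ : IsSmoothDomain Ω) {g : E (m + 1) → ℝ}
    (hg : ContinuousOn g (frontier Ω)) : MemLp g 2 (surfaceMeasure Ω) := by
  have := hΩ.isFiniteMeasure_surface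
  obtain ⟨C, hC⟩ := hΩ.isCompact_frontier.exists_bound_of_continuousOn hg
  refine MemLp.of_bound (hg.aestronglyMeasurable isClosed_frontier.measurableSet) C ?_
  exact (ae_restrict_iff' isClosed_frontier.measurableSet).2 (Eventually.of_forall hC)

theorem memLp_volume (hΩ : IsSmoothDomain Ω) {g : E (m + 1) → ℝ}
    (hg : ContinuousOn g (closure Ω)) : MemLp g 2 (volume.restrict Ω) := by
  have := hΩ.isFiniteMeasure_volume
  obtain ⟨C, hC⟩ := hΩ.isCompact_closure.exists_bound_of_continuousOn hg
  refine MemLp.of_bound ((hg.mono subset_closure).aestronglyMeasurable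
    hΩ.isOpen.measurableSet) C ?_
  exact (ae_restrict_iff' hΩ.isOpen.measurableSet).2
    (Eventually.of_forall fun x hx => hC x (subset_closure hx))

/-- Functions smooth up to the boundary are dense in `H¹(Ω)`. -/
theorem exists_smooth_near (hΩ : IsSmoothDomain Ω) {u : E (m + 1) → ℝ} (hu : MemH1 Ω u)
    {η : ℝ≥0∞} (hη : 0 < η) :
    ∃ v : E (m + 1) → ℝ, ContDiff ℝ ∞ v ∧
      eLpNorm (fun x => v x - u x) 2 (volume.restrict Ω) ≤ η ∧
      ∀ i, eLpNorm (fun x => fderiv ℝ v x (basisVec i) - weakPartial Ω i u x) 2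
        (volume.restrict Ω) ≤ η := by
  have hΩm := hΩ.isOpen.measurableSet
  have hex : ∀ p : E (m + 1), ∃ U ∈ 𝓝 p, p ∈ closure Ω → ∃ (e : E (m + 1)) (κ r ε₀ : ℝ),
      0 < κ ∧ 0 < r ∧ 0 < ε₀ ∧ (∀ x ∈ Ω, x ∈ Metric.ball p r → ∀ ε, 0 < ε → ε < ε₀ →
        Metric.closedBall (x + ε • e) (κ * ε) ⊆ Ω) ∧ U ⊆ Metric.ball p (r / 2) := by
    intro p
    by_cases hp : p ∈ closure Ω
    · obtain ⟨e, κ, r, ε₀, h1, h2, h3, h4⟩ := hΩ.exists_cone hp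
      exact ⟨Metric.ball p (r / 2), Metric.ball_mem_nhds p (by positivity),
        fun _ => ⟨e, κ, r, ε₀, h1, h2, h3, h4, subset_rfl⟩⟩
    · exact ⟨Set.univ, univ_mem, fun h => absurd h hp⟩
  choose U hU hUc using hex
  obtain ⟨s, χ, hs, hχ, hχs, -, hsum⟩ := exists_finite_partition hΩ.isCompact_closure U
    fun p _ => hU p
  set η' : ℝ≥0∞ := η / (s.card + 1) with hη'
  have hη'0 : 0 < η' := ENNReal.div_pos hη.ne' (by finiteness)
  have hsη : ∑ _p ∈ s, η' ≤ η := by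
    rw [Finset.sum_const, nsmul_eq_mul, hη']
    calc (s.card : ℝ≥0∞) * (η / (s.card + 1)) ≤ (s.card + 1) * (η / (s.card + 1)) := by
          gcongr; exact le_self_add
      _ ≤ η := ENNReal.mul_div_le
  have hloc : ∀ p ∈ s, ∃ v : E (m + 1) → ℝ, ContDiff ℝ ∞ v ∧
      eLpNorm (fun x => v x - χ p x * u x) 2 (volume.restrict Ω) ≤ η' ∧
      ∀ i, eLpNorm (fun x => fderiv ℝ v x (basisVec i)
        - (χ p x * weakPartial Ω i u x + fderiv ℝ (χ p) x (basisVec i) * u x)) 2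
          (volume.restrict Ω) ≤ η' := by
    intro p hp
    obtain ⟨e, κ, r, ε₀, h1, h2, h3, h4, h5⟩ := hUc p (hs p hp)
    exact hΩ.exists_smooth_near_localized h1 h2 h3 h4 (hχ p) (hχs p hp).1
      ((hχs p hp).2.trans h5) hu.1 (fun i => (hu.weakPartial_spec i).1)
      (fun i => (hu.weakPartial_spec i).2) hη'0
  choose! v hv hvu hvi using hloc
  have hm : ∀ p ∈ s, AEStronglyMeasurable (fun x => v p x - χ p x * u x) (volume.restrict Ω) :=
    fun p hp => (hv p hp).continuous.aestronglyMeasurable.sub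
      ((hχ p).continuous.aestronglyMeasurable.mul hu.1.aestronglyMeasurable)
  have hmi : ∀ i, ∀ p ∈ s, AEStronglyMeasurable (fun x => fderiv ℝ (v p) x (basisVec i)
        - (χ p x * weakPartial Ω i u x + fderiv ℝ (χ p) x (basisVec i) * u x))
          (volume.restrict Ω) := by
    intro i p hp
    have h1 : Continuous fun x => fderiv ℝ (v p) x (basisVec i) :=
      ((hv p hp).continuous_fderiv (by simp)).clm_apply continuous_const
    have h2 : Continuous fun x => fderiv ℝ (χ p) x (basisVec i) :=
      ((hχ p).continuous_fderiv (by simp)).clm_apply continuous_const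
    exact h1.aestronglyMeasurable.sub (((hχ p).continuous.aestronglyMeasurable.mul
      (hu.weakPartial_spec i).1.aestronglyMeasurable).add
      (h2.aestronglyMeasurable.mul hu.1.aestronglyMeasurable))
  refine ⟨fun x => ∑ p ∈ s, v p x, ContDiff.sum fun p hp => hv p hp, ?_, fun i => ?_⟩
  · refine le_trans (le_of_eq ?_) ((eLpNorm_sum_le hm (by norm_num)).trans
      ((Finset.sum_le_sum hvu).trans hsη))
    refine eLpNorm_congr_ae ?_
    filter_upwards [ae_restrict_mem hΩm] with x hx
    rw [Finset.sum_apply, Finset.sum_sub_distrib, ← Finset.sum_mul, hsum x (subset_closure hx),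
      one_mul]
  · refine le_trans (le_of_eq ?_) ((eLpNorm_sum_le (hmi i) (by norm_num)).trans
      ((Finset.sum_le_sum fun p hp => hvi p hp i).trans hsη))
    refine eLpNorm_congr_ae ?_
    filter_upwards [ae_restrict_mem hΩm] with x hx
    -- the partition sums to one near `x`, so that its derivatives cancel
    have h0 : ∑ p ∈ s, fderiv ℝ (χ p) x (basisVec i) = 0 := by
      have h1 : (fun y => ∑ p ∈ s, χ p y) =ᶠ[𝓝 x] fun _ => 1 := by
        filter_upwards [hΩ.isOpen.mem_nhds hx] with y hy
        exact hsum y (subset_closure hy)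
      have h2 := h1.fderiv_eq (𝕜 := ℝ)
      rw [fderiv_fun_sum fun p _ => (hχ p).differentiable (by simp) x] at h2
      have h3 := congrArg (fun L => L (basisVec i)) h2
      simpa using h3
    rw [Finset.sum_apply, Finset.sum_sub_distrib, Finset.sum_add_distrib, ← Finset.sum_mul,
      ← Finset.sum_mul, hsum x (subset_closure hx), h0, one_mul, zero_mul, add_zero,
      fderiv_fun_sum fun p hp => (hv p hp).differentiable (by simp) x]
    simp

/-- A smooth vector field that is uniformly outward pointing on the boundary. -/
theorem exists_outward_field (hΩ : IsSmoothDomain Ω) :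
    ∃ X : Fin (m + 1) → E (m + 1) → ℝ, (∀ j, ContDiff ℝ ∞ (X j)) ∧
      ∃ c₀ > 0, ∀ x ∈ frontier Ω, c₀ ≤ ∑ j, X j x * outwardNormal Ω x j := by
  have hex : ∀ p : E (m + 1), ∃ U ∈ 𝓝 p, ∃ d : E (m + 1), p ∈ frontier Ω →
      ∀ x ∈ U, x ∈ frontier Ω → 0 < ∑ j, d j * outwardNormal Ω x j := by
    intro p
    by_cases hp : p ∈ frontier Ω
    · obtain ⟨i, c, γ, r, h⟩ := hΩ.smooth.exists_chart hp
      -- in a chart the direction `-c e_i` points out of `Ω`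
      refine ⟨Metric.ball p r, Metric.ball_mem_nhds p h.pos, -(c • basisVec i),
        fun _ x hx hxf => ?_⟩
      rw [Finset.sum_eq_single i]
      · rw [h.outwardNormal_eq hΩ.isOpen hx hxf]
        have h1 := IsGraphChart.inner_graphNormal (i := i) (c := c) (γ := γ) x (basisVec i)
        rw [inner_basisVec, h.fderiv_basisVec, basisVec_self] at h1
        have h2 : 0 < ‖graphNormal i c γ x‖⁻¹ :=
          inv_pos.2 (norm_pos_iff.2 (h.graphNormal_ne_zero x))
        simp only [PiLp.neg_apply, PiLp.smul_apply, basisVec_self, smul_eq_mul, h1]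
        have := h.sq
        nlinarith
      · intro j _ hj
        simp [basisVec_ne hj]
      · simp
    · exact ⟨Set.univ, univ_mem, 0, fun h => absurd h hp⟩
  choose U hU d hd using hex
  obtain ⟨s, χ, hs, hχ, hχs, hχ0, hsum⟩ := exists_finite_partition hΩ.isCompact_frontier U
    fun p _ => hU p
  refine ⟨fun j x => ∑ p ∈ s, χ p x * d p j,
    fun j => ContDiff.sum fun p _ => (hχ p).mul contDiff_const, ?_⟩
  have hswap : ∀ x, ∑ j, (∑ p ∈ s, χ p x * d p j) * outwardNormal Ω x j
      = ∑ p ∈ s, χ p x * ∑ j, d p j * outwardNormal Ω x j := by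
    intro x
    simp only [Finset.sum_mul, Finset.mul_sum]
    rw [Finset.sum_comm]
    simp only [mul_assoc]
  have hcont : ContinuousOn (fun x => ∑ j, (∑ p ∈ s, χ p x * d p j) * outwardNormal Ω x j)
      (frontier Ω) := by
    refine continuousOn_finsetSum _ fun j _ => ContinuousOn.mul ?_ (hΩ.continuousOn_normal_apply j)
    exact (continuous_finsetSum _ fun p _ =>
      (hχ p).continuous.mul continuous_const).continuousOn
  obtain ⟨c₀, hc₀, h⟩ := hΩ.isCompact_frontier.exists_forall_le' hcont (a := 0) (by
    intro x hx
    rw [hswap]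
    have hterm : ∀ p ∈ s, 0 ≤ χ p x * ∑ j, d p j * outwardNormal Ω x j := by
      intro p hp
      by_cases hxp : x ∈ tsupport (χ p)
      · exact mul_nonneg (hχ0 p x) (hd p (hs p hp) x ((hχs p hp).2 hxp) hx).le
      · rw [image_eq_zero_of_notMem_tsupport hxp, zero_mul]
    refine Finset.sum_pos' hterm ?_
    by_contra hcon
    push Not at hcon
    have h0 : ∀ p ∈ s, χ p x = 0 := by
      intro p hp
      by_contra hne
      have h1 := hd p (hs p hp) x ((hχs p hp).2 (subset_closure hne)) hx
      exact absurd (hcon p hp) (not_le.2 (mul_pos ((hχ0 p x).lt_of_ne' hne) h1))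
    have := hsum x hx
    rw [Finset.sum_eq_zero h0] at this
    exact zero_ne_one this)
  exact ⟨c₀, hc₀, h⟩

/-- The divergence theorem for `v² X`, with `X` outward pointing, bounds `v` on the boundary. -/
theorem exists_integral_sq_surface_le (hΩ : IsSmoothDomain Ω) :
    ∃ C : ℝ, 0 ≤ C ∧ ∀ v : E (m + 1) → ℝ, ContDiff ℝ ∞ v →
      ∫ x, v x ^ 2 ∂(surfaceMeasure Ω) ≤ C * ((∫ x in Ω, v x ^ 2)
        + ∑ j, ∫ x in Ω, fderiv ℝ v x (basisVec j) ^ 2) := by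
  obtain ⟨X, hX, c₀, hc₀, hXν⟩ := hΩ.exists_outward_field
  have hX' : ∀ j, Continuous fun x => fderiv ℝ (X j) x (basisVec j) := fun j =>
    ((hX j).continuous_fderiv (by simp)).clm_apply continuous_const
  choose A hA using fun j => hΩ.isCompact_closure.exists_bound_of_continuousOn
    (hX j).continuous.continuousOn
  choose B hB using fun j => hΩ.isCompact_closure.exists_bound_of_continuousOn
    (hX' j).continuousOn
  refine ⟨(∑ j, (|A j| + |B j|)) / c₀, by positivity, fun v hv => ?_⟩
  have hv' : ∀ j, Continuous fun x => fderiv ℝ v x (basisVec j) := fun j =>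
    (hv.continuous_fderiv (by simp)).clm_apply continuous_const
  have i0 : IntegrableOn (fun x => v x ^ 2) Ω :=
    hΩ.integrableOn_of_continuousOn (hv.continuous.pow 2).continuousOn
  have ij : ∀ j, IntegrableOn (fun x => fderiv ℝ v x (basisVec j) ^ 2) Ω := fun j =>
    hΩ.integrableOn_of_continuousOn ((hv' j).pow 2).continuousOn
  set I := (∫ x in Ω, v x ^ 2) + ∑ j, ∫ x in Ω, fderiv ℝ v x (basisVec j) ^ 2 with hI
  have hF : ∀ j, ContDiff ℝ 1 fun x => v x ^ 2 * X j x := fun j =>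
    ((hv.pow 2).mul (hX j)).of_le (by norm_cast)
  have hdiv : ∀ j, ∫ x, v x ^ 2 * X j x * outwardNormal Ω x j ∂(surfaceMeasure Ω)
      ≤ (|A j| + |B j|) * I := by
    intro j
    rw [← hΩ.integral_pd (hF j).contDiffOn j]
    calc ∫ x in Ω, pd Ω j (fun x => v x ^ 2 * X j x) x
        ≤ ∫ x in Ω, (|A j| + |B j|) * (v x ^ 2 + fderiv ℝ v x (basisVec j) ^ 2) := by
          refine setIntegral_mono_on (hΩ.integrableOn_of_continuousOn
            (hΩ.continuousOn_pd j (hF j).contDiffOn)) ((i0.add (ij j)).const_mul _)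
            hΩ.isOpen.measurableSet fun x hx => ?_
          rw [hΩ.pd_eq_fderiv j _ hx]
          have e1 : HasFDerivAt (fun x => v x ^ 2 * X j x) _ x :=
            ((hv.differentiable (by simp) x).hasFDerivAt.pow 2).mul
              ((hX j).differentiable (by simp) x).hasFDerivAt
          rw [e1.fderiv]
          have a1 := (hA j x (subset_closure hx)).trans (le_abs_self _)
          have b1 := (hB j x (subset_closure hx)).trans (le_abs_self _)
          rw [Real.norm_eq_abs] at a1 b1
          have a2 := abs_le.1 a1
          have b2 := abs_le.1 b1
          simp only [add_apply, smul_apply, smul_eq_mul]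
          set D := fderiv ℝ v x (basisVec j)
          have q1 : 2 * v x * D * X j x ≤ |A j| * (v x ^ 2 + D ^ 2) := by
            have : |2 * v x * D| ≤ v x ^ 2 + D ^ 2 := by
              rw [abs_le]; constructor <;> nlinarith [sq_nonneg (v x + D), sq_nonneg (v x - D)]
            calc 2 * v x * D * X j x ≤ |2 * v x * D * X j x| := le_abs_self _
              _ = |X j x| * |2 * v x * D| := by rw [abs_mul, mul_comm]
              _ ≤ _ := by gcongr
          have q2 : v x ^ 2 * fderiv ℝ (X j) x (basisVec j) ≤ |B j| * (v x ^ 2 + D ^ 2) := by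
            nlinarith [sq_nonneg (v x), sq_nonneg D, abs_nonneg (B j)]
          norm_num
          nlinarith
      _ = (|A j| + |B j|) * ((∫ x in Ω, v x ^ 2)
          + ∫ x in Ω, fderiv ℝ v x (basisVec j) ^ 2) := by
          rw [integral_const_mul, integral_add i0 (ij j)]
      _ ≤ (|A j| + |B j|) * I := by
          refine mul_le_mul_of_nonneg_left (add_le_add le_rfl ?_) (by positivity)
          exact Finset.single_le_sum (f := fun j => ∫ x in Ω, fderiv ℝ v x (basisVec j) ^ 2)
            (fun j _ => integral_nonneg fun x => sq_nonneg _) (Finset.mem_univ j)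
  have hvc : ContinuousOn v (frontier Ω) := hv.continuous.continuousOn
  have his : ∀ j, Integrable (fun x => v x ^ 2 * X j x * outwardNormal Ω x j)
      (surfaceMeasure Ω) := fun j => hΩ.integrable_surface
    (((hvc.pow 2).mul (hX j).continuous.continuousOn).mul (hΩ.continuousOn_normal_apply j))
  rw [div_mul_eq_mul_div, le_div_iff₀' hc₀, Finset.sum_mul]
  calc c₀ * ∫ x, v x ^ 2 ∂(surfaceMeasure Ω)
      = ∫ x, c₀ * v x ^ 2 ∂(surfaceMeasure Ω) := (integral_const_mul _ _).symm
    _ ≤ ∫ x, ∑ j, v x ^ 2 * X j x * outwardNormal Ω x j ∂(surfaceMeasure Ω) := by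
        refine integral_mono_ae ((hΩ.integrable_surface (hvc.pow 2)).const_mul _)
          (integrable_finsetSum _ fun j _ => his j) ?_
        refine (ae_restrict_iff' isClosed_frontier.measurableSet).2
          (Eventually.of_forall fun x hx => ?_)
        have := mul_le_mul_of_nonneg_left (hXν x hx) (sq_nonneg (v x))
        simp only [Finset.mul_sum, ← mul_assoc] at this ⊢
        linarith
    _ = ∑ j, ∫ x, v x ^ 2 * X j x * outwardNormal Ω x j ∂(surfaceMeasure Ω) :=
        integral_finsetSum _ fun j _ => his j
    _ ≤ _ := Finset.sum_le_sum fun j _ => hdiv j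

/-- The trace inequality for smooth functions. -/
theorem exists_eLpNorm_surface_le (hΩ : IsSmoothDomain Ω) :
    ∃ C : ℝ≥0∞, C ≠ ⊤ ∧ ∀ (v : E (m + 1) → ℝ) (b : ℝ≥0∞), ContDiff ℝ ∞ v →
      eLpNorm v 2 (volume.restrict Ω) ≤ b →
      (∀ j, eLpNorm (fun x => fderiv ℝ v x (basisVec j)) 2 (volume.restrict Ω) ≤ b) →
      eLpNorm v 2 (surfaceMeasure Ω) ≤ C * b := by
  obtain ⟨C, hC0, hC⟩ := hΩ.exists_integral_sq_surface_le
  refine ⟨(ENNReal.ofReal C * (m + 2)) ^ ((2 : ℝ)⁻¹), by finiteness, fun v b hv h0 hj => ?_⟩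
  have hv' : ∀ j, Continuous fun x => fderiv ℝ v x (basisVec j) := fun j =>
    (hv.continuous_fderiv (by simp)).clm_apply continuous_const
  have e0 := eLpNorm_two_rpow_eq (hΩ.memLp_volume hv.continuous.continuousOn)
  have ej := fun j => eLpNorm_two_rpow_eq (hΩ.memLp_volume (hv' j).continuousOn)
  have es := eLpNorm_two_rpow_eq (hΩ.memLp_surface hv.continuous.continuousOn)
  refine (ENNReal.rpow_le_rpow_iff (z := 2) (by norm_num)).1 ?_
  rw [es, ENNReal.mul_rpow_of_nonneg _ _ (by norm_num), ← ENNReal.rpow_mul,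
    inv_mul_cancel₀ (by norm_num), ENNReal.rpow_one]
  calc ENNReal.ofReal (∫ x, v x ^ 2 ∂(surfaceMeasure Ω))
      ≤ ENNReal.ofReal (C * ((∫ x in Ω, v x ^ 2)
        + ∑ j, ∫ x in Ω, fderiv ℝ v x (basisVec j) ^ 2)) := ENNReal.ofReal_le_ofReal (hC v hv)
    _ = ENNReal.ofReal C * (eLpNorm v 2 (volume.restrict Ω) ^ (2 : ℝ)
        + ∑ j, eLpNorm (fun x => fderiv ℝ v x (basisVec j)) 2 (volume.restrict Ω) ^ (2 : ℝ)) := by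
        rw [ENNReal.ofReal_mul hC0, ENNReal.ofReal_add (integral_nonneg fun x => sq_nonneg _)
          (Finset.sum_nonneg fun j _ => integral_nonneg fun x => sq_nonneg _),
          ENNReal.ofReal_sum_of_nonneg fun j _ => integral_nonneg fun x => sq_nonneg _, e0]
        simp only [ej]
    _ ≤ ENNReal.ofReal C * (b ^ (2 : ℝ) + ∑ _j : Fin (m + 1), b ^ (2 : ℝ)) := by
        gcongr with j
        exact hj j
    _ = ENNReal.ofReal C * (m + 2) * b ^ (2 : ℝ) := by
        rw [Finset.sum_const, Finset.card_univ, Fintype.card_fin, nsmul_eq_mul]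
        push_cast
        ring

/-- Smooth approximations in `H¹(Ω)` are Cauchy in `L²(∂Ω)` by the trace inequality. -/
theorem exists_isTrace (hΩ : IsSmoothDomain Ω) {u : E (m + 1) → ℝ} (hu : MemH1 Ω u) :
    ∃ g, IsTrace Ω u g := by
  have : Fact ((1 : ℝ≥0∞) ≤ 2) := ⟨by norm_num⟩
  set η : ℕ → ℝ≥0∞ := fun k => (k : ℝ≥0∞)⁻¹ with hη
  have hη0 : ∀ k, 0 < η k := fun k => ENNReal.inv_pos.2 (by finiteness)
  have hηt : Tendsto η atTop (𝓝 0) := ENNReal.tendsto_inv_nat_nhds_zero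
  have hηa : ∀ k l, k ≤ l → η l ≤ η k := fun k l h => ENNReal.inv_le_inv.2 (by exact_mod_cast h)
  choose v hv hvu hvi using fun k => hΩ.exists_smooth_near hu (hη0 k)
  have hvs : ∀ k, MemLp (v k) 2 (surfaceMeasure Ω) := fun k =>
    hΩ.memLp_surface (hv k).continuous.continuousOn
  obtain ⟨C, hCt, hC⟩ := hΩ.exists_eLpNorm_surface_le
  have hmu := hu.1.aestronglyMeasurable
  have hcau : CauchySeq fun k => (hvs k).toLp (v k) := by
    refine EMetric.cauchySeq_iff_le_tendsto_0.2 ⟨fun N => C * (η N + η N), ?_, ?_⟩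
    · intro k l N hk hl
      rw [Lp.edist_toLp_toLp]
      refine hC (v k - v l) (η N + η N) ((hv k).sub (hv l)) ?_ fun j => ?_
      · have e : v k - v l = (fun x => v k x - u x) - fun x => v l x - u x := by
          ext x; simp
        rw [e]
        refine (eLpNorm_sub_le ((hv k).continuous.aestronglyMeasurable.sub hmu)
          ((hv l).continuous.aestronglyMeasurable.sub hmu) (by norm_num)).trans ?_
        exact add_le_add ((hvu k).trans (hηa _ _ hk)) ((hvu l).trans (hηa _ _ hl))
      · have hc : ∀ k, Continuous fun x => fderiv ℝ (v k) x (basisVec j) := fun k =>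
          ((hv k).continuous_fderiv (by simp)).clm_apply continuous_const
        have hwm := (hu.weakPartial_spec j).1.aestronglyMeasurable
        have e : (fun x => fderiv ℝ (v k - v l) x (basisVec j))
            = (fun x => fderiv ℝ (v k) x (basisVec j) - weakPartial Ω j u x)
              - fun x => fderiv ℝ (v l) x (basisVec j) - weakPartial Ω j u x := by
          ext x
          rw [fderiv_sub ((hv k).differentiable (by simp) x) ((hv l).differentiable (by simp) x)]
          simp
        rw [e]
        refine (eLpNorm_sub_le ((hc k).aestronglyMeasurable.sub hwm)
          ((hc l).aestronglyMeasurable.sub hwm) (by norm_num)).trans ?_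
        exact add_le_add ((hvi k j).trans (hηa _ _ hk)) ((hvi l j).trans (hηa _ _ hl))
    · have := ENNReal.Tendsto.const_mul (hηt.add hηt) (Or.inr hCt)
      simpa using this
  obtain ⟨g, hg⟩ := cauchySeq_tendsto_of_complete hcau
  refine ⟨g, Lp.memLp g, v, hv, ?_, fun i => ?_, ?_⟩
  · exact tendsto_of_tendsto_of_tendsto_of_le_of_le tendsto_const_nhds hηt (fun _ => zero_le) hvu
  · exact tendsto_of_tendsto_of_tendsto_of_le_of_le tendsto_const_nhds hηt (fun _ => zero_le)
      fun k => hvi k i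
  · rw [← Lp.toLp_coeFn g (Lp.memLp g)] at hg
    exact (Lp.tendsto_Lp_iff_tendsto_eLpNorm'' v hvs g (Lp.memLp g)).1 hg

theorem isTrace_trace (hΩ : IsSmoothDomain Ω) {u : E (m + 1) → ℝ} (hu : MemH1 Ω u) :
    IsTrace Ω u (trace Ω u) := by
  have h := hΩ.exists_isTrace hu
  rw [trace, dif_pos h]
  exact h.choose_spec

end IsSmoothDomain

end Density

/-! ### Integration by parts for Sobolev functions -/

section Parts

theorem tendsto_integral_mul {X : Type*} [MeasurableSpace X] {μ : Measure X}
    {f g : ℕ → X → ℝ} {F G : X → ℝ} (hf : ∀ k, MemLp (f k) 2 μ) (hg : ∀ k, MemLp (g k) 2 μ)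
    (hF : MemLp F 2 μ) (hG : MemLp G 2 μ)
    (hfF : Tendsto (fun k => eLpNorm (fun x => f k x - F x) 2 μ) atTop (𝓝 0))
    (hgG : Tendsto (fun k => eLpNorm (fun x => g k x - G x) 2 μ) atTop (𝓝 0)) :
    Tendsto (fun k => ∫ x, f k x * g k x ∂μ) atTop (𝓝 (∫ x, F x * G x ∂μ)) := by
  have : Fact ((1 : ℝ≥0∞) ≤ 2) := ⟨by norm_num⟩
  have h1 := (Lp.tendsto_Lp_iff_tendsto_eLpNorm'' f hf F hF).2 hfF
  have h2 := (Lp.tendsto_Lp_iff_tendsto_eLpNorm'' g hg G hG).2 hgG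
  have key : ∀ {p q : X → ℝ} (hp : MemLp p 2 μ) (hq : MemLp q 2 μ),
      inner ℝ (hq.toLp q) (hp.toLp p) = ∫ x, p x * q x ∂μ := by
    intro p q hp hq
    rw [L2.inner_def]
    refine integral_congr_ae ?_
    filter_upwards [hp.coeFn_toLp, hq.coeFn_toLp] with x hx hy
    rw [hx, hy]
    simp
  have h3 := h2.inner (𝕜 := ℝ) h1
  simpa only [key] using h3

theorem memLp_top_mul {X : Type*} [MeasurableSpace X] {μ : Measure X} {a u : X → ℝ}
    (ha : MemLp a ⊤ μ) (hu : MemLp u 2 μ) : MemLp (fun x => a x * u x) 2 μ :=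
  hu.mul ha

theorem tendsto_eLpNorm_top_mul {X : Type*} [MeasurableSpace X] {μ : Measure X} {a F : X → ℝ}
    {f : ℕ → X → ℝ} (ha : MemLp a ⊤ μ) (hf : ∀ k, MemLp (f k) 2 μ) (hF : MemLp F 2 μ)
    (hfF : Tendsto (fun k => eLpNorm (fun x => f k x - F x) 2 μ) atTop (𝓝 0)) :
    Tendsto (fun k => eLpNorm (fun x => a x * f k x - a x * F x) 2 μ) atTop (𝓝 0) := by
  have h0 := ENNReal.Tendsto.const_mul (a := eLpNorm a ⊤ μ) hfF (Or.inr ha.eLpNorm_ne_top)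
  rw [mul_zero] at h0
  refine tendsto_of_tendsto_of_tendsto_of_le_of_le tendsto_const_nhds h0 (fun _ => zero_le)
    fun k => ?_
  simp only [← mul_sub]
  exact eLpNorm_smul_le_eLpNorm_top_mul_eLpNorm 2 ((hf k).sub hF).aestronglyMeasurable a

theorem integral_add_three {X : Type*} [MeasurableSpace X] {μ : Measure X} {f g k : X → ℝ}
    (hf : Integrable f μ) (hg : Integrable g μ) (hk : Integrable k μ) :
    ∫ x, (f x + g x + k x) ∂μ = (∫ x, f x ∂μ) + (∫ x, g x ∂μ) + ∫ x, k x ∂μ := by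
  rw [← integral_add hf hg]
  exact integral_add (hf.add hg) hk

theorem fderiv_mul_three {n : ℕ} {a v w : E n → ℝ} {x d : E n} (ha : DifferentiableAt ℝ a x)
    (hv : DifferentiableAt ℝ v x) (hw : DifferentiableAt ℝ w x) :
    fderiv ℝ (fun x => a x * v x * w x) x d = fderiv ℝ a x d * v x * w x
      + a x * fderiv ℝ v x d * w x + a x * v x * fderiv ℝ w x d := by
  have h : HasFDerivAt (fun x => a x * v x * w x) _ x :=
    (ha.hasFDerivAt.mul hv.hasFDerivAt).mul hw.hasFDerivAt
  rw [h.fderiv]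
  simp
  ring

/-- Weak second derivatives commute, as those of test functions do. -/
theorem weakPartial_comm {n : ℕ} {Ω : Set (E n)} (hΩo : IsOpen Ω) {f : E n → ℝ}
    (hf : MemH2 Ω f) (i j : Fin n) :
    weakPartial Ω i (weakPartial Ω j f) =ᵐ[volume.restrict Ω]
      weakPartial Ω j (weakPartial Ω i f) := by
  have hij := (hf.2 j).weakPartial_spec i
  have hji := (hf.2 i).weakPartial_spec j
  have hi := hf.1.weakPartial_spec i
  have hj := hf.1.weakPartial_spec j
  have loc : ∀ {g : E n → ℝ}, MemLp g 2 (volume.restrict Ω) → LocallyIntegrableOn g Ω := by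
    intro g hg
    exact locallyIntegrableOn_of_locallyIntegrable_restrict (hg.locallyIntegrable (by norm_num))
  have h := hΩo.ae_eq_zero_of_integral_contDiff_smul_eq_zero (μ := volume)
    (f := fun x => weakPartial Ω i (weakPartial Ω j f) x - weakPartial Ω j (weakPartial Ω i f) x)
    ((loc hij.1).sub (loc hji.1)) ?_
  · filter_upwards [(ae_restrict_iff' hΩo.measurableSet).2 h] with x hx
    linarith
  · intro ψ hψ hψc hψΩ
    have hd : ∀ k : Fin n, ContDiff ℝ ∞ fun x => fderiv ℝ ψ x (basisVec k) := fun k =>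
      (hψ.fderiv_right (by norm_cast)).clm_apply contDiff_const
    have hs : ∀ k : Fin n, tsupport (fun x => fderiv ℝ ψ x (basisVec k)) ⊆ tsupport ψ := fun k =>
      closure_minimal (fun x hx => support_fderiv_subset ℝ (f := ψ)
        (fun h0 => hx (by simp [h0]))) isClosed_closure
    have hc : ∀ k : Fin n, HasCompactSupport fun x => fderiv ℝ ψ x (basisVec k) := fun k =>
      hψc.of_isClosed_subset isClosed_closure (hs k)
    have e1 := hij.2 ψ hψ hψc hψΩ
    have e2 := hji.2 ψ hψ hψc hψΩ
    have e3 := hj.2 _ (hd i) (hc i) ((hs i).trans hψΩ)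
    have e4 := hi.2 _ (hd j) (hc j) ((hs j).trans hψΩ)
    have e5 : ∀ x, fderiv ℝ (fun x => fderiv ℝ ψ x (basisVec i)) x (basisVec j)
        = fderiv ℝ (fun x => fderiv ℝ ψ x (basisVec j)) x (basisVec i) := by
      intro x
      have hdf : DifferentiableAt ℝ (fderiv ℝ ψ) x :=
        (hψ.fderiv_right (m := ∞) (by norm_cast)).differentiable (by simp) x
      have q : ∀ k : Fin n, fderiv ℝ (fun x => fderiv ℝ ψ x (basisVec k)) x
          = (fderiv ℝ (fderiv ℝ ψ) x).flip (basisVec k) := by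
        intro k
        rw [fderiv_clm_apply hdf (differentiableAt_const _)]
        simp
      rw [q, q, ContinuousLinearMap.flip_apply, ContinuousLinearMap.flip_apply]
      exact (hψ.contDiffAt.isSymmSndFDerivAt (by
        simp only [minSmoothness_of_isRCLikeNormedField]; norm_cast)).eq _ _
    have hint : ∀ {g : E n → ℝ}, MemLp g 2 (volume.restrict Ω) →
        IntegrableOn (fun x => g x * ψ x) Ω := by
      intro g hg
      have hψ2 : MemLp ψ 2 (volume.restrict Ω) :=
        (hψ.continuous.memLp_of_hasCompactSupport hψc).restrict Ω
      exact hg.integrable_mul hψ2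
    rw [← setIntegral_eq_integral_of_forall_compl_eq_zero (s := Ω) fun x hx => by
      rw [image_eq_zero_of_notMem_tsupport fun h => hx (hψΩ h), zero_smul]]
    calc ∫ x in Ω, ψ x • (weakPartial Ω i (weakPartial Ω j f) x
          - weakPartial Ω j (weakPartial Ω i f) x)
        = (∫ x in Ω, weakPartial Ω i (weakPartial Ω j f) x * ψ x)
          - ∫ x in Ω, weakPartial Ω j (weakPartial Ω i f) x * ψ x := by
          rw [← integral_sub (hint hij.1) (hint hji.1)]
          refine integral_congr_ae (Eventually.of_forall fun x => ?_)
          simp only [smul_eq_mul]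
          ring
      _ = 0 := by
          simp only [e5] at e3
          linarith

/-- The functions `V` on `Ω` and `b` on `∂Ω` are integrable and have equal integrals, as is the case
when `V` is the divergence of a vector field and `b` its normal component. The vector field itself
is not recorded. -/
def HasFlux {n : ℕ} (Ω : Set (E n)) (V b : E n → ℝ) : Prop :=
  IntegrableOn V Ω ∧ Integrable b (surfaceMeasure Ω) ∧
    ∫ x in Ω, V x = ∫ x, b x ∂(surfaceMeasure Ω)

namespace HasFlux

variable {n : ℕ} {Ω : Set (E n)} {V W b c : E n → ℝ}

theorem add (h : HasFlux Ω V b) (h' : HasFlux Ω W c) :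
    HasFlux Ω (fun x => V x + W x) fun x => b x + c x :=
  ⟨h.1.add h'.1, h.2.1.add h'.2.1, by
    rw [integral_add h.1 h'.1, integral_add h.2.1 h'.2.1, h.2.2, h'.2.2]⟩

theorem const_mul (h : HasFlux Ω V b) (r : ℝ) :
    HasFlux Ω (fun x => r * V x) fun x => r * b x :=
  ⟨h.1.const_mul r, h.2.1.const_mul r, by
    rw [integral_const_mul, integral_const_mul, h.2.2]⟩

theorem sum {ι : Type*} {s : Finset ι} {V b : ι → E n → ℝ}
    (h : ∀ i ∈ s, HasFlux Ω (V i) (b i)) :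
    HasFlux Ω (fun x => ∑ i ∈ s, V i x) fun x => ∑ i ∈ s, b i x :=
  ⟨integrable_finsetSum _ fun i hi => (h i hi).1,
    integrable_finsetSum _ fun i hi => (h i hi).2.1, by
    rw [integral_finsetSum _ fun i hi => (h i hi).1,
      integral_finsetSum _ fun i hi => (h i hi).2.1]
    exact Finset.sum_congr rfl fun i hi => (h i hi).2.2⟩

end HasFlux

namespace IsSmoothDomain

variable {m : ℕ} {Ω : Set (E (m + 1))}

theorem memLp_top_surface (hΩ : IsSmoothDomain Ω) {g : E (m + 1) → ℝ}
    (hg : ContinuousOn g (frontier Ω)) : MemLp g ⊤ (surfaceMeasure Ω) := by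
  obtain ⟨C, hC⟩ := hΩ.isCompact_frontier.exists_bound_of_continuousOn hg
  exact memLp_top_of_bound (hg.aestronglyMeasurable isClosed_frontier.measurableSet) C
    ((ae_restrict_iff' isClosed_frontier.measurableSet).2 (Eventually.of_forall hC))

theorem memLp_top_volume (hΩ : IsSmoothDomain Ω) {g : E (m + 1) → ℝ}
    (hg : ContinuousOn g (closure Ω)) : MemLp g ⊤ (volume.restrict Ω) := by
  obtain ⟨C, hC⟩ := hΩ.isCompact_closure.exists_bound_of_continuousOn hg
  exact memLp_top_of_bound ((hg.mono subset_closure).aestronglyMeasurable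
    hΩ.isOpen.measurableSet) C ((ae_restrict_iff' hΩ.isOpen.measurableSet).2
    (Eventually.of_forall fun x hx => hC x (subset_closure hx)))

/-- Integration by parts for a product of two `H¹` functions with a weight that is `C¹` up to the
boundary. It passes to the limit from the divergence theorem for smooth functions along the
sequences that define the traces. -/
theorem hasFlux_mul (hΩ : IsSmoothDomain Ω) {a u w gu gw : E (m + 1) → ℝ}
    (ha : ContDiffOn ℝ 1 a (closure Ω)) (hu : MemH1 Ω u) (hw : MemH1 Ω w)
    (hgu : IsTrace Ω u gu) (hgw : IsTrace Ω w gw) (i : Fin (m + 1)) :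
    HasFlux Ω (fun x => pd Ω i a x * u x * w x + a x * weakPartial Ω i u x * w x
      + a x * u x * weakPartial Ω i w x) fun x => a x * outwardNormal Ω x i * gu x * gw x := by
  obtain ⟨hgu2, v, hv, hvu, hvi, hvg⟩ := hgu
  obtain ⟨hgw2, z, hz, hzw, hzi, hzg⟩ := hgw
  have hu2 := hu.1
  have hw2 := hw.1
  have hui := (hu.weakPartial_spec i).1
  have hwi := (hw.weakPartial_spec i).1
  have a0 := hΩ.memLp_top_volume ha.continuousOn
  have a1 := hΩ.memLp_top_volume (hΩ.continuousOn_pd i ha)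
  have aν := hΩ.memLp_top_surface ((ha.continuousOn.mono frontier_subset_closure).mul
    (hΩ.continuousOn_normal_apply i))
  have cd : ∀ {p : E (m + 1) → ℝ}, ContDiff ℝ ∞ p → Continuous fun x => fderiv ℝ p x (basisVec i) :=
    fun hp => (hp.continuous_fderiv (by simp)).clm_apply continuous_const
  have v2 : ∀ k, MemLp (v k) 2 (volume.restrict Ω) := fun k =>
    hΩ.memLp_volume (hv k).continuous.continuousOn
  have z2 : ∀ k, MemLp (z k) 2 (volume.restrict Ω) := fun k =>
    hΩ.memLp_volume (hz k).continuous.continuousOn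
  have v2' := fun k => hΩ.memLp_volume (cd (hv k)).continuousOn
  have z2' := fun k => hΩ.memLp_volume (cd (hz k)).continuousOn
  have vs := fun k => hΩ.memLp_surface (hv k).continuous.continuousOn
  have zs := fun k => hΩ.memLp_surface (hz k).continuous.continuousOn
  have t1 := tendsto_integral_mul (fun k => memLp_top_mul a1 (v2 k)) z2 (memLp_top_mul a1 hu2) hw2
    (tendsto_eLpNorm_top_mul a1 v2 hu2 hvu) hzw
  have t2 := tendsto_integral_mul (fun k => memLp_top_mul a0 (v2' k)) z2 (memLp_top_mul a0 hui) hw2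
    (tendsto_eLpNorm_top_mul a0 v2' hui (hvi i)) hzw
  have t3 := tendsto_integral_mul (fun k => memLp_top_mul a0 (v2 k)) z2' (memLp_top_mul a0 hu2) hwi
    (tendsto_eLpNorm_top_mul a0 v2 hu2 hvu) (hzi i)
  have t4 := tendsto_integral_mul (fun k => memLp_top_mul aν (vs k)) zs (memLp_top_mul aν hgu2)
    hgw2 (tendsto_eLpNorm_top_mul aν vs hgu2 hvg) hzg
  have i1 := (memLp_top_mul a1 hu2).integrable_mul hw2
  have i2 := (memLp_top_mul a0 hui).integrable_mul hw2
  have i3 := (memLp_top_mul a0 hu2).integrable_mul hwi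
  refine ⟨(i1.add i2).add i3, (memLp_top_mul aν hgu2).integrable_mul hgw2, ?_⟩
  have e0 : ∫ x in Ω, (pd Ω i a x * u x * w x + a x * weakPartial Ω i u x * w x
      + a x * u x * weakPartial Ω i w x) = (∫ x in Ω, pd Ω i a x * u x * w x)
      + (∫ x in Ω, a x * weakPartial Ω i u x * w x)
      + ∫ x in Ω, a x * u x * weakPartial Ω i w x := by
    exact integral_add_three i1 i2 i3
  rw [e0]
  -- for the smooth approximations the identity is the divergence theorem
  refine tendsto_nhds_unique ((t1.add t2).add t3) (t4.congr fun k => ?_)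
  have hk : ContDiffOn ℝ 1 (fun x => a x * v k x * z k x) (closure Ω) :=
    (ha.mul ((hv k).of_le (by norm_cast)).contDiffOn).mul
      ((hz k).of_le (by norm_cast)).contDiffOn
  have e := hΩ.integral_pd hk i
  have j1 := (memLp_top_mul a1 (v2 k)).integrable_mul (z2 k)
  have j2 := (memLp_top_mul a0 (v2' k)).integrable_mul (z2 k)
  have j3 := (memLp_top_mul a0 (v2 k)).integrable_mul (z2' k)
  calc ∫ x, a x * outwardNormal Ω x i * v k x * z k x ∂(surfaceMeasure Ω)
      = ∫ x, a x * v k x * z k x * outwardNormal Ω x i ∂(surfaceMeasure Ω) :=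
        integral_congr_ae (Eventually.of_forall fun x => by simp only; ring)
    _ = ∫ x in Ω, (pd Ω i a x * v k x * z k x + a x * fderiv ℝ (v k) x (basisVec i) * z k x
          + a x * v k x * fderiv ℝ (z k) x (basisVec i)) := by
        rw [← e]
        refine setIntegral_congr_fun hΩ.isOpen.measurableSet fun x hx => ?_
        rw [hΩ.pd_eq_fderiv i _ hx, hΩ.pd_eq_fderiv i _ hx]
        have hax : DifferentiableAt ℝ a x :=
          (ha.contDiffAt (mem_of_superset (hΩ.isOpen.mem_nhds hx) subset_closure)).differentiableAt
            (by simp)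
        exact fderiv_mul_three hax ((hv k).differentiable (by simp) x)
          ((hz k).differentiable (by simp) x)
    _ = _ := integral_add_three j1 j2 j3

end IsSmoothDomain

end Parts

/-! ### Transport, Green and commutator identities -/

section Identities

theorem HasFlux.congr {n : ℕ} {Ω : Set (E n)} {V W b c : E n → ℝ} (h : HasFlux Ω V b)
    (hV : V =ᵐ[volume.restrict Ω] W) (hb : ∀ x, b x = c x) : HasFlux Ω W c := by
  obtain rfl : b = c := funext hb
  exact ⟨h.1.congr hV, h.2.1, by rw [← integral_congr_ae hV, h.2.2]⟩

namespace IsSmoothDomain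

variable {m : ℕ} {Ω : Set (E (m + 1))}

theorem differentiableAt (hΩ : IsSmoothDomain Ω) {g : E (m + 1) → ℝ}
    (hg : ContDiffOn ℝ ∞ g (closure Ω)) {x : E (m + 1)} (hx : x ∈ Ω) : DifferentiableAt ℝ g x :=
  (hg.contDiffAt (mem_of_superset (hΩ.isOpen.mem_nhds hx) subset_closure)).differentiableAt
    (by simp)

theorem pd_congr (hΩ : IsSmoothDomain Ω) {g k : E (m + 1) → ℝ} (h : ∀ x ∈ Ω, g x = k x)
    (i : Fin (m + 1)) {x : E (m + 1)} (hx : x ∈ Ω) : pd Ω i g x = pd Ω i k x := by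
  rw [hΩ.pd_eq_fderiv i _ hx, hΩ.pd_eq_fderiv i _ hx]
  have : g =ᶠ[𝓝 x] k := by
    filter_upwards [hΩ.isOpen.mem_nhds hx] with y hy using h y hy
  rw [this.fderiv_eq]

theorem pd_mul (hΩ : IsSmoothDomain Ω) {g k : E (m + 1) → ℝ}
    (hg : ContDiffOn ℝ ∞ g (closure Ω)) (hk : ContDiffOn ℝ ∞ k (closure Ω)) (i : Fin (m + 1))
    {x : E (m + 1)} (hx : x ∈ Ω) :
    pd Ω i (fun y => g y * k y) x = pd Ω i g x * k x + g x * pd Ω i k x := by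
  rw [hΩ.pd_eq_fderiv i _ hx, hΩ.pd_eq_fderiv i _ hx, hΩ.pd_eq_fderiv i _ hx,
    fderiv_fun_mul (hΩ.differentiableAt hg hx) (hΩ.differentiableAt hk hx)]
  simp
  ring

theorem pd_add (hΩ : IsSmoothDomain Ω) {g k : E (m + 1) → ℝ}
    (hg : ContDiffOn ℝ ∞ g (closure Ω)) (hk : ContDiffOn ℝ ∞ k (closure Ω)) (i : Fin (m + 1))
    {x : E (m + 1)} (hx : x ∈ Ω) :
    pd Ω i (fun y => g y + k y) x = pd Ω i g x + pd Ω i k x := by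
  rw [hΩ.pd_eq_fderiv i _ hx, hΩ.pd_eq_fderiv i _ hx, hΩ.pd_eq_fderiv i _ hx,
    fderiv_fun_add (hΩ.differentiableAt hg hx) (hΩ.differentiableAt hk hx)]
  simp

theorem pd_const_mul (hΩ : IsSmoothDomain Ω) {g : E (m + 1) → ℝ}
    (hg : ContDiffOn ℝ ∞ g (closure Ω)) (r : ℝ) (i : Fin (m + 1)) {x : E (m + 1)} (hx : x ∈ Ω) :
    pd Ω i (fun y => r * g y) x = r * pd Ω i g x := by
  rw [hΩ.pd_eq_fderiv i _ hx, hΩ.pd_eq_fderiv i _ hx,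
    fderiv_const_mul (hΩ.differentiableAt hg hx)]
  simp

theorem pd_sum (hΩ : IsSmoothDomain Ω) {ι : Type*} [Fintype ι] {g : ι → E (m + 1) → ℝ}
    (hg : ∀ j, ContDiffOn ℝ ∞ (g j) (closure Ω)) (i : Fin (m + 1)) {x : E (m + 1)} (hx : x ∈ Ω) :
    pd Ω i (fun y => ∑ j, g j y) x = ∑ j, pd Ω i (g j) x := by
  simp only [hΩ.pd_eq_fderiv i _ hx]
  rw [fderiv_fun_sum fun j _ => hΩ.differentiableAt (hg j) hx]
  simp

theorem pd_comm (hΩ : IsSmoothDomain Ω) {g : E (m + 1) → ℝ}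
    (hg : ContDiffOn ℝ ∞ g (closure Ω)) (i j : Fin (m + 1)) {x : E (m + 1)} (hx : x ∈ Ω) :
    pd Ω i (pd Ω j g) x = pd Ω j (pd Ω i g) x := by
  have hgx : ContDiffAt ℝ ∞ g x :=
    hg.contDiffAt (mem_of_superset (hΩ.isOpen.mem_nhds hx) subset_closure)
  have hd : DifferentiableAt ℝ (fderiv ℝ g) x :=
    (hgx.fderiv_right (m := ∞) (by norm_cast)).differentiableAt (by simp)
  have q : ∀ a b : Fin (m + 1), pd Ω a (pd Ω b g) x
      = fderiv ℝ (fderiv ℝ g) x (basisVec a) (basisVec b) := by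
    intro a b
    rw [hΩ.pd_congr (k := fun y => fderiv ℝ g y (basisVec b))
      (fun y hy => hΩ.pd_eq_fderiv b g hy) a hx, hΩ.pd_eq_fderiv a _ hx,
      fderiv_clm_apply hd (differentiableAt_const _)]
    simp
  rw [q, q]
  exact (hgx.isSymmSndFDerivAt (by
    simp only [minSmoothness_of_isRCLikeNormedField]; norm_cast)).eq _ _

theorem contDiffOn_lap (hΩ : IsSmoothDomain Ω) {g : E (m + 1) → ℝ}
    (hg : ContDiffOn ℝ ∞ g (closure Ω)) : ContDiffOn ℝ ∞ (lap Ω g) (closure Ω) :=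
  ContDiffOn.sum fun i _ => hΩ.contDiffOn_pd i (hΩ.contDiffOn_pd i hg)

theorem contDiffOn_gradSq (hΩ : IsSmoothDomain Ω) {g : E (m + 1) → ℝ}
    (hg : ContDiffOn ℝ ∞ g (closure Ω)) : ContDiffOn ℝ ∞ (gradSq Ω g) (closure Ω) :=
  ContDiffOn.sum fun i _ => (hΩ.contDiffOn_pd i hg).pow 2

theorem pd_lap (hΩ : IsSmoothDomain Ω) {g : E (m + 1) → ℝ}
    (hg : ContDiffOn ℝ ∞ g (closure Ω)) (i : Fin (m + 1)) {x : E (m + 1)} (hx : x ∈ Ω) :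
    pd Ω i (lap Ω g) x = lap Ω (pd Ω i g) x := by
  rw [show lap Ω g = fun y => ∑ j, pd Ω j (pd Ω j g) y from rfl,
    hΩ.pd_sum (fun j => hΩ.contDiffOn_pd j (hΩ.contDiffOn_pd j hg)) i hx]
  refine Finset.sum_congr rfl fun j _ => ?_
  rw [hΩ.pd_comm (hΩ.contDiffOn_pd j hg) i j hx]
  exact hΩ.pd_congr (fun y hy => hΩ.pd_comm hg i j hy) j hx

theorem pd_gradSq (hΩ : IsSmoothDomain Ω) {g : E (m + 1) → ℝ}
    (hg : ContDiffOn ℝ ∞ g (closure Ω)) (i : Fin (m + 1)) {x : E (m + 1)} (hx : x ∈ Ω) :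
    pd Ω i (gradSq Ω g) x = 2 * ∑ j, pd Ω i (pd Ω j g) x * pd Ω j g x := by
  rw [show gradSq Ω g = fun y => ∑ j, pd Ω j g y * pd Ω j g y from
      funext fun y => by simp only [gradSq, sq],
    hΩ.pd_sum (fun j => (hΩ.contDiffOn_pd j hg).mul (hΩ.contDiffOn_pd j hg)) i hx,
    Finset.mul_sum]
  refine Finset.sum_congr rfl fun j _ => ?_
  rw [hΩ.pd_mul (hΩ.contDiffOn_pd j hg) (hΩ.contDiffOn_pd j hg) i hx]
  ring

theorem continuousOn_pdNormal (hΩ : IsSmoothDomain Ω) {g : E (m + 1) → ℝ}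
    (hg : ContDiffOn ℝ ∞ g (closure Ω)) : ContinuousOn (pdNormal Ω g) (frontier Ω) :=
  continuousOn_finsetSum _ fun i _ => (hΩ.continuousOn_normal_apply i).mul
    ((hΩ.contDiffOn_pd i hg).continuousOn.mono frontier_subset_closure)

theorem memLp_mul_volume (hΩ : IsSmoothDomain Ω) {a u : E (m + 1) → ℝ}
    (ha : ContinuousOn a (closure Ω)) (hu : MemLp u 2 (volume.restrict Ω)) :
    MemLp (fun x => a x * u x) 2 (volume.restrict Ω) :=
  memLp_top_mul (hΩ.memLp_top_volume ha) hu

theorem memLp_mul_surface (hΩ : IsSmoothDomain Ω) {a u : E (m + 1) → ℝ}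
    (ha : ContinuousOn a (frontier Ω)) (hu : MemLp u 2 (surfaceMeasure Ω)) :
    MemLp (fun x => a x * u x) 2 (surfaceMeasure Ω) :=
  memLp_top_mul (hΩ.memLp_top_surface ha) hu

theorem memLp_traceNormal (hΩ : IsSmoothDomain Ω) {f : E (m + 1) → ℝ} (hf : MemH2 Ω f) :
    MemLp (traceNormal Ω f) 2 (surfaceMeasure Ω) :=
  memLp_finsetSum _ fun i _ =>
    hΩ.memLp_mul_surface (hΩ.continuousOn_normal_apply i) (hΩ.isTrace_trace (hf.2 i)).1

/-- The identity `∫ (∇g · ∇f + ½ Δg f) f = ½ ∫ ∂ₙg f²`: the first-order operator is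
skew-adjoint up to its boundary term. -/
theorem hasFlux_transport (hΩ : IsSmoothDomain Ω) {g f : E (m + 1) → ℝ}
    (hg : ContDiffOn ℝ ∞ g (closure Ω)) (hf : MemH1 Ω f) :
    HasFlux Ω (fun x => (-(∑ i, pd Ω i g x * weakPartial Ω i f x) - 1 / 2 * lap Ω g x * f x) * f x)
      fun x => -(1 / 2) * (pdNormal Ω g x * trace Ω f x ^ 2) := by
  have ht := hΩ.isTrace_trace hf
  refine ((HasFlux.sum (s := Finset.univ) fun i _ => hΩ.hasFlux_mul
    ((hΩ.contDiffOn_pd i hg).of_le (by norm_cast)) hf hf ht ht i).const_mul (-(1 / 2))).congr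
    (Eventually.of_forall fun x => ?_) fun x => ?_
  · simp only [lap, Finset.sum_add_distrib, ← Finset.sum_mul]
    simp only [mul_right_comm _ (f x), ← Finset.sum_mul]
    ring
  · simp only [pdNormal, Finset.sum_mul]
    refine congrArg _ (Finset.sum_congr rfl fun i _ => by ring)

/-- Green's formula. -/
theorem hasFlux_green (hΩ : IsSmoothDomain Ω) {f : E (m + 1) → ℝ} (hf : MemH2 Ω f) :
    HasFlux Ω (fun x => (∑ i, weakPartial Ω i (weakPartial Ω i f) x) * f x
      + ∑ i, weakPartial Ω i f x ^ 2) fun x => traceNormal Ω f x * trace Ω f x := by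
  refine (HasFlux.sum (s := Finset.univ) fun i _ => hΩ.hasFlux_mul (a := fun _ => 1)
    contDiffOn_const (hf.2 i) hf.1 (hΩ.isTrace_trace (hf.2 i)) (hΩ.isTrace_trace hf.1) i).congr
    (Eventually.of_forall fun x => ?_) fun x => ?_
  · simp only [pd, fderivWithin_const_apply, zero_apply, zero_mul, zero_add, one_mul,
      Finset.sum_add_distrib, Finset.sum_mul, sq]
  · simp only [traceNormal, Finset.sum_mul, one_mul]

/-- The pointwise algebra of the third identity. Here `P`, `Q` and `F`, `H` stand for the first and
second derivatives of `Φ` and of `f`, and `dL`, `dη` for the gradients of `ΔΦ` and `η`. The terms in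
`∂ₖΦ ∂ᵢf ∂ᵢ∂ₖf` cancel by the symmetry of `H`. -/
theorem commutator_identity {ι : Type*} [Fintype ι] (P F dL dη : ι → ℝ) (Q H : ι → ι → ℝ)
    (η f : ℝ) (hH : ∀ i k, H i k = H k i) :
    2 * (∑ i, ∑ k, (Q i k * F i * F k + P k * H i i * F k + P k * F i * H i k))
      + (-1) * (∑ i, ∑ k, (Q k k * F i * F i + P k * H k i * F i + P k * F i * H k i))
      + (∑ i, (dL i * F i * f + (∑ k, Q k k) * H i i * f + (∑ k, Q k k) * F i * F i))
      + (∑ i, ((dη i * P i + η * Q i i) * f * f + η * P i * F i * f + η * P i * f * F i))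
    = 2 * (∑ i, ∑ j, F i * Q i j * F j)
      + 2 * ((-(∑ i, H i i) - η * f) * (-(∑ k, P k * F k) - 1 / 2 * (∑ k, Q k k) * f))
      + (∑ i, F i * dL i) * f + (∑ i, dη i * P i) * f ^ 2 := by
  have s1 : ∑ i, ∑ k, P k * H i i * F k = (∑ i, H i i) * ∑ k, P k * F k := by
    rw [Finset.sum_mul_sum]
    exact Finset.sum_congr rfl fun i _ => Finset.sum_congr rfl fun k _ => by ring
  have s2 : ∑ i, ∑ k, P k * H k i * F i = ∑ i, ∑ k, P k * F i * H i k :=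
    Finset.sum_congr rfl fun i _ => Finset.sum_congr rfl fun k _ => by rw [hH k i]; ring
  have s3 : ∑ i, ∑ k, P k * F i * H k i = ∑ i, ∑ k, P k * F i * H i k :=
    Finset.sum_congr rfl fun i _ => Finset.sum_congr rfl fun k _ => by rw [hH k i]
  have s4 : ∑ i, ∑ k, Q k k * F i * F i = (∑ k, Q k k) * ∑ i, F i * F i := by
    rw [mul_comm, Finset.sum_mul_sum]
    exact Finset.sum_congr rfl fun i _ => Finset.sum_congr rfl fun k _ => by ring
  have s5 : ∑ i, ∑ k, Q i k * F i * F k = ∑ i, ∑ j, F i * Q i j * F j :=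
    Finset.sum_congr rfl fun i _ => Finset.sum_congr rfl fun k _ => by ring
  have s6 : ∑ i, dL i * F i * f = (∑ i, F i * dL i) * f := by
    rw [Finset.sum_mul]
    exact Finset.sum_congr rfl fun i _ => by ring
  have s7 : ∑ i, (∑ k, Q k k) * H i i * f = (∑ k, Q k k) * (∑ i, H i i) * f := by
    rw [Finset.mul_sum, Finset.sum_mul]
  have s8 : ∑ i, (∑ k, Q k k) * F i * F i = (∑ k, Q k k) * ∑ i, F i * F i := by
    rw [Finset.mul_sum]
    exact Finset.sum_congr rfl fun i _ => by ring
  have s9 : ∑ i, (dη i * P i + η * Q i i) * f * f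
      = (∑ i, dη i * P i) * f ^ 2 + η * (∑ i, Q i i) * f ^ 2 := by
    rw [Finset.mul_sum, Finset.sum_mul, Finset.sum_mul, ← Finset.sum_add_distrib]
    exact Finset.sum_congr rfl fun i _ => by ring
  have s10 : ∑ i, η * P i * F i * f = η * (∑ i, P i * F i) * f := by
    rw [Finset.mul_sum, Finset.sum_mul]
    exact Finset.sum_congr rfl fun i _ => by ring
  have s11 : ∑ i, η * P i * f * F i = η * (∑ i, P i * F i) * f := by
    rw [Finset.mul_sum, Finset.sum_mul]
    exact Finset.sum_congr rfl fun i _ => by ring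
  simp only [Finset.sum_add_distrib] at s9 ⊢
  rw [s1, s2, s3, s4, s5, s6, s7, s8, s9, s10, s11]
  ring

/-- The commutator identity for general `g` and `η`, with the boundary terms of the four
integrations by parts that it combines. -/
theorem hasFlux_commutator (hΩ : IsSmoothDomain Ω) {g η f : E (m + 1) → ℝ}
    (hg : ContDiffOn ℝ ∞ g (closure Ω)) (hη : ContDiffOn ℝ ∞ η (closure Ω)) (hf : MemH2 Ω f) :
    HasFlux Ω (fun x =>
        2 * (∑ i, ∑ j, weakPartial Ω i f x * pd Ω i (pd Ω j g) x * weakPartial Ω j f x)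
        + 2 * ((-(∑ i, weakPartial Ω i (weakPartial Ω i f) x) - η x * f x)
          * (-(∑ i, pd Ω i g x * weakPartial Ω i f x) - 1 / 2 * lap Ω g x * f x))
        + (∑ i, weakPartial Ω i f x * lap Ω (pd Ω i g) x) * f x
        + (∑ i, pd Ω i η x * pd Ω i g x) * f x ^ 2)
      fun x =>
        2 * (traceNormal Ω f x * (∑ i, pd Ω i g x * trace Ω (weakPartial Ω i f) x))
        + (-1) * (pdNormal Ω g x * (∑ i, trace Ω (weakPartial Ω i f) x ^ 2))
        + traceNormal Ω f x * lap Ω g x * trace Ω f x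
        + η x * pdNormal Ω g x * trace Ω f x ^ 2 := by
  have htf := hΩ.isTrace_trace hf.1
  have ht := fun i => hΩ.isTrace_trace (hf.2 i)
  have hP := fun i => (hΩ.contDiffOn_pd i hg).of_le (m := 1) (by norm_cast)
  have hL := (hΩ.contDiffOn_lap hg).of_le (m := 1) (by norm_cast)
  have hηP := fun i => (hη.mul (hΩ.contDiffOn_pd i hg)).of_le (m := 1) (by norm_cast)
  have M1 := (HasFlux.sum (s := Finset.univ) fun i _ => HasFlux.sum (s := Finset.univ) fun k _ =>
    hΩ.hasFlux_mul (hP k) (hf.2 i) (hf.2 k) (ht i) (ht k) i).const_mul 2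
  have M2 := (HasFlux.sum (s := Finset.univ) fun i _ => HasFlux.sum (s := Finset.univ) fun k _ =>
    hΩ.hasFlux_mul (hP k) (hf.2 i) (hf.2 i) (ht i) (ht i) k).const_mul (-1)
  have M3 := HasFlux.sum (s := Finset.univ) fun i _ =>
    hΩ.hasFlux_mul hL (hf.2 i) hf.1 (ht i) htf i
  have M4 := HasFlux.sum (s := Finset.univ) fun i _ =>
    hΩ.hasFlux_mul (hηP i) hf.1 hf.1 htf htf i
  refine (((M1.add M2).add M3).add M4).congr ?_ fun x => ?_
  · have hsymm : ∀ᵐ x ∂(volume.restrict Ω), ∀ i k, weakPartial Ω i (weakPartial Ω k f) x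
        = weakPartial Ω k (weakPartial Ω i f) x :=
      ae_all_iff.2 fun i => ae_all_iff.2 fun k => weakPartial_comm hΩ.isOpen hf i k
    filter_upwards [hsymm, ae_restrict_mem hΩ.isOpen.measurableSet] with x hx hxΩ
    have e := commutator_identity (fun i => pd Ω i g x) (fun i => weakPartial Ω i f x)
      (fun i => pd Ω i (lap Ω g) x) (fun i => pd Ω i η x) (fun i j => pd Ω i (pd Ω j g) x)
      (fun i j => weakPartial Ω i (weakPartial Ω j f) x) (η x) (f x) hx
    simp only [← hΩ.pd_lap hg _ hxΩ]
    have e' : ∀ i, pd Ω i (fun y => η y * pd Ω i g y) x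
        = pd Ω i η x * pd Ω i g x + η x * pd Ω i (pd Ω i g) x := fun i =>
      hΩ.pd_mul hη (hΩ.contDiffOn_pd i hg) i hxΩ
    simp only [← e'] at e
    exact e
  · have b1 : ∑ i, ∑ k, pd Ω k g x * outwardNormal Ω x i * trace Ω (weakPartial Ω i f) x
        * trace Ω (weakPartial Ω k f) x
        = traceNormal Ω f x * ∑ i, pd Ω i g x * trace Ω (weakPartial Ω i f) x := by
      rw [traceNormal, Finset.sum_mul_sum]
      exact Finset.sum_congr rfl fun i _ => Finset.sum_congr rfl fun k _ => by ring
    have b2 : ∑ i, ∑ k, pd Ω k g x * outwardNormal Ω x k * trace Ω (weakPartial Ω i f) x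
        * trace Ω (weakPartial Ω i f) x
        = pdNormal Ω g x * ∑ i, trace Ω (weakPartial Ω i f) x ^ 2 := by
      rw [pdNormal, mul_comm, Finset.sum_mul_sum]
      exact Finset.sum_congr rfl fun i _ => Finset.sum_congr rfl fun k _ => by ring
    have b3 : ∑ i, lap Ω g x * outwardNormal Ω x i * trace Ω (weakPartial Ω i f) x
        * trace Ω f x = traceNormal Ω f x * lap Ω g x * trace Ω f x := by
      rw [traceNormal, Finset.sum_mul, Finset.sum_mul]
      exact Finset.sum_congr rfl fun i _ => by ring
    have b4 : ∑ i, η x * pd Ω i g x * outwardNormal Ω x i * trace Ω f x * trace Ω f x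
        = η x * pdNormal Ω g x * trace Ω f x ^ 2 := by
      rw [pdNormal, Finset.mul_sum, Finset.sum_mul]
      exact Finset.sum_congr rfl fun i _ => by ring
    rw [b1, b2, b3, b4]

end IsSmoothDomain

end Identities

/-! ### The weight `Φ` and the function `η` -/

section Weight

theorem hasDerivAt_weight {n : ℕ} (φ : E n → ℝ) (s T h : ℝ) {t : ℝ} (ht : Gam T h t ≠ 0)
    (x : E n) : HasDerivAt (fun τ => weight φ s T h τ x) (weight φ s T h t x / Gam T h t) t := by
  have h1 : HasDerivAt (fun τ => Gam T h τ) (-1) t := by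
    simpa [Gam] using ((hasDerivAt_id t).const_sub T).add_const h
  have h2 := (hasDerivAt_const t (s * φ x)).div h1 ht
  refine h2.congr_deriv ?_
  rw [weight]
  field_simp
  ring

theorem contDiffOn_weight {n : ℕ} {Ω : Set (E n)} {φ : E n → ℝ}
    (hφ : ContDiffOn ℝ ∞ φ (closure Ω)) (s T h t : ℝ) :
    ContDiffOn ℝ ∞ (weight φ s T h t) (closure Ω) :=
  (contDiffOn_const.mul hφ).div_const _

theorem eta_weight {n : ℕ} (Ω : Set (E n)) (φ : E n → ℝ) (s T h : ℝ) {t : ℝ}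
    (ht : Gam T h t ≠ 0) :
    eta Ω (weight φ s T h) t = fun x => 1 / (2 * Gam T h t) * weight φ s T h t x
      + 1 / 4 * gradSq Ω (weight φ s T h t) x := by
  funext x
  rw [eta, (hasDerivAt_weight φ s T h ht x).deriv]
  ring

theorem weight_eq {n : ℕ} (φ : E n → ℝ) (s T h t : ℝ) :
    weight φ s T h t = fun x => s / Gam T h t * φ x := by
  funext x
  rw [weight]
  ring

namespace IsSmoothDomain

variable {m : ℕ} {Ω : Set (E (m + 1))} {φ : E (m + 1) → ℝ}

theorem contDiffOn_eta (hΩ : IsSmoothDomain Ω) (hφ : ContDiffOn ℝ ∞ φ (closure Ω)) (s T h : ℝ)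
    {t : ℝ} (ht : Gam T h t ≠ 0) : ContDiffOn ℝ ∞ (eta Ω (weight φ s T h) t) (closure Ω) := by
  have hw := contDiffOn_weight hφ s T h t
  rw [eta_weight Ω φ s T h ht]
  exact (contDiffOn_const.mul hw).add (contDiffOn_const.mul (hΩ.contDiffOn_gradSq hw))

theorem pd_weight (hΩ : IsSmoothDomain Ω) (hφ : ContDiffOn ℝ ∞ φ (closure Ω)) (s T h t : ℝ)
    (i : Fin (m + 1)) {x : E (m + 1)} (hx : x ∈ Ω) :
    pd Ω i (weight φ s T h t) x = s / Gam T h t * pd Ω i φ x := by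
  rw [weight_eq]
  exact hΩ.pd_const_mul hφ _ i hx

theorem pd_pd_weight (hΩ : IsSmoothDomain Ω) (hφ : ContDiffOn ℝ ∞ φ (closure Ω)) (s T h t : ℝ)
    (i j : Fin (m + 1)) {x : E (m + 1)} (hx : x ∈ Ω) :
    pd Ω i (pd Ω j (weight φ s T h t)) x = s / Gam T h t * pd Ω i (pd Ω j φ) x := by
  rw [hΩ.pd_congr (fun y hy => hΩ.pd_weight hφ s T h t j hy) i hx]
  exact hΩ.pd_const_mul (hΩ.contDiffOn_pd j hφ) _ i hx

/-- In `Ω`, the function `η` is a function of `x` divided by `Γ(t)²`, so that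
`∂ₜη = 2 η / Γ(t)`. -/
theorem deriv_eta (hΩ : IsSmoothDomain Ω) (hφ : ContDiffOn ℝ ∞ φ (closure Ω)) (s T h : ℝ)
    {t : ℝ} (ht : Gam T h t ≠ 0) {x : E (m + 1)} (hx : x ∈ Ω) :
    deriv (fun τ => eta Ω (weight φ s T h) τ x) t
      = 2 / Gam T h t * eta Ω (weight φ s T h) t x := by
  have hform : ∀ τ, Gam T h τ ≠ 0 → eta Ω (weight φ s T h) τ x
      = (1 / 2 * (s * φ x) + 1 / 4 * (s ^ 2 * gradSq Ω φ x)) / Gam T h τ ^ 2 := by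
    intro τ hτ
    have hsq : gradSq Ω (weight φ s T h τ) x = (s / Gam T h τ) ^ 2 * gradSq Ω φ x := by
      simp only [gradSq, Finset.mul_sum, hΩ.pd_weight hφ s T h τ _ hx, mul_pow]
    rw [eta_weight Ω φ s T h hτ]
    simp only [hsq, weight]
    field_simp
  have h1 : HasDerivAt (fun τ => Gam T h τ) (-1) t := by
    simpa [Gam] using ((hasDerivAt_id t).const_sub T).add_const h
  have h2 := (hasDerivAt_const t (1 / 2 * (s * φ x) + 1 / 4 * (s ^ 2 * gradSq Ω φ x))).div
    (h1.pow 2) (pow_ne_zero 2 ht)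
  have hev : (fun τ => eta Ω (weight φ s T h) τ x) =ᶠ[𝓝 t] fun τ =>
      (1 / 2 * (s * φ x) + 1 / 4 * (s ^ 2 * gradSq Ω φ x)) / Gam T h τ ^ 2 := by
    filter_upwards [h1.continuousAt.eventually_ne ht] with τ hτ using hform τ hτ
  rw [hev.deriv_eq, hform t ht]
  refine h2.deriv.trans ?_
  simp only [Pi.pow_apply]
  field_simp
  ring

/-- The term `∇η · ∇Φ` of the commutator in terms of `∇²φ`. -/
theorem sum_pd_eta_mul_pd (hΩ : IsSmoothDomain Ω) (hφ : ContDiffOn ℝ ∞ φ (closure Ω)) (s T h : ℝ)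
    {t : ℝ} (ht : Gam T h t ≠ 0) {x : E (m + 1)} (hx : x ∈ Ω) :
    ∑ i, pd Ω i (eta Ω (weight φ s T h) t) x * pd Ω i (weight φ s T h t) x
      = 2 / Gam T h t * (1 / 4 * gradSq Ω (weight φ s T h t) x + s / 4 * ∑ i, ∑ j,
        pd Ω i (weight φ s T h t) x * pd Ω i (pd Ω j φ) x * pd Ω j (weight φ s T h t) x) := by
  have hw := contDiffOn_weight hφ s T h t
  have hη : ∀ i, pd Ω i (eta Ω (weight φ s T h) t) x
      = 1 / (2 * Gam T h t) * pd Ω i (weight φ s T h t) x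
        + 1 / 2 * ∑ j, s / Gam T h t * pd Ω i (pd Ω j φ) x * pd Ω j (weight φ s T h t) x := by
    intro i
    rw [eta_weight Ω φ s T h ht, hΩ.pd_add (contDiffOn_const.mul hw)
      (contDiffOn_const.mul (hΩ.contDiffOn_gradSq hw)) i hx, hΩ.pd_const_mul hw _ i hx,
      hΩ.pd_const_mul (hΩ.contDiffOn_gradSq hw) _ i hx, hΩ.pd_gradSq hw i hx]
    simp only [hΩ.pd_pd_weight hφ s T h t i _ hx]
    ring
  simp only [hη, gradSq, mul_add, Finset.mul_sum, ← Finset.sum_add_distrib, add_mul,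
    Finset.sum_mul]
  refine Finset.sum_congr rfl fun i _ => ?_
  congr 1
  · field_simp
    ring
  · refine Finset.sum_congr rfl fun j _ => ?_
    field_simp
    ring

end IsSmoothDomain

end Weight

end HeatCarleman

theorem proposition2 {n : ℕ} (hn : 1 ≤ n) (Ω : Set (E n)) (hΩo : IsOpen Ω)
    (hΩc : IsConnected Ω) (hΩb : Bornology.IsBounded Ω) (hΩs : HasSmoothBoundary Ω)
    (φ : E n → ℝ) (hφ : ContDiffOn ℝ ∞ φ (closure Ω))
    (s T h t : ℝ) (hs : 0 < s) (hh : 0 < h) (ht : t < T + h)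
    (Φ : ℝ → E n → ℝ) (hΦ : Φ = weight φ s T h)
    (f : E n → ℝ) (hf : MemH2 Ω f) :
    -- identity (i)
    (∫ x in Ω, opA Ω Φ t f x * f x
        = - (1 / 2) * ∫ x, pdNormal Ω (Φ t) x * trace Ω f x ^ 2 ∂(surfaceMeasure Ω)) ∧
    -- identity (ii)
    (∫ x in Ω, opS Ω Φ t f x * f x
        = (∫ x in Ω, ∑ i, weakPartial Ω i f x ^ 2) - (∫ x in Ω, eta Ω Φ t x * f x ^ 2)
          - ∫ x, traceNormal Ω f x * trace Ω f x ∂(surfaceMeasure Ω)) ∧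
    -- identity (iii)
    ((∫ x in Ω, opS' Ω Φ t f x * f x) + 2 * (∫ x in Ω, opS Ω Φ t f x * opA Ω Φ t f x)
        = - 2 * (∫ x in Ω, ∑ i, ∑ j,
              weakPartial Ω i f x * pd Ω i (pd Ω j (Φ t)) x * weakPartial Ω j f x)
          - (∫ x in Ω, (∑ i, weakPartial Ω i f x * lap Ω (pd Ω i (Φ t)) x) * f x)
          - 2 / Gam T h t * (∫ x in Ω, (eta Ω Φ t x + 1 / 4 * gradSq Ω (Φ t) x
              + s / 4 * ∑ i, ∑ j, pd Ω i (Φ t) x * pd Ω i (pd Ω j φ) x * pd Ω j (Φ t) x)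
                * f x ^ 2)
          + (2 * (∫ x, traceNormal Ω f x
                * (∑ i, pd Ω i (Φ t) x * trace Ω (weakPartial Ω i f) x) ∂(surfaceMeasure Ω))
            - (∫ x, pdNormal Ω (Φ t) x
                * (∑ i, trace Ω (weakPartial Ω i f) x ^ 2) ∂(surfaceMeasure Ω))
            + (∫ x, traceNormal Ω f x * lap Ω (Φ t) x * trace Ω f x ∂(surfaceMeasure Ω))
            + (∫ x, eta Ω Φ t x * pdNormal Ω (Φ t) x * trace Ω f x ^ 2
                ∂(surfaceMeasure Ω)))) ∧
    -- every integral above converges absolutely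
    (IntegrableOn (fun x => opA Ω Φ t f x * f x) Ω ∧
      IntegrableOn (fun x => opS Ω Φ t f x * f x) Ω ∧
      IntegrableOn (fun x => ∑ i, weakPartial Ω i f x ^ 2) Ω ∧
      IntegrableOn (fun x => eta Ω Φ t x * f x ^ 2) Ω ∧
      IntegrableOn (fun x => opS' Ω Φ t f x * f x) Ω ∧
      IntegrableOn (fun x => opS Ω Φ t f x * opA Ω Φ t f x) Ω ∧
      IntegrableOn (fun x => ∑ i, ∑ j,
        weakPartial Ω i f x * pd Ω i (pd Ω j (Φ t)) x * weakPartial Ω j f x) Ω ∧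
      IntegrableOn (fun x => (∑ i, weakPartial Ω i f x * lap Ω (pd Ω i (Φ t)) x) * f x) Ω ∧
      IntegrableOn (fun x => (eta Ω Φ t x + 1 / 4 * gradSq Ω (Φ t) x
        + s / 4 * ∑ i, ∑ j, pd Ω i (Φ t) x * pd Ω i (pd Ω j φ) x * pd Ω j (Φ t) x)
          * f x ^ 2) Ω ∧
      Integrable (fun x => pdNormal Ω (Φ t) x * trace Ω f x ^ 2) (surfaceMeasure Ω) ∧
      Integrable (fun x => traceNormal Ω f x * trace Ω f x) (surfaceMeasure Ω) ∧
      Integrable (fun x => traceNormal Ω f x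
        * (∑ i, pd Ω i (Φ t) x * trace Ω (weakPartial Ω i f) x)) (surfaceMeasure Ω) ∧
      Integrable (fun x => pdNormal Ω (Φ t) x
        * (∑ i, trace Ω (weakPartial Ω i f) x ^ 2)) (surfaceMeasure Ω) ∧
      Integrable (fun x => traceNormal Ω f x * lap Ω (Φ t) x * trace Ω f x)
        (surfaceMeasure Ω) ∧
      Integrable (fun x => eta Ω Φ t x * pdNormal Ω (Φ t) x * trace Ω f x ^ 2)
        (surfaceMeasure Ω)) := by
  obtain ⟨m, rfl⟩ : ∃ m, n = m + 1 := ⟨n - 1, by omega⟩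
  have hΩ : IsSmoothDomain Ω := ⟨hΩo, hΩb, hΩs⟩
  subst hΦ
  have hΓ : Gam T h t ≠ 0 := by
    rw [Gam]
    linarith
  set g : E (m + 1) → ℝ := weight φ s T h t with hgdef
  have hg : ContDiffOn ℝ ∞ g (closure Ω) := contDiffOn_weight hφ s T h t
  have hη := hΩ.contDiffOn_eta hφ s T h hΓ
  set η : E (m + 1) → ℝ := eta Ω (weight φ s T h) t with hηdef
  -- all interior factors are in `L²(Ω)`
  have f2 := hf.1.1
  have F2 := fun i => (hf.1.weakPartial_spec i).1
  have H2 := fun i => ((hf.2 i).weakPartial_spec i).1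
  have hP := fun i => (hΩ.contDiffOn_pd i hg).continuousOn
  have hQ := fun i j => (hΩ.contDiffOn_pd i (hΩ.contDiffOn_pd j hg)).continuousOn
  have hQφ := fun i j => (hΩ.contDiffOn_pd i (hΩ.contDiffOn_pd j hφ)).continuousOn
  have ηf2 := hΩ.memLp_mul_volume hη.continuousOn f2
  have A2 : MemLp (opA Ω (weight φ s T h) t f) 2 (volume.restrict Ω) :=
    (memLp_finsetSum _ fun i _ => hΩ.memLp_mul_volume (hP i) (F2 i)).neg.sub
      (hΩ.memLp_mul_volume (continuousOn_const.mul (hΩ.contDiffOn_lap hg).continuousOn) f2)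
  have S2 : MemLp (opS Ω (weight φ s T h) t f) 2 (volume.restrict Ω) :=
    (memLp_finsetSum _ fun i _ => H2 i).neg.sub ηf2
  have hS' : (fun x => -(2 / Gam T h t) * (η x * f x ^ 2)) =ᵐ[volume.restrict Ω]
      fun x => opS' Ω (weight φ s T h) t f x * f x := by
    filter_upwards [ae_restrict_mem hΩo.measurableSet] with x hx
    rw [opS', hΩ.deriv_eta hφ s T h hΓ hx]
    ring
  -- all boundary factors are in `L²(∂Ω)`
  have tf := (hΩ.isTrace_trace hf.1).1
  have tF := fun i => (hΩ.isTrace_trace (hf.2 i)).1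
  have tn := hΩ.memLp_traceNormal hf
  have hν := hΩ.continuousOn_pdNormal hg
  have hLb := (hΩ.contDiffOn_lap hg).continuousOn.mono frontier_subset_closure
  have hηb := hη.continuousOn.mono frontier_subset_closure
  -- every integrand is a sum of products of two such factors
  have iA : IntegrableOn (fun x => opA Ω (weight φ s T h) t f x * f x) Ω := A2.integrable_mul f2
  have iS : IntegrableOn (fun x => opS Ω (weight φ s T h) t f x * f x) Ω := S2.integrable_mul f2
  have iF : IntegrableOn (fun x => ∑ i, weakPartial Ω i f x ^ 2) Ω :=
    integrable_finsetSum _ fun i _ => (F2 i).integrable_sq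
  have mul_sq : ∀ {a : E (m + 1) → ℝ}, ContinuousOn a (closure Ω) →
      IntegrableOn (fun x => a x * f x ^ 2) Ω := fun {a} ha =>
    ((hΩ.memLp_mul_volume ha f2).integrable_mul f2).congr
      (Eventually.of_forall fun x => by simp only [Pi.mul_apply]; ring)
  have iη : IntegrableOn (fun x => η x * f x ^ 2) Ω := mul_sq hη.continuousOn
  have iS' : IntegrableOn (fun x => opS' Ω (weight φ s T h) t f x * f x) Ω :=
    (iη.const_mul _).congr hS'
  have iSA : IntegrableOn (fun x =>
      opS Ω (weight φ s T h) t f x * opA Ω (weight φ s T h) t f x) Ω := S2.integrable_mul A2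
  have iQ : IntegrableOn (fun x => ∑ i, ∑ j,
      weakPartial Ω i f x * pd Ω i (pd Ω j g) x * weakPartial Ω j f x) Ω :=
    integrable_finsetSum _ fun i _ => integrable_finsetSum _ fun j _ =>
      ((hΩ.memLp_mul_volume (hQ i j) (F2 i)).integrable_mul (F2 j)).congr
        (Eventually.of_forall fun x => by simp only [Pi.mul_apply]; ring)
  have iL : IntegrableOn (fun x => (∑ i, weakPartial Ω i f x * lap Ω (pd Ω i g) x) * f x) Ω := by
    have h1 : MemLp (fun x => ∑ i, weakPartial Ω i f x * lap Ω (pd Ω i g) x) 2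
        (volume.restrict Ω) := memLp_finsetSum _ fun i _ => by
      simpa only [mul_comm] using hΩ.memLp_mul_volume
        (hΩ.contDiffOn_lap (hΩ.contDiffOn_pd i hg)).continuousOn (F2 i)
    exact h1.integrable_mul f2
  have hG : ContinuousOn (fun x => 1 / 4 * gradSq Ω g x
      + s / 4 * ∑ i, ∑ j, pd Ω i g x * pd Ω i (pd Ω j φ) x * pd Ω j g x) (closure Ω) :=
    (continuousOn_const.mul (hΩ.contDiffOn_gradSq hg).continuousOn).add
      (continuousOn_const.mul (continuousOn_finsetSum _ fun i _ => continuousOn_finsetSum _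
        fun j _ => ((hP i).mul (hQφ i j)).mul (hP j)))
  have iG : IntegrableOn (fun x => (η x + 1 / 4 * gradSq Ω g x
      + s / 4 * ∑ i, ∑ j, pd Ω i g x * pd Ω i (pd Ω j φ) x * pd Ω j g x) * f x ^ 2) Ω :=
    by
    have h1 := mul_sq (hη.continuousOn.add hG)
    simpa only [Pi.add_apply, ← add_assoc] using h1
  have bS : ∀ {a : E (m + 1) → ℝ}, ContinuousOn a (frontier Ω) →
      Integrable (fun x => a x * trace Ω f x ^ 2) (surfaceMeasure Ω) := fun {a} ha =>
    ((hΩ.memLp_mul_surface ha tf).integrable_mul tf).congr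
      (Eventually.of_forall fun x => by simp only [Pi.mul_apply]; ring)
  have b1 : Integrable (fun x => traceNormal Ω f x * trace Ω f x) (surfaceMeasure Ω) :=
    tn.integrable_mul tf
  have b2 : Integrable (fun x => traceNormal Ω f x
      * (∑ i, pd Ω i g x * trace Ω (weakPartial Ω i f) x)) (surfaceMeasure Ω) :=
    tn.integrable_mul (memLp_finsetSum _ fun i _ =>
      hΩ.memLp_mul_surface ((hP i).mono frontier_subset_closure) (tF i))
  have b3 : Integrable (fun x => pdNormal Ω g x
      * (∑ i, trace Ω (weakPartial Ω i f) x ^ 2)) (surfaceMeasure Ω) := by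
    simp only [Finset.mul_sum]
    exact integrable_finsetSum _ fun i _ => ((hΩ.memLp_mul_surface hν (tF i)).integrable_mul
      (tF i)).congr (Eventually.of_forall fun x => by simp only [Pi.mul_apply]; ring)
  have b4 : Integrable (fun x => traceNormal Ω f x * lap Ω g x * trace Ω f x)
      (surfaceMeasure Ω) :=
    ((hΩ.memLp_mul_surface hLb tn).integrable_mul tf).congr
      (Eventually.of_forall fun x => by simp only [Pi.mul_apply]; ring)
  have b5 : Integrable (fun x => η x * pdNormal Ω g x * trace Ω f x ^ 2) (surfaceMeasure Ω) :=
    bS (hηb.mul hν)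
  refine ⟨?_, ?_, ?_, iA, iS, iF, iη, iS', iSA, iQ, iL, iG, bS hν, b1, b2, b3, b4, b5⟩
  · rw [← integral_const_mul]
    exact (hΩ.hasFlux_transport hg hf.1).2.2
  · have h1 := (hΩ.hasFlux_green hf).2.2
    have h2 : ∫ x in Ω, ((∑ i, weakPartial Ω i (weakPartial Ω i f) x) * f x
        + ∑ i, weakPartial Ω i f x ^ 2) = ∫ x in Ω, ((∑ i, weakPartial Ω i f x ^ 2)
          - η x * f x ^ 2 - opS Ω (weight φ s T h) t f x * f x) :=
      integral_congr_ae (Eventually.of_forall fun x => by simp only [opS, ← hηdef]; ring)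
    rw [h2, integral_sub (iF.fun_sub iη) iS, integral_sub iF iη] at h1
    linarith
  · have h1 := (hΩ.hasFlux_commutator hg hη hf).2.2
    have h2 : ∫ x in Ω, (2 * (∑ i, ∑ j,
          weakPartial Ω i f x * pd Ω i (pd Ω j g) x * weakPartial Ω j f x)
        + 2 * ((-(∑ i, weakPartial Ω i (weakPartial Ω i f) x) - η x * f x)
          * (-(∑ i, pd Ω i g x * weakPartial Ω i f x) - 1 / 2 * lap Ω g x * f x))
        + (∑ i, weakPartial Ω i f x * lap Ω (pd Ω i g) x) * f x
        + (∑ i, pd Ω i η x * pd Ω i g x) * f x ^ 2)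
      = ∫ x in Ω, (2 * (∑ i, ∑ j,
          weakPartial Ω i f x * pd Ω i (pd Ω j g) x * weakPartial Ω j f x)
        + 2 * (opS Ω (weight φ s T h) t f x * opA Ω (weight φ s T h) t f x)
        + (∑ i, weakPartial Ω i f x * lap Ω (pd Ω i g) x) * f x
        + (2 / Gam T h t * ((η x + 1 / 4 * gradSq Ω g x
          + s / 4 * ∑ i, ∑ j, pd Ω i g x * pd Ω i (pd Ω j φ) x * pd Ω j g x) * f x ^ 2)
          + opS' Ω (weight φ s T h) t f x * f x)) := by
      refine integral_congr_ae ?_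
      filter_upwards [hS', ae_restrict_mem hΩo.measurableSet] with x hx hxΩ
      rw [← hx, hΩ.sum_pd_eta_mul_pd hφ s T h hΓ hxΩ]
      simp only [opS, opA, ← hηdef, ← hgdef]
      ring
    rw [h2, integral_add (((iQ.const_mul 2).fun_add (iSA.const_mul 2)).fun_add iL)
        ((iG.const_mul _).fun_add iS'), integral_add_three (iQ.const_mul 2) (iSA.const_mul 2) iL,
      integral_add (iG.const_mul _) iS',
      integral_add (((b2.const_mul 2).fun_add (b3.const_mul (-1))).fun_add b4) b5,
      integral_add_three (b2.const_mul 2) (b3.const_mul (-1)) b4] at h1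
    simp only [integral_const_mul] at h1
    linarith
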